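/- Let $n\ge 3$ and let $e_1,\dots,e_n$ be the standard basis of the Lie algebra $\mathfrak t\cong\mathbb R^n$ of the diagonal maximal torus of $\mathrm U(n)$ (so $x\in\mathbb R^n$ stands for $\mathrm{diag}(ix_1,\dots,ix_n)$). Put $e=e_1+\dots+e_n$, and for $x\in\mathbb R^n$ let $x'=x-\frac{x_1+\dots+x_n}{n}\,e$ be its trace-free part. Let $S_{12}\subset \mathrm{SU}(n)\times \mathrm{SU}(n)$ be the torus with Lie algebra spanned by $$\bigl((2e_1)';\,(e_1+e_n)'\bigr)\quad\text{and}\quad (0;\,e_i-e_1),\qquad 2\le i\le n-1,$$ acting on $\mathrm{SU}(n)$ by $(h_l,h_r)\cdot g=h_l\,g\,h_r^{-1}$. This action is free modulo its kernel; let $\mathrm{SU}(n)/\!/S_{12}$ be its orbit space (the biquotient) with the quotient smooth structure. Let $\mathrm U(n-1)$ act on $\mathrm{SU}(n)$ by $$A\cdot g=\begin{pmatrix}\det(A)^2&0\\0&I_{n-1}\end{pmatrix}\,g\,\begin{pmatrix}A&0\\0&\det(A)\end{pmatrix}^{-1},$$ and let $E=\mathrm{SU}(n)\times_{\mathrm U(n-1)}\mathbb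 C^{n-1}$ be the quotient of $\mathrm{SU}(n)\times\mathbb C^{n-1}$ by the action $A\cdot(g,v)=(A\cdot g,Av)$, with the quotient smooth structure. With the projection $$E\to\mathbb CP^{n-1},\qquad [g,v]\mapsto[\,g_{1n}:\overline{g_{2n}}:\dots:\overline{g_{nn}}\,],$$ and the complex linear structure on the fibres for which all the maps $v\mapsto[g,v]$ are linear isomorphisms of $\mathbb C^{n-1}$ onto fibres, $E$ is a smooth complex vector bundle of rank $n-1$ over $\mathbb CP^{n-1}$. Let $F(E)\to\mathbb CP^{n-1}$ be the full flag bundle of $E$: its total space consists of the pairs $(b,(V_1\subset\dots\subset V_{n-1}=E_b))$ with $b\in\mathbb CP^{n-1}$ and $\dim_{\mathbb C}V_i=i$, with the smooth structure for which local trivializations of $E$ over $U$ induce diffeomorphisms from $F(E)|_U$ to $U\times F(\mathbb C^{n-1})$. Then $\mathrm{SU}(n)/\!/S_{12}$ is diffeomorphic to the total space of $F(E)$. -/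

import Mathlib

open scoped Manifold ContDiff Matrix LinearAlgebra.Projectivization Bundle

noncomputable section

/-! ### Smooth manifold structures -/

/-- A smooth (`C^∞`) manifold structure without boundary on a topological space `X`: an atlas
modelled on a finite-dimensional real vector space, on a Hausdorff second countable space. -/
structure SmoothStructure (X : Type) [TopologicalSpace X] where
  /-- the model space -/
  V : Type
  [normedAddCommGroup : NormedAddCommGroup V]
  [normedSpace : NormedSpace ℝ V]
  [finiteDimensional : FiniteDimensional ℝ V]
  [chartedSpace : ChartedSpace V X]
  [isManifold : IsManifold 𝓘(ℝ, V) ∞ X]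
  [t2Space : T2Space X]
  [secondCountable : SecondCountableTopology X]

attribute [instance] SmoothStructure.normedAddCommGroup SmoothStructure.normedSpace
  SmoothStructure.finiteDimensional SmoothStructure.chartedSpace SmoothStructure.isManifold

section Submersion

variable {V W H K M N : Type} [NormedAddCommGroup V] [NormedSpace ℝ V] [NormedAddCommGroup W]
  [NormedSpace ℝ W] [TopologicalSpace H] [TopologicalSpace K] [TopologicalSpace M]
  [ChartedSpace H M] [TopologicalSpace N] [ChartedSpace K N]

/-- Surjective smooth submersions. If `M` carries a smooth structure and `f : M → N` is a
surjection, then there is at most one smooth structure on `N` for which `f` has this property;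
it is the quotient smooth structure. -/
def IsSurjectiveSubmersion (I : ModelWithCorners ℝ V H) (J : ModelWithCorners ℝ W K)
    (f : M → N) : Prop :=
  Function.Surjective f ∧ ContMDiff I J ∞ f ∧ ∀ x : M, Function.Surjective (mfderiv I J f x)

/-- Smooth embeddings (topological embeddings that are smooth immersions). If `N` carries a
smooth structure and `f : M → N` is a topological embedding, then there is at most one smooth
structure on `M` for which `f` has this property; it is the submanifold structure. -/
def IsEmbeddingSmooth (I : ModelWithCorners ℝ V H) (J : ModelWithCorners ℝ W K)
    (f : M → N) : Prop :=
  Topology.IsEmbedding f ∧ ContMDiff I J ∞ f ∧ ∀ x : M, Function.Injective (mfderiv I J f x)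

end Submersion

/-! ### Biquotients -/

/-- The orbit relation on `G` of the action `(h_l, h_r) · g = h_l * g * h_r⁻¹` of a subgroup
`H ⊆ G × G`. -/
def biquotientSetoid {G : Type} [Group G] (H : Subgroup (G × G)) : Setoid G where
  r g g' := ∃ h ∈ H, g' = h.1 * g * h.2⁻¹
  iseqv :=
    { refl := fun g => ⟨1, H.one_mem, by simp⟩
      symm := by
        rintro g _ ⟨h, hh, rfl⟩
        exact ⟨h⁻¹, H.inv_mem hh, by simp [mul_assoc]⟩
      trans := by
        rintro g _ _ ⟨h, hh, rfl⟩ ⟨k, hk, rfl⟩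
        exact ⟨k * h, H.mul_mem hk hh, by simp [mul_assoc]⟩ }

/-- The biquotient `G//H`, the orbit space of the two-sided action of `H ⊆ G × G` on `G`. -/
def Biquotient {G : Type} [Group G] (H : Subgroup (G × G)) : Type :=
  Quotient (biquotientSetoid H)

instance {G : Type} [Group G] [TopologicalSpace G] (H : Subgroup (G × G)) :
    TopologicalSpace (Biquotient H) :=
  inferInstanceAs (TopologicalSpace (Quotient (biquotientSetoid H)))

/-- The orbit map `G → G//H`. -/
def Biquotient.mk {G : Type} [Group G] (H : Subgroup (G × G)) (g : G) : Biquotient H :=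
  Quotient.mk (biquotientSetoid H) g

/-- The action of `H ⊆ G × G` on `G` is free modulo its kernel: an element of `H` that fixes some
point of `G` fixes every point of `G`. -/
def ActsFreelyModKernel {G : Type} [Group G] (H : Subgroup (G × G)) : Prop :=
  ∀ h ∈ H, (∃ g : G, h.1 * g * h.2⁻¹ = g) → ∀ g : G, h.1 * g * h.2⁻¹ = g

/-! ### The torus `S₁₂` in `SU(n) × SU(n)`, where `n = m + 1` -/

/-- The special unitary group `SU(m + 1)`. -/
abbrev SU (m : ℕ) : Type := Matrix.specialUnitaryGroup (Fin (m + 1)) ℂ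

/-- The standard basis of the Lie algebra of the diagonal torus of `U(m + 1)`; this Lie algebra is
identified with `ℝ^(m + 1)`, a vector `x` standing for the matrix `diag(i x_0, …, i x_m)`. -/
def lieE {m : ℕ} (j : Fin (m + 1)) : Fin (m + 1) → ℝ := Pi.single j 1

/-- The projection `x ↦ x'` to the trace-free part, along the complement spanned by
`e = (1, …, 1)`. -/
def tracefree {m : ℕ} (x : Fin (m + 1) → ℝ) : Fin (m + 1) → ℝ :=
  fun j => x j - (∑ i, x i) / (m + 1)

/-- The Lie algebra `𝔰₁₂ = ⟨(2e_1; e_1 + e_n)', (0; e_i - e_1), 2 ≤ i ≤ n - 1⟩`; indices are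
shifted by one, so `e_1` is `lieE 0` and `e_n` is `lieE (Fin.last m)`. -/
def lieS12 (m : ℕ) : Submodule ℝ ((Fin (m + 1) → ℝ) × (Fin (m + 1) → ℝ)) :=
  Submodule.span ℝ
    ({(tracefree ((2 : ℝ) • lieE 0), tracefree (lieE 0 + lieE (Fin.last m)))} ∪
      {p | ∃ i : Fin (m + 1), i ≠ 0 ∧ i ≠ Fin.last m ∧ p = (0, lieE i - lieE 0)})

/-- The exponential map of the diagonal torus, `x ↦ diag(exp(i x_0), …, exp(i x_m))`. -/
def torusExp {m : ℕ} (x : Fin (m + 1) → ℝ) : Matrix (Fin (m + 1)) (Fin (m + 1)) ℂ :=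
  Matrix.diagonal fun j => Complex.exp (x j * Complex.I)

theorem torusExp_zero {m : ℕ} : torusExp (0 : Fin (m + 1) → ℝ) = 1 := by
  simp [torusExp]

theorem torusExp_add {m : ℕ} (x y : Fin (m + 1) → ℝ) :
    torusExp (x + y) = torusExp x * torusExp y := by
  simp [torusExp, Matrix.diagonal_mul_diagonal, add_mul, Complex.exp_add]

theorem torusExp_neg {m : ℕ} (x : Fin (m + 1) → ℝ) : torusExp (-x) = (torusExp x)ᴴ := by
  unfold torusExp
  rw [Matrix.diagonal_conjTranspose]
  congr 1
  funext j
  simp [← Complex.exp_conj]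

/-- The torus `S₁₂ ⊆ SU(m + 1) × SU(m + 1)`, the image of `𝔰₁₂` under the exponential map. -/
def S12 (m : ℕ) : Subgroup (SU m × SU m) where
  carrier := {p | ∃ x ∈ lieS12 m, p.1.1 = torusExp x.1 ∧ p.2.1 = torusExp x.2}
  one_mem' := ⟨0, Submodule.zero_mem _, by simp [torusExp_zero], by simp [torusExp_zero]⟩
  mul_mem' := by
    rintro p q ⟨x, hx, h1, h2⟩ ⟨y, hy, k1, k2⟩
    exact ⟨x + y, Submodule.add_mem _ hx hy, by simp [torusExp_add, h1, k1],
      by simp [torusExp_add, h2, k2]⟩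
  inv_mem' := by
    rintro p ⟨x, hx, h1, h2⟩
    refine ⟨-x, Submodule.neg_mem _ hx, ?_, ?_⟩
    · rw [Prod.fst_neg, torusExp_neg, ← h1]; rfl
    · rw [Prod.snd_neg, torusExp_neg, ← h2]; rfl

/-! ### Complex projective space -/

/-- Complex projective space `ℂP^m`. -/
abbrev CP (m : ℕ) : Type := ℙ ℂ (Fin (m + 1) → ℂ)

/-- `ℂ^(m + 1) ∖ {0}` as an open subset of `ℂ^(m + 1)`. -/
def puncturedSpace (m : ℕ) : TopologicalSpace.Opens (Fin (m + 1) → ℂ) :=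
  ⟨{v | v ≠ 0}, isOpen_ne⟩

/-- The projection `ℂ^(m + 1) ∖ {0} → ℂP^m`. -/
def CP.mk {m : ℕ} (v : puncturedSpace m) : CP m := Projectivization.mk ℂ v.1 v.2

instance (m : ℕ) : TopologicalSpace (CP m) :=
  TopologicalSpace.coinduced (CP.mk (m := m)) inferInstance

/-! ### The associated vector bundle `SU(n) ×_{U(n-1)} ℂ^(n-1)`, where `n = m + 1` -/

/-- The homomorphism `A ↦ diag(det(A)², 1, …, 1)` from `U(m)` to matrices of size `m + 1`. -/
def leftFactor (m : ℕ) :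
    Matrix.unitaryGroup (Fin m) ℂ →* Matrix (Fin (m + 1)) (Fin (m + 1)) ℂ where
  toFun A := Matrix.diagonal (Fin.cons (A.1.det ^ 2) fun _ => 1)
  map_one' := by
    rw [← Matrix.diagonal_one]
    congr 1
    funext i
    refine Fin.cases ?_ (fun j => ?_) i <;> simp
  map_mul' A B := by
    rw [Matrix.diagonal_mul_diagonal]
    congr 1
    funext i
    refine Fin.cases ?_ (fun j => ?_) i <;> simp [mul_pow]

/-- The homomorphism from `U(m)` to matrices of size `m + 1` that sends `A` to the block diagonal
matrix with blocks `A` and `det(A)`. -/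
def rightFactor (m : ℕ) :
    Matrix.unitaryGroup (Fin m) ℂ →* Matrix (Fin (m + 1)) (Fin (m + 1)) ℂ where
  toFun A := Matrix.reindex finSumFinEquiv finSumFinEquiv
    (Matrix.fromBlocks A.1 0 0 (A.1.det • (1 : Matrix (Fin 1) (Fin 1) ℂ)))
  map_one' := by simp
  map_mul' A B := by
    simp [Matrix.submatrix_mul_equiv, Matrix.fromBlocks_multiply, smul_smul, mul_comm]

theorem leftFactor_det (m : ℕ) (A : Matrix.unitaryGroup (Fin m) ℂ) :
    (leftFactor m A).det = A.1.det ^ 2 := by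
  simp [leftFactor, Matrix.det_diagonal, Fin.prod_univ_succ]

theorem rightFactor_det (m : ℕ) (A : Matrix.unitaryGroup (Fin m) ℂ) :
    (rightFactor m A).det = A.1.det ^ 2 := by
  simp [rightFactor, sq]

theorem leftFactor_inv (m : ℕ) (A : Matrix.unitaryGroup (Fin m) ℂ) :
    leftFactor m A⁻¹ = star (leftFactor m A) := by
  have h : (A⁻¹).1 = (A.1)ᴴ := rfl
  simp only [leftFactor, MonoidHom.coe_mk, OneHom.coe_mk, Matrix.star_eq_conjTranspose,
    Matrix.diagonal_conjTranspose, h, Matrix.det_conjTranspose]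
  congr 1
  funext i
  refine Fin.cases ?_ (fun j => ?_) i <;> simp

theorem rightFactor_inv (m : ℕ) (A : Matrix.unitaryGroup (Fin m) ℂ) :
    rightFactor m A⁻¹ = star (rightFactor m A) := by
  have h : (A⁻¹).1 = (A.1)ᴴ := rfl
  simp [rightFactor, Matrix.star_eq_conjTranspose, h, Matrix.det_conjTranspose,
    Matrix.fromBlocks_conjTranspose]

theorem leftFactor_mem (m : ℕ) (A : Matrix.unitaryGroup (Fin m) ℂ) :
    leftFactor m A ∈ Matrix.unitaryGroup (Fin (m + 1)) ℂ := by
  rw [Matrix.mem_unitaryGroup_iff, ← leftFactor_inv, ← map_mul, mul_inv_cancel, map_one]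

theorem rightFactor_inv_mem (m : ℕ) (A : Matrix.unitaryGroup (Fin m) ℂ) :
    (rightFactor m A)⁻¹ ∈ Matrix.unitaryGroup (Fin (m + 1)) ℂ := by
  have h : (rightFactor m A)⁻¹ = rightFactor m A⁻¹ := by
    apply Matrix.inv_eq_right_inv
    rw [← map_mul, mul_inv_cancel, map_one]
  rw [h, Matrix.mem_unitaryGroup_iff, ← rightFactor_inv, ← map_mul, mul_inv_cancel, map_one]

theorem twistedAct_mem (m : ℕ) (A : Matrix.unitaryGroup (Fin m) ℂ) (g : SU m) :
    leftFactor m A * g.1 * (rightFactor m A)⁻¹ ∈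
      Matrix.specialUnitaryGroup (Fin (m + 1)) ℂ := by
  rw [Matrix.mem_specialUnitaryGroup_iff]
  refine ⟨mul_mem (mul_mem (leftFactor_mem m A) g.2.1) (rightFactor_inv_mem m A), ?_⟩
  have hA : A.1.det ≠ 0 := by
    intro h0
    have h1 := congrArg Matrix.det (Matrix.mem_unitaryGroup_iff.1 A.2)
    rw [Matrix.det_mul, h0, zero_mul, Matrix.det_one] at h1
    exact zero_ne_one h1
  have hg : g.1.det = 1 := (Matrix.mem_specialUnitaryGroup_iff.1 g.2).2
  rw [Matrix.det_mul, Matrix.det_mul, Matrix.det_nonsing_inv, leftFactor_det, rightFactor_det, hg]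
  simp [hA]

/-- The free two-sided action of `U(m)` on `SU(m + 1)`,
`A · g = diag(det(A)², 1, …, 1) * g * diag(A, det(A))⁻¹`. -/
def twistedAct {m : ℕ} (A : Matrix.unitaryGroup (Fin m) ℂ) (g : SU m) : SU m :=
  ⟨leftFactor m A * g.1 * (rightFactor m A)⁻¹, twistedAct_mem m A g⟩

theorem twistedAct_one {m : ℕ} (g : SU m) : twistedAct 1 g = g := by
  apply Subtype.ext
  simp [twistedAct]

theorem twistedAct_mul {m : ℕ} (A B : Matrix.unitaryGroup (Fin m) ℂ) (g : SU m) :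
    twistedAct (A * B) g = twistedAct A (twistedAct B g) := by
  apply Subtype.ext
  simp [twistedAct, Matrix.mul_inv_rev, mul_assoc]

/-- The orbit relation of the diagonal action `A · (g, v) = (A · g, A v)` of `U(m)` on
`SU(m + 1) × ℂ^m`. -/
def assocSetoid (m : ℕ) : Setoid (SU m × (Fin m → ℂ)) where
  r p q := ∃ A : Matrix.unitaryGroup (Fin m) ℂ, q = (twistedAct A p.1, A.1 *ᵥ p.2)
  iseqv :=
    { refl := fun p => ⟨1, by simp [twistedAct_one]⟩
      symm := by
        rintro p _ ⟨A, rfl⟩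
        refine ⟨A⁻¹, Prod.ext ?_ ?_⟩
        · simp [← twistedAct_mul, twistedAct_one]
        · change p.2 = (A⁻¹).1 *ᵥ (A.1 *ᵥ p.2)
          rw [Matrix.mulVec_mulVec, ← Submonoid.coe_mul, inv_mul_cancel]
          simp
      trans := by
        rintro p _ _ ⟨A, rfl⟩ ⟨B, rfl⟩
        exact ⟨B * A, by simp [twistedAct_mul, Matrix.mulVec_mulVec]⟩ }

/-- The space `SU(m + 1) ×_{U(m)} ℂ^m`. -/
def AssocBundle (m : ℕ) : Type := Quotient (assocSetoid m)

instance (m : ℕ) : TopologicalSpace (AssocBundle m) :=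
  inferInstanceAs (TopologicalSpace (Quotient (assocSetoid m)))

/-- The projection `SU(m + 1) × ℂ^m → SU(m + 1) ×_{U(m)} ℂ^m`, `(g, v) ↦ [g, v]`. -/
def AssocBundle.mk {m : ℕ} (p : SU m × (Fin m → ℂ)) : AssocBundle m :=
  Quotient.mk (assocSetoid m) p

/-- The last column of `g`, with all entries but the first one conjugated. -/
def conjLastColumn {m : ℕ} (g : SU m) : Fin (m + 1) → ℂ :=
  Fin.cons (g.1 0 (Fin.last m)) fun j => star (g.1 j.succ (Fin.last m))

theorem conjLastColumn_ne_zero {m : ℕ} (g : SU m) : conjLastColumn g ≠ 0 := by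
  intro h
  have hcol : ∀ i, g.1 i (Fin.last m) = 0 := by
    intro i
    have hi := congrFun h i
    revert hi
    refine Fin.cases ?_ (fun j => ?_) i <;> simp [conjLastColumn]
  have hdet := Matrix.det_eq_zero_of_column_eq_zero (Fin.last m) hcol
  rw [(Matrix.mem_specialUnitaryGroup_iff.1 g.2).2] at hdet
  exact one_ne_zero hdet

/-- The map `SU(m + 1) → ℂP^m` that induces the identification of the orbit space of the action
of `U(m)` with `ℂP^m`: it sends `g` to `[g_{1n} : conj(g_{2n}) : … : conj(g_{nn})]`,
`n = m + 1`. -/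
def toCP {m : ℕ} (g : SU m) : CP m := CP.mk ⟨conjLastColumn g, conjLastColumn_ne_zero g⟩

/-! ### Full flags -/

/-- A full flag `V_1 ⊂ V_2 ⊂ … ⊂ V_m = W`, `dim V_i = i`, in an `m`-dimensional complex vector
space `W`. -/
@[ext]
structure FullFlag (m : ℕ) (W : Type) [AddCommGroup W] [Module ℂ W] where
  /-- `space i` is the subspace of dimension `i + 1`. -/
  space : Fin m → Submodule ℂ W
  mono : Monotone space
  finrank_space : ∀ i, Module.finrank ℂ (space i) = i + 1

/-- The bases of `ℂ^m`, an open subset of `(ℂ^m)^m`. -/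
def frames (m : ℕ) : TopologicalSpace.Opens (Fin m → Fin m → ℂ) :=
  ⟨{f | LinearIndependent ℂ f}, isOpen_setOfPred_linearIndependent⟩

/-- The flag `⟨a_1⟩ ⊂ ⟨a_1, a_2⟩ ⊂ … ⊂ ⟨a_1, …, a_m⟩` of a basis `a_1, …, a_m` of `ℂ^m`. -/
def flagOfFrame {m : ℕ} (a : frames m) : FullFlag m (Fin m → ℂ) where
  space i := Submodule.span ℂ (a.1 '' Set.Iic i)
  mono _ _ h := Submodule.span_mono (Set.image_mono (Set.Iic_subset_Iic.2 h))
  finrank_space i := by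
    have h : LinearIndependent ℂ a.1 := a.2
    rw [Set.image_eq_range]
    have h2 := finrank_span_eq_card (h.comp (fun j : Set.Iic i => j.1) Subtype.val_injective)
    rw [Function.comp_def] at h2
    rw [h2]
    simp

/-- The topology of the flag manifold of `ℂ^m`, as a quotient of the space of bases. -/
instance (m : ℕ) : TopologicalSpace (FullFlag m (Fin m → ℂ)) :=
  TopologicalSpace.coinduced (flagOfFrame (m := m)) inferInstance

/-! ### Smooth complex vector bundles and their flag bundles -/

/-- A smooth complex vector bundle of rank `m` over a smooth manifold `B`. -/
structure SmoothComplexVectorBundle {B : Type} [TopologicalSpace B] (S : SmoothStructure B)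
    (m : ℕ) where
  /-- the fibre over a point -/
  fiber : B → Type
  [addCommGroup : ∀ b, AddCommGroup (fiber b)]
  [module : ∀ b, Module ℂ (fiber b)]
  [topFiber : ∀ b, TopologicalSpace (fiber b)]
  [topTotal : TopologicalSpace (Bundle.TotalSpace (Fin m → ℂ) fiber)]
  [fiberBundle : FiberBundle (Fin m → ℂ) fiber]
  [vectorBundle : VectorBundle ℂ (Fin m → ℂ) fiber]
  [vectorBundleReal : VectorBundle ℝ (Fin m → ℂ) fiber]
  [smooth : ContMDiffVectorBundle ∞ (Fin m → ℂ) fiber 𝓘(ℝ, S.V)]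

attribute [instance] SmoothComplexVectorBundle.addCommGroup SmoothComplexVectorBundle.module
  SmoothComplexVectorBundle.topFiber SmoothComplexVectorBundle.topTotal
  SmoothComplexVectorBundle.fiberBundle SmoothComplexVectorBundle.vectorBundle
  SmoothComplexVectorBundle.vectorBundleReal SmoothComplexVectorBundle.smooth

namespace SmoothComplexVectorBundle

variable {B : Type} [TopologicalSpace B] {S : SmoothStructure B} {m : ℕ}

/-- The total space of a vector bundle. -/
abbrev Total (E : SmoothComplexVectorBundle S m) : Type :=
  Bundle.TotalSpace (Fin m → ℂ) E.fiber

/-- The total space of the full flag bundle of `E`: pairs of a point `b` of the base and a full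
flag in the fibre over `b`. -/
def FlagBundle (E : SmoothComplexVectorBundle S m) : Type :=
  Σ b : B, FullFlag m (E.fiber b)

/-- The manifold structure `T` on the total space of the flag bundle is the one for which
every local trivialization `E|_U ≅ U × ℂ^m` of the vector bundle induces a diffeomorphism of the
flag bundle over `U` with `U × Fl(ℂ^m)`. -/
def IsFlagBundleStructure (E : SmoothComplexVectorBundle S m)
    (L : SmoothStructure (FullFlag m (Fin m → ℂ))) [TopologicalSpace E.FlagBundle]
    (T : SmoothStructure E.FlagBundle) : Prop :=
  ∀ (e : Bundle.Trivialization (Fin m → ℂ) (Bundle.TotalSpace.proj : E.Total → B))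
    [MemTrivializationAtlas e],
    ∃ Φ : PartialDiffeomorph 𝓘(ℝ, T.V) (𝓘(ℝ, S.V).prod 𝓘(ℝ, L.V)) E.FlagBundle
        (B × FullFlag m (Fin m → ℂ)) ∞,
      Φ.source = {x | x.1 ∈ e.baseSet} ∧ Φ.target = e.baseSet ×ˢ Set.univ ∧
      ∀ x ∈ Φ.source, (Φ x).1 = x.1 ∧
        ∀ i, (Φ x).2.space i = (x.2.space i).map (e.linearMapAt ℂ x.1)

end SmoothComplexVectorBundle

/-- The smooth complex vector bundle `E → ℂP^m` is the associated bundle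
`SU(m + 1) ×_{U(m)} ℂ^m → ℂP^m`, `[g, v] ↦ toCP g`: there is a diffeomorphism of total spaces
that, for each `g`, restricts to a complex linear isomorphism `v ↦ [g, v]` of `ℂ^m` onto the fibre
over `toCP g`. -/
def IsAssociatedBundle {m : ℕ} {S : SmoothStructure (CP m)} (A : SmoothStructure (AssocBundle m))
    (E : SmoothComplexVectorBundle S m) : Prop :=
  ∃ Φ : Diffeomorph 𝓘(ℝ, A.V) (𝓘(ℝ, S.V).prod 𝓘(ℝ, Fin m → ℂ)) (AssocBundle m) E.Total ∞,
    ∀ g : SU m, ∃ ℓ : (Fin m → ℂ) ≃ₗ[ℂ] E.fiber (toCP g),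
      ∀ v, Φ (AssocBundle.mk (g, v)) = ⟨toCP g, ℓ v⟩

end

/-! Put n = m + 1, and let T be the diagonal torus of U(m). Exponentiating the generators of
`lieS12` shows that an element of S₁₂ is a pair (c·diag(det(A)², 1, …, 1), c·diag(A, det A)) with A
in T and one common scalar c, and c cancels in h_l g h_r⁻¹. Hence the orbits of S₁₂ are the orbits
of T under the twisted action of U(m) (`biquotient_mk_eq_iff`), and SU(n)//S₁₂ is SU(n)/T. The
orbits of U(m) itself are the fibres of `toCP` (`exists_twistedAct_eq`), so SU(n)/T fibres over ℂP^m
with fibre U(m)/T = Fl(ℂ^m). It is the flag bundle of E: the T-orbit of g corresponds to the image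
of the standard flag under v ↦ [g, v], because the stabilizer of the standard flag in U(m) is T
(`fiberFlag_eq_iff`).

To have coordinates, [g, v] is represented by w = g(v, 0), a vector orthogonal to the last column of
g. With y = `conjLastColumn g`, the action of A multiplies y by det A and the first coordinate of w
by det(A)² = det A / conj(det A). So the operation "multiply the first coordinate of w by
conj(y_j)/y_j and drop the j-th coordinate" (`fiberCoord`) is invariant, and it trivializes E where
y_j ≠ 0.

Smoothness is reduced to local sections. Two quotients of one manifold that have smooth local
sections and the same fibres are diffeomorphic (`exists_diffeomorph_of_hasSmoothSections`). This is
applied to SU(n) with the biquotient and the flag bundle as quotients, and to SU(n) × ℂ^m with the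
associated bundle and the total space of E. A section of g ↦ (`toCP g`, `fiberFlag j g`) lifts a
point and a flag to a vector and a frame, assembles these to an invertible matrix (`frameMatrix`),
and applies Gram-Schmidt with a phase correction (`specialUnitarize`), which changes neither the
flag of the columns nor the line of a last column that is orthogonal to the others
(`exists_section_fiberFlag`). The same retraction provides the manifold structure of SU(n). -/

noncomputable section

/-! ### Smooth quotients -/

section Quotients

open Topology Set

variable {E H V : Type} [NormedAddCommGroup E] [NormedSpace ℝ E] [TopologicalSpace H]
  {I : ModelWithCorners ℝ E H} {M X N : Type} [TopologicalSpace M] [ChartedSpace H M]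
  [TopologicalSpace X] [NormedAddCommGroup V] [NormedSpace ℝ V] [TopologicalSpace N]
  [ChartedSpace V N]

/-- A map has smooth local sections if through each point of its domain there passes one. -/
def HasSmoothSections {E' H' : Type} [NormedAddCommGroup E'] [NormedSpace ℝ E']
    [TopologicalSpace H'] [ChartedSpace H' X] (I : ModelWithCorners ℝ E H)
    (J : ModelWithCorners ℝ E' H') (q : M → X) : Prop :=
  ∀ x, ∃ σ : X → M, σ (q x) = x ∧ ContMDiffAt J I ∞ σ (q x) ∧ ∀ᶠ p in 𝓝 (q x), q (σ p) = p

/-- Differentiating `q ∘ σ = id` at `q x`, for a section `σ` through `x`, shows that the derivative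
of `σ` is a right inverse of the derivative of `q` at `x`. -/
theorem HasSmoothSections.isSurjectiveSubmersion {E' H' : Type} [NormedAddCommGroup E']
    [NormedSpace ℝ E'] [TopologicalSpace H'] [ChartedSpace H' X] {I : ModelWithCorners ℝ E H}
    {J : ModelWithCorners ℝ E' H'} [IsManifold I 1 M] [IsManifold J 1 X] {q : M → X}
    (h : HasSmoothSections I J q)
    (hs : Function.Surjective q) (hq : ContMDiff I J ∞ q) : IsSurjectiveSubmersion I J q := by
  refine ⟨hs, hq, fun x v => ?_⟩
  obtain ⟨σ, h1, h2, h3⟩ := h x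
  have hσ : MDifferentiableAt J I σ (q x) := h2.mdifferentiableAt (by simp)
  have hq' : MDifferentiableAt I J q (σ (q x)) := (hq _).mdifferentiableAt (by simp)
  have hc := mfderiv_comp (q x) hq' hσ
  have he : (q ∘ σ) =ᶠ[𝓝 (q x)] id := h3
  rw [he.mfderiv_eq, mfderiv_id] at hc
  have hv := congrArg (fun L => L v) hc
  rw [h1] at hc
  refine ⟨mfderiv J I σ (q x) v, ?_⟩
  have := congrArg (fun L => L v) hc
  exact this.symm

/-- Two smooth quotients of the same manifold with the same fibres are diffeomorphic. -/
theorem exists_diffeomorph_of_hasSmoothSections {E₁ H₁ E₂ H₂ Y : Type} [NormedAddCommGroup E₁]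
    [NormedSpace ℝ E₁] [TopologicalSpace H₁] [ChartedSpace H₁ X] [TopologicalSpace Y]
    [NormedAddCommGroup E₂] [NormedSpace ℝ E₂] [TopologicalSpace H₂] [ChartedSpace H₂ Y]
    {I₁ : ModelWithCorners ℝ E₁ H₁} {I₂ : ModelWithCorners ℝ E₂ H₂} {q : M → X} {q' : M → Y}
    (hq : ContMDiff I I₁ ∞ q) (hs : HasSmoothSections I I₁ q) (hsur : Function.Surjective q)
    (hq' : ContMDiff I I₂ ∞ q') (hs' : HasSmoothSections I I₂ q')
    (hsur' : Function.Surjective q') (hiff : ∀ x y, q x = q y ↔ q' x = q' y) :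
    ∃ Φ : Diffeomorph I₁ I₂ X Y ∞, ∀ x, Φ (q x) = q' x := by
  -- The lift by `surjInv` need not be continuous. It only defines the map; as `q'` is constant on
  -- the fibres of `q`, the map agrees near any point with `q' ∘ σ` for a smooth local section `σ`.
  let f : X → Y := fun p => q' (Function.surjInv hsur p)
  let g : Y → X := fun p => q (Function.surjInv hsur' p)
  have hf : ∀ x, f (q x) = q' x := fun x => (hiff _ _).1 (Function.surjInv_eq hsur _)
  have hg : ∀ x, g (q' x) = q x := fun x => (hiff _ _).2 (Function.surjInv_eq hsur' _)
  refine ⟨⟨⟨f, g, fun p => ?_, fun p => ?_⟩, fun p => ?_, fun p => ?_⟩, hf⟩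
  · obtain ⟨x, rfl⟩ := hsur p
    rw [hf, hg]
  · obtain ⟨x, rfl⟩ := hsur' p
    rw [hg, hf]
  · obtain ⟨x, rfl⟩ := hsur p
    obtain ⟨σ, -, h2, h3⟩ := hs x
    refine ((hq' _).comp _ h2).congr_of_eventuallyEq ?_
    filter_upwards [h3] with p hp
    change f p = q' (σ p)
    rw [← hf, hp]
  · obtain ⟨x, rfl⟩ := hsur' p
    obtain ⟨σ, -, h2, h3⟩ := hs' x
    refine ((hq _).comp _ h2).congr_of_eventuallyEq ?_
    filter_upwards [h3] with p hp
    change g p = q (σ p)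
    rw [← hg, hp]

/-- Data that determine a smooth structure on the quotient `q : M → X`: saturated open sets
`O j` that cover `M`, and smooth submersions `r j` from them to a manifold `N` that have the same
fibres as `q`. -/
structure QuotientCharts (I : ModelWithCorners ℝ E H) (V : Type) [NormedAddCommGroup V]
    [NormedSpace ℝ V] [ChartedSpace V N] {ι : Type} (q : M → X) (O : ι → Set M)
    (r : ι → M → N) : Prop where
  isQuotientMap : IsQuotientMap q
  cover : ∀ x, ∃ j, x ∈ O j
  isOpen : ∀ j, IsOpen (O j)
  saturated : ∀ j x y, x ∈ O j → q x = q y → y ∈ O j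
  contMDiffOn : ∀ j, ContMDiffOn I 𝓘(ℝ, V) ∞ (r j) (O j)
  eq_iff : ∀ j, ∀ x ∈ O j, ∀ y ∈ O j, r j x = r j y ↔ q x = q y
  exists_section : ∀ j, ∀ x ∈ O j, ∃ s : N → M, s (r j x) = x ∧
    ContMDiffAt 𝓘(ℝ, V) I ∞ s (r j x) ∧ ∀ᶠ n in 𝓝 (r j x), s n ∈ O j ∧ r j (s n) = n

namespace QuotientCharts

variable {ι : Type} {q : M → X} {O : ι → Set M} {r : ι → M → N}

theorem isOpen_image (h : QuotientCharts I V q O r) (j : ι) : IsOpen (r j '' O j) := by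
  rw [isOpen_iff_mem_nhds]
  rintro _ ⟨x, hx, rfl⟩
  obtain ⟨s, -, -, h3⟩ := h.exists_section j x hx
  filter_upwards [h3] with n hn
  exact ⟨s n, hn.1, hn.2⟩

theorem preimage_image (h : QuotientCharts I V q O r) (j : ι) : q ⁻¹' (q '' O j) = O j := by
  ext x
  constructor
  · rintro ⟨y, hy, hyx⟩
    exact h.saturated j y x hy hyx
  · exact fun hx => ⟨x, hx, rfl⟩

/-- The local homeomorphism from `X` to `N` induced by `r j`. -/
def localHomeo (h : QuotientCharts I V q O r) [Nonempty M] (j : ι) : OpenPartialHomeomorph X N where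
  -- The chosen preimage lies in `O j` by saturation, and by `eq_iff` the value of `r j` does not
  -- depend on it.
  toFun p := r j (Function.surjInv h.isQuotientMap.surjective p)
  invFun n := q (Function.invFunOn (r j) (O j) n)
  source := q '' O j
  target := r j '' O j
  map_source' := by
    rintro _ ⟨x, hx, rfl⟩
    refine ⟨_, h.saturated j x _ hx ?_, rfl⟩
    exact (Function.surjInv_eq h.isQuotientMap.surjective _).symm
  map_target' n hn := ⟨_, Function.invFunOn_mem hn, rfl⟩
  left_inv' := by
    rintro _ ⟨x, hx, rfl⟩
    have h1 := Function.surjInv_eq h.isQuotientMap.surjective (q x)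
    have h2 := h.saturated j x _ hx h1.symm
    have h3 : ∃ a ∈ O j, r j a = r j (Function.surjInv h.isQuotientMap.surjective (q x)) :=
      ⟨_, h2, rfl⟩
    rw [(h.eq_iff j _ (Function.invFunOn_mem h3) _ h2).1 (Function.invFunOn_eq h3), h1]
  right_inv' n hn := by
    have h1 := Function.surjInv_eq h.isQuotientMap.surjective (q (Function.invFunOn (r j) (O j) n))
    have h2 := h.saturated j _ _ (Function.invFunOn_mem hn) h1.symm
    rw [(h.eq_iff j _ h2 _ (Function.invFunOn_mem hn)).2 h1, Function.invFunOn_eq hn]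
  open_source := by
    rw [← h.isQuotientMap.isOpen_preimage, h.preimage_image]
    exact h.isOpen j
  open_target := h.isOpen_image j
  continuousOn_toFun := by
    have ho : IsOpen (q '' O j) := by
      rw [← h.isQuotientMap.isOpen_preimage, h.preimage_image]
      exact h.isOpen j
    rw [h.isQuotientMap.continuousOn_isOpen_iff ho, h.preimage_image]
    refine (h.contMDiffOn j).continuousOn.congr fun x hx => ?_
    have h1 := Function.surjInv_eq h.isQuotientMap.surjective (q x)
    exact (h.eq_iff j _ (h.saturated j x _ hx h1.symm) _ hx).2 h1
  continuousOn_invFun := by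
    rintro _ ⟨x, hx, rfl⟩
    obtain ⟨s, -, h2, h3⟩ := h.exists_section j x hx
    refine ContinuousAt.continuousWithinAt ?_
    refine ((h.isQuotientMap.continuous.continuousAt).comp h2.continuousAt).congr ?_
    filter_upwards [h3] with n hn
    have hn' : ∃ a ∈ O j, r j a = n := ⟨s n, hn⟩
    refine (h.eq_iff j _ hn.1 _ (Function.invFunOn_mem hn')).1 ?_
    rw [hn.2, Function.invFunOn_eq hn']

variable (h : QuotientCharts I V q O r) [Nonempty M]

theorem localHomeo_apply {j : ι} {x : M} (hx : x ∈ O j) : h.localHomeo j (q x) = r j x := by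
  have h1 := Function.surjInv_eq h.isQuotientMap.surjective (q x)
  exact (h.eq_iff j _ (h.saturated j x _ hx h1.symm) _ hx).2 h1

theorem localHomeo_symm_apply {j : ι} {x : M} (hx : x ∈ O j) :
    (h.localHomeo j).symm (r j x) = q x := by
  rw [← h.localHomeo_apply hx, (h.localHomeo j).left_inv ⟨x, hx, rfl⟩]

/-- Lifting to `M` turns the transition map into `r j ∘ s`, with `s` a local section of `r i`. Near
the point, `s` takes values in `O j`, where `r j` is smooth. -/
theorem contMDiffAt_transition {i j : ι} {n : N} (hn : n ∈ (h.localHomeo i).target)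
    (hj : (h.localHomeo i).symm n ∈ (h.localHomeo j).source) :
    ContMDiffAt 𝓘(ℝ, V) 𝓘(ℝ, V) ∞ (fun n => h.localHomeo j ((h.localHomeo i).symm n)) n := by
  obtain ⟨x, hx, rfl⟩ := hn
  rw [h.localHomeo_symm_apply hx] at hj
  have hxj : x ∈ O j := by
    rw [← h.preimage_image j]
    exact hj
  obtain ⟨s, h1, h2, h3⟩ := h.exists_section i x hx
  have hr : ContMDiffAt I 𝓘(ℝ, V) ∞ (r j) (s (r i x)) := by
    rw [h1]
    exact (h.contMDiffOn j).contMDiffAt ((h.isOpen j).mem_nhds hxj)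
  refine (hr.comp _ h2).congr_of_eventuallyEq ?_
  have h4 : ∀ᶠ n in 𝓝 (r i x), s n ∈ O j :=
    h2.continuousAt.eventually_mem ((h.isOpen j).mem_nhds (by rwa [h1]))
  filter_upwards [h3, h4] with n hn hn'
  change h.localHomeo j ((h.localHomeo i).symm n) = r j (s n)
  rw [← h.localHomeo_apply hn', ← h.localHomeo_symm_apply hn.1, hn.2]

/-- The charted space structure of the quotient. -/
@[reducible] def chartedSpace : ChartedSpace V X where
  atlas := {e | ∃ j, ∃ c ∈ atlas V N, e = (h.localHomeo j).trans c}
  chartAt p := (h.localHomeo (h.cover (Function.surjInv h.isQuotientMap.surjective p)).choose).trans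
    (chartAt V (h.localHomeo
      (h.cover (Function.surjInv h.isQuotientMap.surjective p)).choose p))
  mem_chart_source p := by
    have h1 := (h.cover (Function.surjInv h.isQuotientMap.surjective p)).choose_spec
    refine ⟨⟨_, h1, Function.surjInv_eq h.isQuotientMap.surjective p⟩, ?_⟩
    simp
  chart_mem_atlas p := ⟨_, _, chart_mem_atlas _ _, rfl⟩

theorem mem_atlas {j : ι} {c : OpenPartialHomeomorph N V} (hc : c ∈ atlas V N) :
    (h.localHomeo j).trans c ∈ @atlas V _ X _ h.chartedSpace := ⟨j, c, hc, rfl⟩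

variable [IsManifold 𝓘(ℝ, V) ∞ N]

theorem isManifold : @IsManifold ℝ _ V _ _ V _ 𝓘(ℝ, V) ∞ X _ h.chartedSpace := by
  let _ := h.chartedSpace
  refine isManifold_of_contDiffOn _ _ _ ?_
  rintro _ _ ⟨i, c, hc, rfl⟩ ⟨j, c', hc', rfl⟩
  intro v hv
  refine ContDiffAt.contDiffWithinAt ?_
  rw [← contMDiffAt_iff_contDiffAt]
  simp only [OpenPartialHomeomorph.trans_symm_eq_symm_trans_symm, modelWithCornersSelf_coe_symm,
    preimage_id_eq, id_eq, mem_inter_iff, OpenPartialHomeomorph.trans_source,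
    OpenPartialHomeomorph.symm_source, mem_preimage, OpenPartialHomeomorph.coe_trans,
    Function.comp_apply] at hv
  obtain ⟨⟨⟨hv1, hv2⟩, hv3, hv4⟩, -⟩ := hv
  have k1 : ContMDiffAt 𝓘(ℝ, V) 𝓘(ℝ, V) ∞ c.symm v :=
    (contMDiffOn_symm_of_mem_maximalAtlas (IsManifold.subset_maximalAtlas hc)).contMDiffAt
      (c.open_target.mem_nhds hv1)
  have k2 := h.contMDiffAt_transition hv2 hv3
  have k3 := (contMDiffOn_of_mem_maximalAtlas (IsManifold.subset_maximalAtlas (I := 𝓘(ℝ, V))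
    (n := ∞) hc')).contMDiffAt (c'.open_source.mem_nhds hv4)
  have k4 := k3.comp v (k2.comp v k1)
  exact k4

/-- By construction `(localHomeo j).trans c` is a chart of `X` for each chart `c` of `N`; composing
with the inverse of `c` leaves `localHomeo j`. -/
theorem contMDiffOn_localHomeo (j : ι) :
    letI := h.chartedSpace
    ContMDiffOn 𝓘(ℝ, V) 𝓘(ℝ, V) ∞ (h.localHomeo j) (q '' O j) := by
  let _ := h.chartedSpace
  have := h.isManifold
  intro p hp
  refine ContMDiffAt.contMDiffWithinAt ?_
  set c := chartAt V (h.localHomeo j p)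
  have hm : c ∈ atlas V N := chart_mem_atlas _ _
  have hpc : h.localHomeo j p ∈ c.source := mem_chart_source _ _
  have hps : p ∈ ((h.localHomeo j).trans c).source := ⟨hp, hpc⟩
  have k1 := (contMDiffOn_of_mem_maximalAtlas (IsManifold.subset_maximalAtlas (I := 𝓘(ℝ, V))
    (n := ∞) (h.mem_atlas (j := j) hm))).contMDiffAt
      (((h.localHomeo j).trans c).open_source.mem_nhds hps)
  have k2 : ContMDiffAt 𝓘(ℝ, V) 𝓘(ℝ, V) ∞ c.symm (((h.localHomeo j).trans c) p) :=
    (contMDiffOn_symm_of_mem_maximalAtlas (IsManifold.subset_maximalAtlas hm)).contMDiffAt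
      (c.open_target.mem_nhds (c.map_source hpc))
  refine (k2.comp p k1).congr_of_eventuallyEq ?_
  filter_upwards [((h.localHomeo j).trans c).open_source.mem_nhds hps] with p' hp'
  exact (c.left_inv hp'.2).symm

theorem contMDiffOn_localHomeo_symm (j : ι) :
    letI := h.chartedSpace
    ContMDiffOn 𝓘(ℝ, V) 𝓘(ℝ, V) ∞ (h.localHomeo j).symm (r j '' O j) := by
  let _ := h.chartedSpace
  have := h.isManifold
  intro n hn
  refine ContMDiffAt.contMDiffWithinAt ?_
  set c := chartAt V n
  have hm : c ∈ atlas V N := chart_mem_atlas _ _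
  have hnc : n ∈ c.source := mem_chart_source _ _
  have k1 : ContMDiffAt 𝓘(ℝ, V) 𝓘(ℝ, V) ∞ c n := (contMDiffOn_of_mem_maximalAtlas
    (IsManifold.subset_maximalAtlas hm)).contMDiffAt (c.open_source.mem_nhds hnc)
  have hct : c n ∈ ((h.localHomeo j).trans c).target := by
    rw [OpenPartialHomeomorph.trans_target]
    refine ⟨c.map_source hnc, ?_⟩
    rw [mem_preimage, c.left_inv hnc]
    exact hn
  have k2 := (contMDiffOn_symm_of_mem_maximalAtlas (IsManifold.subset_maximalAtlas (I := 𝓘(ℝ, V))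
    (n := ∞) (h.mem_atlas (j := j) hm))).contMDiffAt
      (((h.localHomeo j).trans c).open_target.mem_nhds hct)
  refine (k2.comp n k1).congr_of_eventuallyEq ?_
  filter_upwards [c.open_source.mem_nhds hnc] with n' hn'
  change _ = (h.localHomeo j).symm (c.symm (c n'))
  rw [c.left_inv hn']

theorem contMDiff_quotient :
    letI := h.chartedSpace
    ContMDiff I 𝓘(ℝ, V) ∞ q := by
  let _ := h.chartedSpace
  intro x
  obtain ⟨j, hj⟩ := h.cover x
  have k1 := (h.contMDiffOn j).contMDiffAt ((h.isOpen j).mem_nhds hj)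
  have k2 := (h.contMDiffOn_localHomeo_symm j).contMDiffAt
    ((h.isOpen_image j).mem_nhds ⟨x, hj, rfl⟩)
  refine (k2.comp x k1).congr_of_eventuallyEq ?_
  filter_upwards [(h.isOpen j).mem_nhds hj] with y hy
  exact (h.localHomeo_symm_apply hy).symm

theorem hasSmoothSections :
    letI := h.chartedSpace
    HasSmoothSections I 𝓘(ℝ, V) q := by
  let _ := h.chartedSpace
  intro x
  obtain ⟨j, hj⟩ := h.cover x
  obtain ⟨s, h1, h2, h3⟩ := h.exists_section j x hj
  have hs := (h.localHomeo j).open_source.mem_nhds (⟨x, hj, rfl⟩ : q x ∈ q '' O j)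
  have k1 := (h.contMDiffOn_localHomeo j).contMDiffAt hs
  have hx := h.localHomeo_apply hj
  rw [← hx] at h1 h2 h3
  refine ⟨s ∘ h.localHomeo j, h1, h2.comp _ k1, ?_⟩
  filter_upwards [k1.continuousAt.eventually h3, hs] with p hp hp'
  have := h.localHomeo_symm_apply hp.1
  rw [hp.2, (h.localHomeo j).left_inv hp'] at this
  exact this.symm

/-- A continuous local section through `x` sends neighbourhoods filters the right way: `𝓝 (q x)` is
the image under `q` of a filter finer than `𝓝 x`. Openness makes the Hausdorff property equivalent
to closedness of the fibre relation, and transfers second countability. -/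
theorem isOpenMap (h : QuotientCharts I V q O r) : IsOpenMap q := by
  let _ := h.chartedSpace
  rw [isOpenMap_iff_nhds_le]
  intro x
  obtain ⟨σ, h1, h2, h3⟩ := h.hasSmoothSections x
  have k := h2.continuousAt
  rw [ContinuousAt, h1] at k
  calc 𝓝 (q x) = Filter.map id (𝓝 (q x)) := Filter.map_id.symm
    _ = Filter.map (q ∘ σ) (𝓝 (q x)) := (Filter.map_congr h3).symm
    _ = Filter.map q (Filter.map σ (𝓝 (q x))) := Filter.map_map.symm
    _ ≤ Filter.map q (𝓝 x) := Filter.map_mono k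

/-- The smooth structure of the quotient. -/
def smoothStructure [FiniteDimensional ℝ V] [SecondCountableTopology M]
    (hc : IsClosed {p : M × M | q p.1 = q p.2}) : SmoothStructure X where
  V := V
  chartedSpace := h.chartedSpace
  isManifold := h.isManifold
  t2Space := (t2Space_iff_of_isOpenQuotientMap
    ⟨h.isQuotientMap.surjective, h.isQuotientMap.continuous, h.isOpenMap⟩).2 hc
  secondCountable := h.isQuotientMap.secondCountableTopology h.isOpenMap

/-- The diffeomorphism between open subsets of `X` and `N` induced by `r j`. -/
def partialDiffeo [FiniteDimensional ℝ V] [SecondCountableTopology M]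
    (hc : IsClosed {p : M × M | q p.1 = q p.2}) (j : ι) :
    PartialDiffeomorph 𝓘(ℝ, (h.smoothStructure hc).V) 𝓘(ℝ, V) X N ∞ where
  toPartialEquiv := (h.localHomeo j).toPartialEquiv
  open_source := (h.localHomeo j).open_source
  open_target := (h.localHomeo j).open_target
  contMDiffOn_toFun := h.contMDiffOn_localHomeo j
  contMDiffOn_invFun := h.contMDiffOn_localHomeo_symm j

end QuotientCharts

end Quotients

/-! ### Submanifolds -/

section Submanifolds

open Topology Set

/-- The inverse function theorem at `a` yields smoothness of the inverse only at the image of `a`.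
Shrinking the source to points where `f` is smooth with invertible derivative, an open condition,
yields it on the whole target. -/
theorem exists_openPartialHomeomorph_contDiffAt_symm {V : Type} [NormedAddCommGroup V]
    [NormedSpace ℝ V] [CompleteSpace V] {f : V → V} {a : V} {U : Set V} (hU : U ∈ 𝓝 a)
    (hf : ∀ᶠ v in 𝓝 a, ContDiffAt ℝ ∞ f v) (hf' : HasFDerivAt f (ContinuousLinearMap.id ℝ V) a) :
    ∃ ψ : OpenPartialHomeomorph V V, a ∈ ψ.source ∧ ψ.source ⊆ U ∧ (∀ v, ψ v = f v) ∧
      ∀ w ∈ ψ.target, ContDiffAt ℝ ∞ ψ.symm w := by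
  have hfa := hf.self_of_nhds
  have hf'' : HasFDerivAt f ((ContinuousLinearEquiv.refl ℝ V : V ≃L[ℝ] V) : V →L[ℝ] V) a := hf'
  let ψ₀ := hfa.toOpenPartialHomeomorph f hf'' (by simp)
  have hd : ∀ᶠ v in 𝓝 a, fderiv ℝ f v ∈ range ((↑) : (V ≃L[ℝ] V) → V →L[ℝ] V) := by
    have hc : ContinuousAt (fderiv ℝ f) a := hfa.continuousAt_fderiv (by simp)
    refine hc.eventually_mem (ContinuousLinearEquiv.isOpen.mem_nhds ?_)
    rw [hf''.fderiv]
    exact ⟨_, rfl⟩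
  obtain ⟨B, hB, hBo, haB⟩ := mem_nhds_iff.1 (Filter.inter_mem (Filter.inter_mem hU hf) hd)
  refine ⟨ψ₀.restrOpen B hBo, ⟨hfa.mem_toOpenPartialHomeomorph_source hf'' (by simp), haB⟩,
    fun v hv => (hB hv.2).1.1, fun v => rfl, fun w hw => ?_⟩
  have hv := (ψ₀.restrOpen B hBo).map_target hw
  obtain ⟨e, he⟩ := (hB hv.2).2
  have h1 : ContDiffAt ℝ ∞ f ((ψ₀.restrOpen B hBo).symm w) := (hB hv.2).1.2
  refine (ψ₀.restrOpen B hBo).contDiffAt_symm (f₀' := e) hw ?_ h1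
  rw [he]
  exact (h1.differentiableAt (by simp)).hasFDerivAt

variable {E S : Type} [NormedAddCommGroup E] [NormedSpace ℝ E] [FiniteDimensional ℝ E]
  [TopologicalSpace S]

/-- A chart of the image of a smooth retraction `Ψ`, near a given point. -/
theorem exists_chart_of_retraction {ι : S → E} (hι : IsEmbedding ι) {e : S} {Ψ : E → E}
    (hΨ : ∀ᶠ y in 𝓝 (ι e), ContDiffAt ℝ ∞ Ψ y) (hΨS : ∀ᶠ y in 𝓝 (ι e), Ψ y ∈ range ι)
    (hid : ∀ x, Ψ (ι x) = ι x) :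
    ∃ (V : Submodule ℝ E) (ρ : E →L[ℝ] V) (c : OpenPartialHomeomorph S V), e ∈ c.source ∧
      (∀ x, c x = ρ (ι x)) ∧ ∀ w ∈ c.target, ContDiffAt ℝ ∞ (ι ∘ c.symm) w := by
  set a := ι e
  have : Nonempty S := ⟨e⟩
  have : CompleteSpace E := FiniteDimensional.complete ℝ E
  set P := fderiv ℝ Ψ a
  have hP : HasFDerivAt Ψ P a := (hΨ.self_of_nhds.differentiableAt (by simp)).hasFDerivAt
  -- The derivative of the idempotent map `Ψ` at its fixed point `a` is a linear projection. Its
  -- range `V` plays the role of the tangent space.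
  have hPP : ∀ v, P (P v) = P v := by
    have h1 : Ψ ∘ Ψ =ᶠ[𝓝 a] Ψ := by
      filter_upwards [hΨS] with y ⟨x, hx⟩
      rw [Function.comp_apply, ← hx, hid]
    have hP' : HasFDerivAt Ψ P (Ψ a) := by rwa [hid]
    have h2 := (hP'.comp a hP).congr_of_eventuallyEq h1.symm
    exact fun v => congrArg (fun L : E →L[ℝ] E => L v) (h2.unique hP)
  let V : Submodule ℝ E := LinearMap.range (P : E →ₗ[ℝ] E)
  have hV : ∀ v : V, P v = v := by
    rintro ⟨_, w, rfl⟩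
    exact hPP w
  let ρ : E →L[ℝ] V := P.codRestrict V fun w => ⟨w, rfl⟩
  have hρ : ∀ w, (ρ w : E) = P w := fun w => rfl
  have hρV : ∀ v : V, ρ v = v := fun v => Subtype.ext (hV v)
  -- injectivity of the projection on `S` near `e`
  obtain ⟨O, hO, haO, hOinj⟩ : ∃ O : Set E, IsOpen O ∧ a ∈ O ∧
      ∀ x y, ι x ∈ O → ι y ∈ O → ρ (ι x) = ρ (ι y) → ι x = ι y := by
    -- The derivative at `a` is `P + (id - P) = id`, so this map is injective near `a`. On the image
    -- of `ι` the second summand vanishes, so there `P` alone is injective.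
    have hs : HasStrictFDerivAt (fun y => P y + (y - Ψ y))
        ((ContinuousLinearEquiv.refl ℝ E : E ≃L[ℝ] E) : E →L[ℝ] E) a := by
      have h1 := P.hasStrictFDerivAt (x := a)
      have h2 : HasStrictFDerivAt Ψ P a := hΨ.self_of_nhds.hasStrictFDerivAt (by simp)
      refine (h1.add ((hasStrictFDerivAt_id a).sub h2)).congr_fderiv ?_
      ext v
      simp
    let φ := hs.toOpenPartialHomeomorph
    refine ⟨φ.source, φ.open_source, hs.mem_toOpenPartialHomeomorph_source, fun x y hx hy h => ?_⟩
    refine φ.injOn hx hy ?_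
    change P (ι x) + (ι x - Ψ (ι x)) = P (ι y) + (ι y - Ψ (ι y))
    rw [hid, hid, ← hρ, ← hρ, h]
    simp
  -- A local parametrization: move from `a` in the direction of `V`, then retract by `Ψ`. Since `P`
  -- is the identity on `V`, the map `ρ ∘ s` has derivative the identity at `ρ a`; with its local
  -- inverse `ψ.symm`, the inverse chart is `s ∘ ψ.symm`.
  let s : V → E := fun v => Ψ (a + (v - ρ a : V))
  have hsa : ContinuousAt (fun v : V => a + (v - ρ a : V)) (ρ a) := by fun_prop
  have hsa' : a + ((ρ a - ρ a : V) : E) = a := by simp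
  have hΨs : ∀ᶠ v in 𝓝 (ρ a), ContDiffAt ℝ ∞ Ψ (a + (v - ρ a : V)) := by
    refine hsa.eventually (p := fun y => ContDiffAt ℝ ∞ Ψ y) ?_
    beta_reduce
    rwa [hsa']
  have hsS : ∀ᶠ v in 𝓝 (ρ a), s v ∈ range ι := by
    refine hsa.eventually (p := fun y => Ψ y ∈ range ι) ?_
    beta_reduce
    rwa [hsa']
  have hs : ∀ᶠ v in 𝓝 (ρ a), ContDiffAt ℝ ∞ s v := by
    filter_upwards [hΨs] with v hv
    refine hv.comp (f := fun v : V => a + (v - ρ a : V)) v ?_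
    refine contDiffAt_const.add ?_
    exact (V.subtypeL.contDiff.contDiffAt).comp (f := fun v => v - ρ a) v
      (contDiffAt_id.sub contDiffAt_const)
  have hsρ : s (ρ a) = a := by
    change Ψ (a + ((ρ a - ρ a : V) : E)) = a
    rw [hsa', hid]
  have hsO : ∀ᶠ v in 𝓝 (ρ a), s v ∈ O :=
    hs.self_of_nhds.continuousAt.eventually_mem (hO.mem_nhds (by rwa [hsρ]))
  have hd : HasFDerivAt (fun v => ρ (s v)) (ContinuousLinearMap.id ℝ V) (ρ a) := by
    have h1 : HasFDerivAt (fun v : V => a + ((v - ρ a : V) : E)) V.subtypeL (ρ a) := by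
      have := (V.subtypeL.hasFDerivAt (x := ρ a)).const_add (a - ρ a)
      refine this.congr_of_eventuallyEq (Filter.Eventually.of_forall fun v => ?_)
      simp only [Submodule.coe_sub, Submodule.subtypeL_apply]
      abel
    have h2 : HasFDerivAt Ψ P (a + ((ρ a - ρ a : V) : E)) := by rwa [hsa']
    have h3 := (ρ.hasFDerivAt (x := s (ρ a))).comp (ρ a) (h2.comp (ρ a) h1)
    refine h3.congr_fderiv ?_
    ext v
    simp only [ContinuousLinearMap.coe_comp, Function.comp_apply, Submodule.subtypeL_apply,
      ContinuousLinearMap.coe_id', id_eq, hρ, hV]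
  obtain ⟨ψ, h1, h2, h3, h4⟩ := exists_openPartialHomeomorph_contDiffAt_symm
    (f := fun v => ρ (s v)) (Filter.inter_mem hsO (Filter.inter_mem hsS hs))
    (hs.mono fun v hv => ρ.contDiff.contDiffAt.comp v hv) hd
  have key : ∀ w ∈ ψ.target, ι (Function.invFun ι (s (ψ.symm w))) = s (ψ.symm w) := fun w hw =>
    Function.invFun_eq (h2 (ψ.map_target hw)).2.1
  have key2 : ∀ w ∈ ψ.target, ρ (s (ψ.symm w)) = w := fun w hw => by
    rw [← h3, ψ.right_inv hw]
  have key3 : ∀ w ∈ ψ.target, ContDiffAt ℝ ∞ (fun w => s (ψ.symm w)) w := fun w hw => by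
    have h5 : ContDiffAt ℝ ∞ s (ψ.symm w) := (h2 (ψ.map_target hw)).2.2
    exact h5.comp w (h4 w hw)
  have key4 : ∀ w ∈ ψ.target,
      (fun w => ι (Function.invFun ι (s (ψ.symm w)))) =ᶠ[𝓝 w] fun w => s (ψ.symm w) := fun w hw =>
    Filter.mem_of_superset (ψ.open_target.mem_nhds hw) key
  refine ⟨V, ρ, {
    toFun := fun x => ρ (ι x)
    invFun := fun w => Function.invFun ι (s (ψ.symm w))
    source := {x | ι x ∈ O ∧ ρ (ι x) ∈ ψ.target}
    target := ψ.target
    map_source' := fun x hx => hx.2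
    map_target' := fun w hw => ?_
    left_inv' := fun x hx => ?_
    right_inv' := fun w hw => ?_
    open_source := ?_
    open_target := ψ.open_target
    continuousOn_toFun := ?_
    continuousOn_invFun := ?_ }, ?_, fun x => rfl, ?_⟩
  · change ι _ ∈ O ∧ ρ (ι _) ∈ ψ.target
    rw [key w hw, key2 w hw]
    exact ⟨(h2 (ψ.map_target hw)).1, hw⟩
  · apply hι.injective
    have hk := key _ hx.2
    refine hOinj _ _ ?_ hx.1 ?_
    · rw [hk]
      exact (h2 (ψ.map_target hx.2)).1
    · rw [hk, key2 _ hx.2]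
  · rw [key w hw, key2 w hw]
  · exact (ρ.continuous.comp hι.continuous).continuousOn
  · intro w hw
    refine ContinuousAt.continuousWithinAt ?_
    rw [hι.continuousAt_iff]
    exact (key3 w hw).continuousAt.congr (key4 w hw).symm
  · exact (hO.preimage hι.continuous).inter
      (ψ.open_target.preimage (ρ.continuous.comp hι.continuous))
  · refine ⟨haO, ?_⟩
    have := ψ.map_source h1
    rwa [h3, hsρ] at this
  · exact fun w hw => (key3 w hw).congr_of_eventuallyEq (key4 w hw)

/-- The image of a smooth retraction that is homogeneous under linear maps is a submanifold. -/
theorem exists_smoothStructure_of_retraction {ι : S → E} (hι : IsEmbedding ι) {e : S} {Ψ : E → E}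
    (hΨ : ∀ᶠ y in 𝓝 (ι e), ContDiffAt ℝ ∞ Ψ y) (hΨS : ∀ᶠ y in 𝓝 (ι e), Ψ y ∈ range ι)
    (hid : ∀ x, Ψ (ι x) = ι x) (τ : S → S ≃ₜ S) (T T' : S → E →L[ℝ] E)
    (hτ : ∀ x, τ x e = x) (hT : ∀ x p, ι (τ x p) = T x (ι p))
    (hT' : ∀ x p, ι ((τ x).symm p) = T' x (ι p)) :
    ∃ G : SmoothStructure S, IsEmbeddingSmooth 𝓘(ℝ, G.V) 𝓘(ℝ, E) ι ∧
      ∀ {E' H' M' : Type} [NormedAddCommGroup E'] [NormedSpace ℝ E'] [TopologicalSpace H']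
        [TopologicalSpace M'] [ChartedSpace H' M'] (I' : ModelWithCorners ℝ E' H') (f : M' → S)
        (x : M'), ContMDiffAt I' 𝓘(ℝ, E) ∞ (fun x => ι (f x)) x →
          ContMDiffAt I' 𝓘(ℝ, G.V) ∞ f x := by
  obtain ⟨V, ρ, c, hec, hc, hcs⟩ := exists_chart_of_retraction hι hΨ hΨS hid
  -- The chart at `x` is the chart at `e` transported by `τ x`. Seen in `E` it is the linear map `ρ
  -- ∘ T' x`, and its inverse is smooth into `E`, so transition maps are smooth.
  let ch : S → OpenPartialHomeomorph S V := fun x => (τ x).symm.transOpenPartialHomeomorph c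
  have hch : ∀ x p, ch x p = ρ (T' x (ι p)) := fun x p => by
    change c ((τ x).symm p) = _
    rw [hc, hT']
  have hchs : ∀ x w, ι ((ch x).symm w) = T x (ι (c.symm w)) := fun x w => hT x _
  have hx : ∀ x, x ∈ (ch x).source := fun x => by
    change (τ x).symm x ∈ c.source
    have h1 : (τ x).symm x = e := by rw [Homeomorph.symm_apply_eq, hτ]
    rwa [h1]
  let cs : ChartedSpace V S :=
    { atlas := range ch
      chartAt := ch
      mem_chart_source := hx
      chart_mem_atlas := fun x => ⟨x, rfl⟩ }
  have hsm : ∀ x, ∀ w ∈ c.target, ContDiffAt ℝ ∞ (fun w => ι ((ch x).symm w)) w := fun x w hw => by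
    simp only [hchs]
    exact (T x).contDiff.contDiffAt.comp w (hcs w hw)
  have hmf : IsManifold 𝓘(ℝ, V) ∞ S := by
    refine isManifold_of_contDiffOn _ _ _ ?_
    rintro _ _ ⟨x, rfl⟩ ⟨x', rfl⟩ w hw
    refine ContDiffAt.contDiffWithinAt ?_
    have h1 : ContDiffAt ℝ ∞ (fun w => ρ (T' x' (ι ((ch x).symm w)))) w :=
      (ρ.contDiff.contDiffAt).comp w ((T' x').contDiff.contDiffAt.comp w (hsm x w hw.1.1))
    exact h1.congr_of_eventuallyEq (Filter.Eventually.of_forall fun w => hch _ _)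
  have hιs : ContMDiff 𝓘(ℝ, V) 𝓘(ℝ, E) ∞ ι := fun x => by
    have h1 : ContMDiffAt 𝓘(ℝ, V) 𝓘(ℝ, V) ∞ (ch x) x := contMDiffAt_of_mem_maximalAtlas
      (IsManifold.subset_maximalAtlas ⟨x, rfl⟩) (hx x)
    have h2 := (hsm x _ ((ch x).map_source (hx x))).contMDiffAt
    refine (h2.comp x h1).congr_of_eventuallyEq ?_
    filter_upwards [(ch x).open_source.mem_nhds (hx x)] with p hp
    exact congrArg ι ((ch x).left_inv hp).symm
  have : T2Space S := hι.t2Space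
  have : SecondCountableTopology E := secondCountable_of_proper
  refine ⟨{ V := V
            chartedSpace := cs
            isManifold := hmf
            secondCountable := hι.secondCountableTopology }, ⟨hι, hιs, fun x => ?_⟩, ?_⟩
  · change Function.Injective (mfderiv 𝓘(ℝ, V) 𝓘(ℝ, E) ι x)
    -- The linear formula for the chart makes sense on all of `E`; followed by the inverse chart it
    -- gives a local smooth left inverse of `ι`, so the derivative of `ι` is injective.
    have h1 : ContMDiffAt 𝓘(ℝ, E) 𝓘(ℝ, V) ∞ (fun y => (ch x).symm (ρ (T' x y))) (ι x) := by
      have h2 : ContMDiffAt 𝓘(ℝ, V) 𝓘(ℝ, V) ∞ (ch x).symm (ρ (T' x (ι x))) := by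
        refine contMDiffAt_symm_of_mem_maximalAtlas (IsManifold.subset_maximalAtlas ⟨x, rfl⟩) ?_
        rw [← hch]
        exact (ch x).map_source (hx x)
      exact h2.comp (ι x) (f := fun y => ρ (T' x y)) (ρ.comp (T' x)).contDiff.contDiffAt.contMDiffAt
    have h3 : (fun y => (ch x).symm (ρ (T' x y))) ∘ ι =ᶠ[𝓝 x] id := by
      filter_upwards [(ch x).open_source.mem_nhds (hx x)] with p hp
      change (ch x).symm (ρ (T' x (ι p))) = p
      rw [← hch, (ch x).left_inv hp]
    have h4 := mfderiv_comp x (h1.mdifferentiableAt (by simp))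
      ((hιs x).mdifferentiableAt (by simp))
    rw [h3.mfderiv_eq, mfderiv_id] at h4
    intro v w hvw
    have h5 := congrArg (fun L => L v) h4
    have h6 := congrArg (fun L => L w) h4
    simp only [ContinuousLinearMap.coe_comp, Function.comp_apply] at h5 h6
    rw [hvw, ← h6] at h5
    exact h5
  · intro E' H' M' _ _ _ _ _ I' f x hf
    change ContMDiffAt I' 𝓘(ℝ, V) ∞ f x
    -- In the chart at `f x`, the map `f` is a linear function of `ι ∘ f`.
    rw [contMDiffAt_iff_target]
    refine ⟨hι.continuousAt_iff.2 hf.continuousAt, ?_⟩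
    have h1 : ContMDiffAt I' 𝓘(ℝ, V) ∞ (fun y => ρ (T' (f x) (ι (f y)))) x :=
      (ρ.comp (T' (f x))).contDiff.contDiffAt.contMDiffAt.comp x hf
    exact h1.congr_of_eventuallyEq (Filter.Eventually.of_forall fun y => hch _ _)

end Submanifolds

/-! ### The Gram-Schmidt retraction onto the special unitary group -/

section GramSchmidt

open Topology Set InnerProductSpace

theorem ContDiffAt.matrix_det {F n : Type} [NormedAddCommGroup F] [NormedSpace ℝ F] [Fintype n]
    [DecidableEq n] {A : F → Matrix n n ℂ} {x : F}
    (h : ∀ i j, ContDiffAt ℝ ∞ (fun x => A x i j) x) : ContDiffAt ℝ ∞ (fun x => (A x).det) x := by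
  simp only [Matrix.det_apply]
  exact ContDiffAt.sum fun σ _ => ContDiffAt.const_smul _ (contDiffAt_prod fun i _ => h _ _)

theorem ContDiffAt.matrix_inv {F n : Type} [NormedAddCommGroup F] [NormedSpace ℝ F] [Fintype n]
    [DecidableEq n] {A : F → Matrix n n ℂ} {x : F}
    (h : ∀ i j, ContDiffAt ℝ ∞ (fun x => A x i j) x) (hx : (A x).det ≠ 0) (i j : n) :
    ContDiffAt ℝ ∞ (fun x => (A x)⁻¹ i j) x := by
  simp only [Matrix.inv_def, Ring.inverse_eq_inv', Matrix.smul_apply, smul_eq_mul,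
    Matrix.adjugate_apply]
  refine ((ContDiffAt.matrix_det h).inv hx).mul (ContDiffAt.matrix_det fun k l => ?_)
  by_cases hk : k = j
  · subst hk
    simp only [Matrix.updateRow_self]
    exact contDiffAt_const
  · simp only [Matrix.updateRow_ne hk]
    exact h k l

/-- Strong induction along the recursion formula. Its denominators are squared norms of earlier
Gram-Schmidt vectors, nonzero by linear independence. -/
theorem contDiffAt_gramSchmidt {n : ℕ} {F : Type} [NormedAddCommGroup F] [InnerProductSpace ℂ F]
    {f : Fin n → F} (hf : LinearIndependent ℂ f) (k : Fin n) :
    ContDiffAt ℝ ∞ (fun f : Fin n → F => gramSchmidt ℂ f k) f := by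
  induction k using WellFoundedLT.induction with
  | ind k ih =>
    have h1 : (fun f : Fin n → F => gramSchmidt ℂ f k) = fun f =>
        f k - ∑ i ∈ Finset.Iio k, (inner ℂ (gramSchmidt ℂ f i) (f k) /
          ((‖gramSchmidt ℂ f i‖ : ℝ) : ℂ) ^ 2) • gramSchmidt ℂ f i := by
      funext f
      rw [eq_sub_iff_add_eq]
      exact (gramSchmidt_def'' ℂ f k).symm
    rw [h1]
    have hk : ContDiffAt ℝ ∞ (fun f : Fin n → F => f k) f := (contDiff_apply ℝ F k).contDiffAt
    refine hk.sub (ContDiffAt.sum fun i hi => ?_)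
    have h2 := ih i (Finset.mem_Iio.1 hi)
    have h3 : gramSchmidt ℂ f i ≠ 0 := gramSchmidt_ne_zero i hf
    have h4 : ContDiffAt ℝ ∞ (fun f : Fin n → F => ((‖gramSchmidt ℂ f i‖ : ℝ) : ℂ)) f :=
      Complex.ofRealCLM.contDiff.contDiffAt.comp f (h2.norm ℂ h3)
    simp only [div_eq_mul_inv]
    exact ((h2.inner ℂ hk).mul ((h4.pow 2).inv (by simpa using h3))).smul h2

theorem contDiffAt_gramSchmidtNormed {n : ℕ} {F : Type} [NormedAddCommGroup F]
    [InnerProductSpace ℂ F] {f : Fin n → F} (hf : LinearIndependent ℂ f) (k : Fin n) :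
    ContDiffAt ℝ ∞ (fun f : Fin n → F => gramSchmidtNormed ℂ f k) f := by
  have h2 := contDiffAt_gramSchmidt hf k
  have h3 : gramSchmidt ℂ f k ≠ 0 := gramSchmidt_ne_zero k hf
  refine ContDiffAt.smul (ContDiffAt.inv ?_ ?_) h2
  · exact Complex.ofRealCLM.contDiff.contDiffAt.comp f (h2.norm ℂ h3)
  · simpa using h3

theorem gramSchmidtNormed_of_orthonormal {n : ℕ} {F : Type} [NormedAddCommGroup F]
    [InnerProductSpace ℂ F] {f : Fin n → F} (hf : Orthonormal ℂ f) :
    gramSchmidtNormed ℂ f = f := by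
  funext k
  rw [gramSchmidtNormed, gramSchmidt_of_orthogonal ℂ (fun i j h => hf.2 h), hf.1 k]
  simp

/-- Only orthogonality of `f k` to the earlier vectors is needed: the Gram-Schmidt vectors that are
projected away lie in the span of those. -/
theorem gramSchmidt_eq_self {n : ℕ} {F : Type} [NormedAddCommGroup F]
    [InnerProductSpace ℂ F] {f : Fin n → F} {k : Fin n}
    (hf : ∀ i < k, inner ℂ (f i) (f k) = 0) : gramSchmidt ℂ f k = f k := by
  rw [gramSchmidt_def, Finset.sum_eq_zero, sub_zero]
  intro i hi
  have hi' := Finset.mem_Iio.1 hi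
  rw [Submodule.starProjection_apply_eq_zero_iff, Submodule.mem_orthogonal_singleton_iff_inner_right]
  have h1 : gramSchmidt ℂ f i ∈ Submodule.span ℂ (f '' Iic i) := by
    rw [← span_gramSchmidt_Iic]
    exact Submodule.subset_span ⟨i, self_mem_Iic, rfl⟩
  have h2 : Submodule.span ℂ (f '' Iic i) ≤ (ℂ ∙ f k)ᗮ := by
    rw [Submodule.span_le]
    rintro _ ⟨j, hj, rfl⟩
    rw [SetLike.mem_coe, Submodule.mem_orthogonal_singleton_iff_inner_left]
    exact hf j (lt_of_le_of_lt hj hi')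
  exact (Submodule.mem_orthogonal_singleton_iff_inner_left.1 (h2 h1))

variable {n : ℕ}

/-- The columns of a matrix, as vectors in euclidean space. -/
def euclideanCols (N : Fin n → Fin n → ℂ) (k : Fin n) : EuclideanSpace ℂ (Fin n) :=
  WithLp.toLp 2 fun i => N i k

theorem contDiff_euclideanCols : ContDiff ℝ ∞ (euclideanCols (n := n)) := by
  refine contDiff_pi.2 fun k => PiLp.contDiff_toLp.comp (contDiff_pi.2 fun i => ?_)
  exact contDiff_apply_apply ℝ ℂ i k

/-- The unitary matrix that the Gram-Schmidt process associates with an invertible matrix. -/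
def gramSchmidtMatrix (N : Fin n → Fin n → ℂ) : Matrix (Fin n) (Fin n) ℂ :=
  Matrix.of fun i k => gramSchmidtNormed ℂ (euclideanCols N) k i

theorem orthonormal_euclideanCols_iff {N : Fin n → Fin n → ℂ} :
    Orthonormal ℂ (euclideanCols N) ↔ Matrix.of N ∈ Matrix.unitaryGroup (Fin n) ℂ := by
  rw [Matrix.mem_unitaryGroup_iff', orthonormal_iff_ite, ← Matrix.ext_iff]
  refine forall_congr' fun i => forall_congr' fun j => ?_
  rw [EuclideanSpace.inner_eq_star_dotProduct, dotProduct_comm, Matrix.one_apply]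
  rfl

theorem linearIndependent_euclideanCols_iff {N : Fin n → Fin n → ℂ} :
    LinearIndependent ℂ (euclideanCols N) ↔ LinearIndependent ℂ (Matrix.of N).col := by
  have h : euclideanCols N = (WithLp.linearEquiv 2 ℂ (Fin n → ℂ)).symm ∘ (Matrix.of N).col := rfl
  rw [h]
  exact LinearMap.linearIndependent_iff (WithLp.linearEquiv 2 ℂ (Fin n → ℂ)).symm.toLinearMap
    (LinearEquiv.ker _)

theorem gramSchmidtMatrix_mem {N : Fin n → Fin n → ℂ}
    (hN : LinearIndependent ℂ (euclideanCols N)) :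
    gramSchmidtMatrix N ∈ Matrix.unitaryGroup (Fin n) ℂ :=
  orthonormal_euclideanCols_iff.1 (gramSchmidtNormed_orthonormal hN)

theorem gramSchmidtMatrix_eq_self {N : Fin n → Fin n → ℂ}
    (hN : Matrix.of N ∈ Matrix.unitaryGroup (Fin n) ℂ) : gramSchmidtMatrix N = Matrix.of N := by
  ext i k
  change gramSchmidtNormed ℂ (euclideanCols N) k i = _
  rw [gramSchmidtNormed_of_orthonormal (orthonormal_euclideanCols_iff.2 hN)]
  rfl

theorem contDiffAt_gramSchmidtMatrix {N : Fin n → Fin n → ℂ}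
    (hN : LinearIndependent ℂ (euclideanCols N)) :
    ContDiffAt ℝ ∞ (fun (N : Fin n → Fin n → ℂ) (i k : Fin n) => gramSchmidtMatrix N i k) N := by
  refine contDiffAt_pi.2 fun i => contDiffAt_pi.2 fun k => ?_
  have h1 := (contDiffAt_gramSchmidtNormed hN k).comp N contDiff_euclideanCols.contDiffAt
  have h2 : ContDiff ℝ ∞ fun v : EuclideanSpace ℂ (Fin n) => WithLp.ofLp v i :=
    (contDiff_apply ℝ ℂ i).comp PiLp.contDiff_ofLp
  exact h2.contDiffAt.comp N h1

theorem isOpen_linearIndependent_euclideanCols :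
    IsOpen {N : Fin n → Fin n → ℂ | LinearIndependent ℂ (euclideanCols N)} :=
  (isOpen_setOfPred_linearIndependent (𝕜 := ℂ) (E := EuclideanSpace ℂ (Fin n))).preimage
    contDiff_euclideanCols.continuous

variable {m : ℕ}

/-- The factors by which the columns of a unitary matrix with determinant `d` are multiplied in
order to make its determinant `1`. -/
def detCorrection (d : ℂ) : Fin (m + 1) → ℂ := Fin.cons (star d) fun _ => 1

/-- The determinant of a unitary matrix has modulus one, so its conjugate is its inverse, and
scaling a column by this phase keeps the matrix unitary. -/
theorem det_mul_detCorrection {U : Matrix (Fin (m + 1)) (Fin (m + 1)) ℂ}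
    (hU : U ∈ Matrix.unitaryGroup (Fin (m + 1)) ℂ) :
    U * Matrix.diagonal (detCorrection U.det) ∈ Matrix.specialUnitaryGroup (Fin (m + 1)) ℂ := by
  have hd : U.det * star U.det = 1 := by
    have h := congrArg Matrix.det (Matrix.mem_unitaryGroup_iff.1 hU)
    rwa [Matrix.det_mul, Matrix.star_eq_conjTranspose, Matrix.det_conjTranspose,
      Matrix.det_one] at h
  rw [Matrix.mem_specialUnitaryGroup_iff]
  refine ⟨mul_mem hU ?_, ?_⟩
  · rw [Matrix.mem_unitaryGroup_iff, Matrix.star_eq_conjTranspose,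
      Matrix.diagonal_conjTranspose, Matrix.diagonal_mul_diagonal, ← Matrix.diagonal_one]
    congr 1
    funext i
    refine Fin.cases ?_ (fun j => ?_) i
    · simpa [detCorrection, mul_comm] using hd
    · simp [detCorrection]
  · rw [Matrix.det_mul, Matrix.det_diagonal, Fin.prod_univ_succ]
    simpa [detCorrection] using hd

/-- A retraction from the invertible matrices to the special unitary group: the Gram-Schmidt
process, with the first column multiplied by a phase. -/
def specialUnitarize (N : Fin (m + 1) → Fin (m + 1) → ℂ) :
    Matrix (Fin (m + 1)) (Fin (m + 1)) ℂ :=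
  gramSchmidtMatrix N * Matrix.diagonal (detCorrection (gramSchmidtMatrix N).det)

theorem specialUnitarize_apply (N : Fin (m + 1) → Fin (m + 1) → ℂ) (i k : Fin (m + 1)) :
    specialUnitarize N i k =
      gramSchmidtMatrix N i k * detCorrection (gramSchmidtMatrix N).det k := by
  rw [specialUnitarize, Matrix.mul_diagonal]

theorem specialUnitarize_mem {N : Fin (m + 1) → Fin (m + 1) → ℂ}
    (hN : LinearIndependent ℂ (euclideanCols N)) :
    specialUnitarize N ∈ Matrix.specialUnitaryGroup (Fin (m + 1)) ℂ :=
  det_mul_detCorrection (gramSchmidtMatrix_mem hN)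

theorem specialUnitarize_eq_self (g : SU m) :
    specialUnitarize (fun i j => g.1 i j) = g.1 := by
  have h0 : gramSchmidtMatrix (fun i j => g.1 i j) = g.1 := gramSchmidtMatrix_eq_self g.2.1
  rw [specialUnitarize, h0, (Matrix.mem_specialUnitaryGroup_iff.1 g.2).2]
  have h : Matrix.diagonal (detCorrection (m := m) 1) = 1 := by
    rw [← Matrix.diagonal_one]
    congr 1
    funext i
    refine Fin.cases ?_ (fun j => ?_) i <;> simp [detCorrection]
  rw [h, mul_one]

theorem contDiffAt_specialUnitarize {N : Fin (m + 1) → Fin (m + 1) → ℂ}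
    (hN : LinearIndependent ℂ (euclideanCols N)) :
    ContDiffAt ℝ ∞ (fun (N : Fin (m + 1) → Fin (m + 1) → ℂ) (i k : Fin (m + 1)) =>
      specialUnitarize N i k) N := by
  have h1 := contDiffAt_gramSchmidtMatrix hN
  refine contDiffAt_pi.2 fun i => contDiffAt_pi.2 fun k => ?_
  simp only [specialUnitarize_apply]
  refine (contDiffAt_pi.1 (contDiffAt_pi.1 h1 i) k).mul ?_
  refine Fin.cases ?_ (fun j => contDiffAt_const) k
  have h2 : ContDiffAt ℝ ∞ (fun N => (gramSchmidtMatrix N).det) N :=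
    ContDiffAt.matrix_det fun i j => contDiffAt_pi.1 (contDiffAt_pi.1 h1 i) j
  exact Complex.conjCLE.contDiff.contDiffAt.comp N h2

theorem linearIndependent_euclideanCols (g : SU m) :
    LinearIndependent ℂ (euclideanCols fun i j => g.1 i j) :=
  (orthonormal_euclideanCols_iff.2 g.2.1).linearIndependent

/-- `specialUnitarize` preserves the flag spanned by the columns. -/
theorem span_col_specialUnitarize {N : Fin (m + 1) → Fin (m + 1) → ℂ}
    (hN : LinearIndependent ℂ (euclideanCols N)) (k : Fin (m + 1)) :
    Submodule.span ℂ ((specialUnitarize N).col '' Iic k) =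
      Submodule.span ℂ ((Matrix.of N).col '' Iic k) := by
  have hU := gramSchmidtMatrix_mem hN
  have hd : star (gramSchmidtMatrix N).det ≠ 0 := by
    intro h0
    have h := congrArg Matrix.det (Matrix.mem_unitaryGroup_iff.1 hU)
    rw [Matrix.det_mul, star_eq_zero.1 h0, zero_mul, Matrix.det_one] at h
    exact zero_ne_one h
  have h1 : Submodule.span ℂ ((gramSchmidtMatrix N).col '' Iic k) =
      Submodule.span ℂ ((Matrix.of N).col '' Iic k) := by
    have h2 := (span_gramSchmidtNormed (𝕜 := ℂ) (euclideanCols N) (Iic k)).trans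
      (span_gramSchmidt_Iic ℂ (euclideanCols N) k)
    have h3 := congrArg (Submodule.map (WithLp.linearEquiv 2 ℂ (Fin (m + 1) → ℂ)).toLinearMap) h2
    rw [Submodule.map_span, Submodule.map_span, ← image_comp, ← image_comp] at h3
    exact h3
  rw [← h1]
  -- The phase correction rescales each column by a nonzero scalar, so spans of columns are those of
  -- the Gram-Schmidt matrix.
  have h4 : ∀ j, (specialUnitarize N).col j =
      detCorrection (gramSchmidtMatrix N).det j • (gramSchmidtMatrix N).col j := fun j => by
    funext i
    change specialUnitarize N i j = _ * gramSchmidtMatrix N i j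
    rw [specialUnitarize_apply, mul_comm]
  have h5 : ∀ j : Fin (m + 1), detCorrection (gramSchmidtMatrix N).det j ≠ 0 := fun j => by
    refine Fin.cases hd (fun i => ?_) j
    simp [detCorrection]
  apply le_antisymm
  · rw [Submodule.span_le]
    rintro _ ⟨j, hj, rfl⟩
    rw [h4]
    exact Submodule.smul_mem _ _ (Submodule.subset_span ⟨j, hj, rfl⟩)
  · rw [Submodule.span_le]
    rintro _ ⟨j, hj, rfl⟩
    have h6 := Submodule.smul_mem (Submodule.span ℂ ((specialUnitarize N).col '' Iic k))
      (detCorrection (gramSchmidtMatrix N).det j)⁻¹ (Submodule.subset_span ⟨j, hj, rfl⟩)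
    rwa [h4, inv_smul_smul₀ (h5 j)] at h6

/-- If the last column is orthogonal to the others, then `specialUnitarize` only changes its
length. -/
theorem specialUnitarize_last (hm : 0 < m) {N : Fin (m + 1) → Fin (m + 1) → ℂ}
    (horth : ∀ k < Fin.last m, inner ℂ (euclideanCols N k) (euclideanCols N (Fin.last m)) = 0)
    (i : Fin (m + 1)) :
    specialUnitarize N i (Fin.last m) =
      (‖euclideanCols N (Fin.last m)‖ : ℂ)⁻¹ * N i (Fin.last m) := by
  -- As `m` is positive, the last column is not the first one, and the phase correction leaves it
  -- alone.
  obtain ⟨l, rfl⟩ := Nat.exists_eq_succ_of_ne_zero hm.ne'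
  rw [specialUnitarize_apply, ← Fin.succ_last]
  have h1 : detCorrection (m := l.succ) (gramSchmidtMatrix N).det (Fin.last l).succ = 1 := rfl
  rw [h1, mul_one, Fin.succ_last]
  change (gramSchmidtNormed ℂ (euclideanCols N) (Fin.last _)) i = _
  rw [gramSchmidtNormed, gramSchmidt_eq_self horth]
  rfl

end GramSchmidt

/-! ### The smooth structure of the special unitary group -/

/-- Near the identity, `specialUnitarize` is a smooth retraction of matrices onto SU(m + 1), and
left translations extend to linear maps of the matrix space. The second clause lets smoothness of
maps into SU(m + 1) be checked on matrix entries. -/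
theorem exists_smoothStructure_SU (m : ℕ) :
    ∃ G : SmoothStructure (SU m), IsEmbeddingSmooth 𝓘(ℝ, G.V)
      𝓘(ℝ, Fin (m + 1) → Fin (m + 1) → ℂ) (fun (g : SU m) (i j : Fin (m + 1)) => g.1 i j) ∧
      ∀ {E' H' M' : Type} [NormedAddCommGroup E'] [NormedSpace ℝ E'] [TopologicalSpace H']
        [TopologicalSpace M'] [ChartedSpace H' M'] (I' : ModelWithCorners ℝ E' H') (f : M' → SU m)
        (x : M'), ContMDiffAt I' 𝓘(ℝ, Fin (m + 1) → Fin (m + 1) → ℂ) ∞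
            (fun x i j => (f x).1 i j) x →
          ContMDiffAt I' 𝓘(ℝ, G.V) ∞ f x := by
  have hι : Topology.IsEmbedding fun (g : SU m) (i j : Fin (m + 1)) => g.1 i j :=
    Topology.IsEmbedding.subtypeVal
  have hmul : ∀ A : Matrix (Fin (m + 1)) (Fin (m + 1)) ℂ, ∃ T : (Fin (m + 1) → Fin (m + 1) → ℂ)
      →L[ℝ] (Fin (m + 1) → Fin (m + 1) → ℂ), ∀ N i j, T N i j = (A * Matrix.of N) i j := fun A => by
    refine ⟨LinearMap.toContinuousLinearMap
      { toFun := fun N i j => (A * Matrix.of N) i j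
        map_add' := fun N N' => ?_
        map_smul' := fun c N => ?_ }, fun N i j => rfl⟩
    · funext i j
      simp [Matrix.mul_apply, mul_add, Finset.sum_add_distrib]
    · funext i j
      simp [Matrix.mul_apply, Finset.mul_sum, mul_left_comm]
  choose T hT using hmul
  have hli : ∀ᶠ N in nhds (fun (i j : Fin (m + 1)) => (1 : SU m).1 i j),
      LinearIndependent ℂ (euclideanCols N) :=
    isOpen_linearIndependent_euclideanCols.mem_nhds (linearIndependent_euclideanCols 1)
  refine exists_smoothStructure_of_retraction hι (e := 1)
    (Ψ := fun N i k => specialUnitarize N i k) (hli.mono fun N hN => contDiffAt_specialUnitarize hN)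
    (hli.mono fun N hN => ⟨⟨_, specialUnitarize_mem hN⟩, rfl⟩)
    (fun g => specialUnitarize_eq_self g) (fun g => Homeomorph.mulLeft g) (fun g => T g.1)
    (fun g => T (g⁻¹).1) (fun g => mul_one g) (fun g p => ?_) (fun g p => ?_)
  · funext i j
    rw [hT]
    rfl
  · funext i j
    rw [hT]
    rfl

/-- A map out of a smooth quotient is smooth if its composition with the projection is. -/
theorem HasSmoothSections.contMDiffAt_of_comp {E E' E'' H H' H'' M X Z : Type}
    [NormedAddCommGroup E] [NormedSpace ℝ E] [TopologicalSpace H] [TopologicalSpace M]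
    [ChartedSpace H M] [NormedAddCommGroup E'] [NormedSpace ℝ E'] [TopologicalSpace H']
    [TopologicalSpace X] [ChartedSpace H' X] [NormedAddCommGroup E''] [NormedSpace ℝ E'']
    [TopologicalSpace H''] [TopologicalSpace Z] [ChartedSpace H'' Z]
    {I : ModelWithCorners ℝ E H} {J : ModelWithCorners ℝ E' H'} {K : ModelWithCorners ℝ E'' H''}
    {q : M → X} (h : HasSmoothSections I J q) {f : X → Z} {x : M}
    (hf : ContMDiffAt I K ∞ (fun y => f (q y)) x) : ContMDiffAt J K ∞ f (q x) := by
  obtain ⟨σ, h1, h2, h3⟩ := h x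
  rw [← h1] at hf
  refine (hf.comp _ h2).congr_of_eventuallyEq ?_
  filter_upwards [h3] with p hp
  exact (congrArg f hp).symm

/-! ### The smooth structure of complex projective space -/

/-- Proportionality of nonzero vectors means that all 2 × 2 minors vanish. In this form the relation
involves no unknown scalar and is visibly closed. -/
theorem CP.mk_eq_mk_iff {m : ℕ} {y y' : puncturedSpace m} :
    CP.mk y = CP.mk y' ↔ ∀ i k, y.1 i * y'.1 k = y.1 k * y'.1 i := by
  refine (Projectivization.mk_eq_mk_iff' ℂ y.1 y'.1 y.2 y'.2).trans ?_
  constructor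
  · rintro ⟨c, hc⟩ i k
    rw [← hc]
    simp only [Pi.smul_apply, smul_eq_mul]
    ring
  · intro h
    obtain ⟨j, hj⟩ := Function.ne_iff.1 y'.2
    refine ⟨y.1 j / y'.1 j, funext fun i => ?_⟩
    have h1 := h j i
    simp only [Pi.smul_apply, smul_eq_mul]
    rw [Pi.zero_apply] at hj
    field_simp
    rw [h1, mul_comm]

theorem cpCharts (m : ℕ) : QuotientCharts 𝓘(ℝ, Fin (m + 1) → ℂ) (Fin m → ℂ) (CP.mk (m := m))
    (fun j => {y | y.1 j ≠ 0}) (fun j y i => y.1 (j.succAbove i) / y.1 j) where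
  isQuotientMap := by
    refine ⟨⟨rfl⟩, fun p => ?_⟩
    induction p using Projectivization.ind with
    | h v hv => exact ⟨⟨v, hv⟩, rfl⟩
  cover y := Function.ne_iff.1 y.2
  isOpen j := isOpen_ne.preimage ((continuous_apply j).comp continuous_subtype_val)
  saturated j y y' hy h := by
    intro h0
    rw [CP.mk_eq_mk_iff] at h
    obtain ⟨k, hk⟩ := Function.ne_iff.1 y'.2
    have h1 := h j k
    rw [h0, mul_zero] at h1
    exact (mul_ne_zero hy hk) h1
  contMDiffOn j := by
    intro y hy
    refine ContMDiffAt.contMDiffWithinAt ?_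
    have h1 : ContDiffAt ℝ ∞ (fun (v : Fin (m + 1) → ℂ) (i : Fin m) => v (j.succAbove i) / v j)
        y.1 := by
      refine contDiffAt_pi.2 fun i => ?_
      simp only [div_eq_mul_inv]
      have h2 : ∀ i : Fin (m + 1), ContDiffAt ℝ ∞ (fun v : Fin (m + 1) → ℂ => v i) y.1 :=
        fun i => (contDiff_apply ℝ ℂ i).contDiffAt
      exact (h2 _).mul ((h2 j).inv hy)
    exact h1.contMDiffAt.comp y (contMDiff_subtype_val y)
  eq_iff j y hy y' hy' := by
    rw [CP.mk_eq_mk_iff]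
    change y.1 j ≠ 0 at hy
    change y'.1 j ≠ 0 at hy'
    constructor
    · intro h
      have h1 : ∀ i, y.1 i * y'.1 j = y.1 j * y'.1 i := fun i => by
        rcases Fin.eq_self_or_eq_succAbove j i with rfl | ⟨i, rfl⟩
        · rfl
        · have h2 := congrFun h i
          rw [div_eq_div_iff hy hy'] at h2
          rw [h2, mul_comm]
      intro i k
      have h2 := h1 i
      have h3 := h1 k
      have h4 : y.1 j * y'.1 j ≠ 0 := mul_ne_zero hy hy'
      refine mul_left_cancel₀ h4 ?_
      linear_combination (y.1 j * y'.1 k) * h2 - (y.1 j * y'.1 i) * h3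
    · intro h
      funext i
      rw [div_eq_div_iff hy hy', h (j.succAbove i) j, mul_comm]
  exists_section j y hy := by
    have hne : ∀ u : Fin m → ℂ, y.1 j • j.insertNth (α := fun _ => ℂ) 1 u ≠ 0 := fun u h0 => by
      have h1 := congrFun h0 j
      simp only [Pi.smul_apply, Fin.insertNth_apply_same, smul_eq_mul, mul_one] at h1
      exact hy h1
    -- The factor `y.1 j` makes the section of the affine chart pass through `y` itself rather than
    -- through a multiple of it.
    refine ⟨fun u => ⟨y.1 j • j.insertNth (α := fun _ => ℂ) 1 u, hne u⟩, ?_, ?_, ?_⟩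
    · refine Subtype.ext (funext fun i => ?_)
      rcases Fin.eq_self_or_eq_succAbove j i with rfl | ⟨i, rfl⟩
      · simp
      · simp only [Pi.smul_apply, Fin.insertNth_apply_succAbove, smul_eq_mul]
        exact mul_div_cancel₀ _ hy
    · rw [← ContMDiffAt.subtypeVal_comp_iff]
      refine ContDiffAt.contMDiffAt (contDiffAt_pi.2 fun i => ?_)
      rcases Fin.eq_self_or_eq_succAbove j i with rfl | ⟨i, rfl⟩
      · simp only [Function.comp_apply, Pi.smul_apply, Fin.insertNth_apply_same]
        exact contDiffAt_const
      · simp only [Function.comp_apply, Pi.smul_apply, Fin.insertNth_apply_succAbove]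
        have h1 := (contDiff_apply ℝ ℂ i (n := ∞)).contDiffAt (x := fun i => y.1 (j.succAbove i) / y.1 j)
        exact h1.const_smul (y.1 j)
    · refine Filter.Eventually.of_forall fun u => ⟨?_, ?_⟩
      · simpa using hy
      · funext i
        simp only [Pi.smul_apply, Fin.insertNth_apply_succAbove, Fin.insertNth_apply_same,
          smul_eq_mul, mul_one]
        exact mul_div_cancel_left₀ _ hy

theorem isClosed_CP_rel (m : ℕ) :
    IsClosed {p : puncturedSpace m × puncturedSpace m | CP.mk p.1 = CP.mk p.2} := by
  simp only [CP.mk_eq_mk_iff, Set.ofPred_forall]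
  refine isClosed_iInter fun i => isClosed_iInter fun k => ?_
  have h : ∀ i, Continuous fun y : puncturedSpace m => y.1 i := fun i =>
    (continuous_apply i).comp continuous_subtype_val
  exact isClosed_eq (((h i).comp continuous_fst).mul ((h k).comp continuous_snd))
    (((h k).comp continuous_fst).mul ((h i).comp continuous_snd))

instance (m : ℕ) : Nonempty (puncturedSpace m) := ⟨⟨1, one_ne_zero⟩⟩

/-- The smooth structure of complex projective space. -/
def cpStructure (m : ℕ) : SmoothStructure (CP m) :=
  (cpCharts m).smoothStructure (isClosed_CP_rel m)

theorem contMDiff_CP_mk (m : ℕ) :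
    ContMDiff 𝓘(ℝ, Fin (m + 1) → ℂ) 𝓘(ℝ, (cpStructure m).V) ∞ (CP.mk (m := m)) :=
  (cpCharts m).contMDiff_quotient

theorem hasSmoothSections_CP_mk (m : ℕ) :
    HasSmoothSections 𝓘(ℝ, Fin (m + 1) → ℂ) 𝓘(ℝ, (cpStructure m).V) (CP.mk (m := m)) :=
  (cpCharts m).hasSmoothSections

theorem surjective_CP_mk (m : ℕ) : Function.Surjective (CP.mk (m := m)) :=
  (cpCharts m).isQuotientMap.surjective

/-! ### Triangular factorization of matrices -/

section Triangular

variable {m : ℕ}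

/-- The leading submatrices of a matrix. -/
def leadingMinor (B : Matrix (Fin m) (Fin m) ℂ) (k : Fin m) :
    Matrix {j // j ≤ k} {j // j ≤ k} ℂ :=
  B.submatrix (fun j => j.1) (fun j => j.1)

/-- The lower triangular matrix that transforms `B` to an upper unitriangular matrix. -/
def lowerFactor (B : Matrix (Fin m) (Fin m) ℂ) : Matrix (Fin m) (Fin m) ℂ :=
  Matrix.of fun k j => if h : j ≤ k then (leadingMinor B k)⁻¹ ⟨k, le_rfl⟩ ⟨j, h⟩ else 0

/-- The matrices all of whose leading minors are nonzero. -/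
def HasLeadingMinors (B : Matrix (Fin m) (Fin m) ℂ) : Prop := ∀ k, (leadingMinor B k).det ≠ 0

theorem lowerFactor_blockTriangular (B : Matrix (Fin m) (Fin m) ℂ) :
    (lowerFactor B).BlockTriangular OrderDual.toDual := by
  intro i j hij
  exact dif_neg (not_le.2 hij)

theorem sum_subtype_le {k : Fin m} {f : Fin m → ℂ} (h : ∀ j, k < j → f j = 0) :
    ∑ j : {j // j ≤ k}, f j.1 = ∑ j, f j := by
  rw [← Finset.sum_subtype (Finset.univ.filter (· ≤ k)) (by simp) f]
  refine Finset.sum_subset (Finset.filter_subset _ _) fun j _ hj => h j ?_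
  simpa using hj

theorem lowerFactor_mul_apply (B C : Matrix (Fin m) (Fin m) ℂ) (k i : Fin m) :
    (lowerFactor B * C) k i =
      ∑ j : {j // j ≤ k}, (leadingMinor B k)⁻¹ ⟨k, le_rfl⟩ j * C j.1 i := by
  rw [Matrix.mul_apply, ← sum_subtype_le (k := k)]
  · refine Finset.sum_congr rfl fun j _ => ?_
    congr 1
    exact dif_pos j.2
  · intro j hj
    rw [lowerFactor_blockTriangular B hj, zero_mul]

/-- The upper unitriangular matrices. -/
def IsUpperUnitriangular (L : Matrix (Fin m) (Fin m) ℂ) : Prop :=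
  ∀ k i, i ≤ k → L k i = if i = k then 1 else 0

/-- Row `k` of `lowerFactor B` is the last row of the inverse of the `k`-th leading submatrix.
Against the columns up to `k` of `B` it therefore gives the last row of an identity matrix. -/
theorem lowerFactor_mul_isUpperUnitriangular {B : Matrix (Fin m) (Fin m) ℂ}
    (hB : HasLeadingMinors B) : IsUpperUnitriangular (lowerFactor B * B) := by
  intro k i hi
  rw [lowerFactor_mul_apply]
  have h1 := Matrix.nonsing_inv_mul (leadingMinor B k) (isUnit_iff_ne_zero.2 (hB k))
  have h2 := congrFun (congrFun h1 ⟨k, le_rfl⟩) ⟨i, hi⟩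
  rw [Matrix.mul_apply, Matrix.one_apply] at h2
  refine h2.trans ?_
  simp only [Subtype.mk.injEq]
  simp only [eq_comm]

theorem IsUpperUnitriangular.blockTriangular {L : Matrix (Fin m) (Fin m) ℂ}
    (h : IsUpperUnitriangular L) : L.BlockTriangular id := fun i j hij => by
  rw [h i j (le_of_lt hij)]
  exact if_neg (ne_of_lt hij)

theorem IsUpperUnitriangular.det {L : Matrix (Fin m) (Fin m) ℂ}
    (h : IsUpperUnitriangular L) : L.det = 1 := by
  rw [Matrix.det_of_isUpperTriangular h.blockTriangular]
  refine Finset.prod_eq_one fun i _ => ?_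
  rw [h i i le_rfl, if_pos rfl]

theorem IsUpperUnitriangular.leadingMinor_det {L : Matrix (Fin m) (Fin m) ℂ}
    (h : IsUpperUnitriangular L) (k : Fin m) : (leadingMinor L k).det = 1 := by
  have h1 : (leadingMinor L k).BlockTriangular id := fun i j hij => h.blockTriangular hij
  rw [Matrix.det_of_isUpperTriangular h1]
  refine Finset.prod_eq_one fun i _ => ?_
  change L i.1 i.1 = 1
  rw [h i i le_rfl, if_pos rfl]

theorem IsUpperUnitriangular.hasLeadingMinors {L : Matrix (Fin m) (Fin m) ℂ}
    (h : IsUpperUnitriangular L) : HasLeadingMinors L := fun k => by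
  rw [h.leadingMinor_det]
  exact one_ne_zero

/-- Uniqueness of the triangular factorization. -/
theorem IsUpperUnitriangular.eq_of_mul {L L' D : Matrix (Fin m) (Fin m) ℂ}
    (h : IsUpperUnitriangular L) (h' : IsUpperUnitriangular L')
    (hD : D.BlockTriangular OrderDual.toDual) (hDL : D * L = L') : L = L' := by
  -- Induction along row `k`: in the entry `(k, i)` of `D * L = L'`, the terms with `j < i` vanish
  -- by induction and those with `j > i` because `L` is triangular. With lower triangularity of `D`
  -- this forces `D = 1`.
  have h1 : ∀ k i, i ≤ k → D k i = if i = k then 1 else 0 := by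
    intro k i
    induction i using WellFoundedLT.induction with
    | ind i ih =>
      intro hi
      have h2 := congrFun (congrFun hDL k) i
      rw [h' k i hi, Matrix.mul_apply, Finset.sum_eq_single i] at h2
      · rwa [h i i le_rfl, if_pos rfl, mul_one] at h2
      · intro j _ hj
        rcases lt_or_gt_of_ne hj with hj | hj
        · rw [ih j hj (hj.le.trans hi), if_neg (lt_of_lt_of_le hj hi).ne, zero_mul]
        · rw [h j i hj.le, if_neg hj.ne, mul_zero]
      · simp
  have h3 : D = 1 := by
    ext k i
    rw [Matrix.one_apply]
    rcases le_or_gt i k with hi | hi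
    · rw [h1 k i hi]
      simp only [eq_comm]
    · rw [hD hi, if_neg hi.ne]
  rw [← hDL, h3, one_mul]

/-- For lower triangular `D`, taking leading submatrices is compatible with the product `D * B`, and
those of `D` are invertible because all diagonal entries of `D` are nonzero. -/
theorem HasLeadingMinors.mul {B D : Matrix (Fin m) (Fin m) ℂ} (hB : HasLeadingMinors B)
    (hD : D.BlockTriangular OrderDual.toDual) (hd : D.det ≠ 0) : HasLeadingMinors (D * B) := by
  intro k
  have h1 : leadingMinor (D * B) k = leadingMinor D k * leadingMinor B k := by
    ext i j
    rw [Matrix.mul_apply]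
    change (D * B) i.1 j.1 = ∑ l : {l // l ≤ k}, D i.1 l.1 * B l.1 j.1
    rw [Matrix.mul_apply, ← sum_subtype_le (k := k)]
    intro l hl
    have h0 : D i.1 l = 0 := hD (OrderDual.toDual_lt_toDual.2 (lt_of_le_of_lt i.2 hl))
    rw [h0, zero_mul]
  have h2 : (leadingMinor D k).BlockTriangular OrderDual.toDual := fun i j hij => hD hij
  have h3 := Matrix.det_of_isLowerTriangular _ h2
  rw [Matrix.det_of_isLowerTriangular _ hD, Finset.prod_ne_zero_iff] at hd
  rw [h1, Matrix.det_mul, h3]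
  refine mul_ne_zero ?_ (hB k)
  exact Finset.prod_ne_zero_iff.2 fun i _ => hd i.1 (Finset.mem_univ _)

theorem det_lowerFactor_ne_zero {B : Matrix (Fin m) (Fin m) ℂ} (hB : HasLeadingMinors B) :
    (lowerFactor B).det ≠ 0 := by
  have h := (lowerFactor_mul_isUpperUnitriangular hB).det
  rw [Matrix.det_mul] at h
  exact left_ne_zero_of_mul_eq_one h

/-- The upper unitriangular matrix with given entries above the diagonal. -/
def unitriangular (l : {p : Fin m × Fin m // p.1 < p.2} → ℂ) : Matrix (Fin m) (Fin m) ℂ :=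
  Matrix.of fun k i => if h : k < i then l ⟨(k, i), h⟩ else if i = k then 1 else 0

theorem isUpperUnitriangular_unitriangular (l : {p : Fin m × Fin m // p.1 < p.2} → ℂ) :
    IsUpperUnitriangular (unitriangular l) := fun _ _ hi => dif_neg (not_lt.2 hi)

theorem IsUpperUnitriangular.eq_unitriangular {L : Matrix (Fin m) (Fin m) ℂ}
    (h : IsUpperUnitriangular L) : L = unitriangular fun p => L p.1.1 p.1.2 := by
  ext k i
  rcases le_or_gt i k with hi | hi
  · rw [h k i hi, isUpperUnitriangular_unitriangular _ k i hi]
  · rw [unitriangular, Matrix.of_apply, dif_pos hi]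

theorem unitriangular_apply (l : {p : Fin m × Fin m // p.1 < p.2} → ℂ)
    (p : {p : Fin m × Fin m // p.1 < p.2}) : unitriangular l p.1.1 p.1.2 = l p := dif_pos p.2

end Triangular

/-! ### The smooth structure of the flag manifold -/

section Flags

variable {m : ℕ}

theorem det_ne_zero_of_frames (b : frames m) : (Matrix.of b.1).det ≠ 0 :=
  ((Matrix.isUnit_iff_isUnit_det _).1 (Matrix.linearIndependent_rows_iff_isUnit.1 b.2)).ne_zero

theorem linearIndependent_of_det_ne_zero {B : Matrix (Fin m) (Fin m) ℂ} (h : B.det ≠ 0) :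
    LinearIndependent ℂ fun i j => B i j :=
  Matrix.linearIndependent_rows_iff_isUnit.2
    ((Matrix.isUnit_iff_isUnit_det _).2 (isUnit_iff_ne_zero.2 h))

theorem span_image_Iic_le {W : Type} [AddCommGroup W] [Module ℂ W] {b b' : Fin m → W}
    {D : Matrix (Fin m) (Fin m) ℂ} (hD : D.BlockTriangular OrderDual.toDual)
    (h : ∀ k, b k = ∑ j, D k j • b' j) (k : Fin m) :
    Submodule.span ℂ (b '' Set.Iic k) ≤ Submodule.span ℂ (b' '' Set.Iic k) := by
  rw [Submodule.span_le]
  rintro _ ⟨i, hi, rfl⟩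
  rw [h]
  refine Submodule.sum_mem _ fun j _ => ?_
  rcases le_or_gt j i with hj | hj
  · exact Submodule.smul_mem _ _ (Submodule.subset_span ⟨j, hj.trans hi, rfl⟩)
  · rw [hD hj, zero_smul]
    exact Submodule.zero_mem _

/-- Frames are the rows of a matrix, so the quotient matrix expresses `b` in terms of `b'`. It is
lower triangular exactly when each `b i` is a combination of `b' 0, …, b' i`. -/
theorem flagOfFrame_eq_iff {b b' : frames m} : flagOfFrame b = flagOfFrame b' ↔
    (Matrix.of b.1 * (Matrix.of b'.1)⁻¹).BlockTriangular OrderDual.toDual := by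
  have hb' := isUnit_iff_ne_zero.2 (det_ne_zero_of_frames b')
  have hrow : ∀ k, b.1 k = ∑ j, (Matrix.of b.1 * (Matrix.of b'.1)⁻¹) k j • b'.1 j := fun k => by
    funext i
    have h1 : Matrix.of b.1 k i =
        ((Matrix.of b.1 * (Matrix.of b'.1)⁻¹) * Matrix.of b'.1) k i := by
      rw [Matrix.mul_assoc, Matrix.nonsing_inv_mul _ hb', mul_one]
    rw [Matrix.mul_apply] at h1
    rw [Finset.sum_apply]
    exact h1
  constructor
  · intro h i j hij
    have h1 : b.1 i ∈ Submodule.span ℂ (b'.1 '' Set.Iic i) := by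
      have h2 : (flagOfFrame b).space i = (flagOfFrame b').space i := by rw [h]
      change Submodule.span ℂ (b.1 '' Set.Iic i) = Submodule.span ℂ (b'.1 '' Set.Iic i) at h2
      rw [← h2]
      exact Submodule.subset_span ⟨i, Set.self_mem_Iic, rfl⟩
    -- The map on the right is the `j`-th coordinate in the frame `b'`; it kills `b' l` for every `l
    -- ≠ j`.
    have h2 : Submodule.span ℂ (b'.1 '' Set.Iic i) ≤
        LinearMap.ker ((LinearMap.proj j).comp (Matrix.vecMulLinear (Matrix.of b'.1)⁻¹)) := by
      rw [Submodule.span_le]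
      rintro _ ⟨l, hl, rfl⟩
      have h3 := congrFun (congrFun (Matrix.mul_nonsing_inv _ hb') l) j
      have h4 : l ≠ j := (lt_of_le_of_lt (Set.mem_Iic.1 hl) (OrderDual.toDual_lt_toDual.1 hij)).ne
      exact h3.trans (Matrix.one_apply_ne h4)
    exact h2 h1
  · intro h
    refine FullFlag.ext (funext fun k => ?_)
    refine Submodule.eq_of_le_of_finrank_eq (span_image_Iic_le h hrow k) ?_
    exact ((flagOfFrame b).finrank_space k).trans ((flagOfFrame b').finrank_space k).symm

/-- The matrix of the coordinates of the frame `b` in the frame `a`. -/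
def frameCoords (a b : frames m) : Matrix (Fin m) (Fin m) ℂ :=
  Matrix.of b.1 * (Matrix.of a.1)⁻¹

theorem frameCoords_mul (a b : frames m) :
    frameCoords a b * Matrix.of a.1 = Matrix.of b.1 := by
  rw [frameCoords, Matrix.mul_assoc,
    Matrix.nonsing_inv_mul _ (isUnit_iff_ne_zero.2 (det_ne_zero_of_frames a)), mul_one]

theorem contDiff_frameCoords (a : frames m) (i j : Fin m) :
    ContDiff ℝ ∞ fun b : Fin m → Fin m → ℂ => (Matrix.of b * (Matrix.of a.1)⁻¹) i j := by
  simp only [Matrix.mul_apply, Matrix.of_apply]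
  exact ContDiff.sum fun l _ => (contDiff_apply_apply ℝ ℂ i l).mul contDiff_const

theorem contMDiff_frameCoords (a : frames m) (i j : Fin m) :
    ContMDiff 𝓘(ℝ, Fin m → Fin m → ℂ) 𝓘(ℝ, ℂ) ∞ fun b : frames m => frameCoords a b i j :=
  (contDiff_frameCoords a i j).contMDiff.comp contMDiff_subtype_val

theorem blockTriangular_inv {D : Matrix (Fin m) (Fin m) ℂ}
    (hD : D.BlockTriangular OrderDual.toDual) (hd : D.det ≠ 0) :
    D⁻¹.BlockTriangular OrderDual.toDual := by
  have := D.invertibleOfIsUnitDet (isUnit_iff_ne_zero.2 hd)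
  exact Matrix.blockTriangular_inv_of_blockTriangular hD

theorem contMDiffAt_lowerFactor_mul {a b : frames m} (hb : HasLeadingMinors (frameCoords a b))
    (k i : Fin m) : ContMDiffAt 𝓘(ℝ, Fin m → Fin m → ℂ) 𝓘(ℝ, ℂ) ∞
      (fun b : frames m => (lowerFactor (frameCoords a b) * frameCoords a b) k i) b := by
  simp only [lowerFactor_mul_apply]
  let C : (Fin m → Fin m → ℂ) → Matrix (Fin m) (Fin m) ℂ := fun b =>
    Matrix.of b * (Matrix.of a.1)⁻¹
  have hC : ∀ i j, ContDiffAt ℝ ∞ (fun b => C b i j) b.1 := fun i j =>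
    (contDiff_frameCoords a i j).contDiffAt
  have h2 : ∀ j, ContDiffAt ℝ ∞ (fun b => (leadingMinor (C b) k)⁻¹ ⟨k, le_rfl⟩ j) b.1 := fun j =>
    ContDiffAt.matrix_inv (A := fun b => leadingMinor (C b) k) (fun i j => hC i.1 j.1) (hb k) _ _
  have h1 : ContDiffAt ℝ ∞ (fun b => ∑ j : {j // j ≤ k},
      (leadingMinor (C b) k)⁻¹ ⟨k, le_rfl⟩ j * C b j.1 i) b.1 :=
    ContDiffAt.sum fun j _ => (h2 j).mul (hC j.1 i)
  exact h1.contMDiffAt.comp b (contMDiff_subtype_val b)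

theorem hasLeadingMinors_congr {a b b' : frames m} (hb : HasLeadingMinors (frameCoords a b))
    (h : flagOfFrame b' = flagOfFrame b) : HasLeadingMinors (frameCoords a b') := by
  rw [flagOfFrame_eq_iff] at h
  have h1 : frameCoords a b' = (Matrix.of b'.1 * (Matrix.of b.1)⁻¹) * frameCoords a b := by
    rw [frameCoords, frameCoords, ← Matrix.mul_assoc, Matrix.mul_assoc (Matrix.of b'.1),
      Matrix.nonsing_inv_mul _ (isUnit_iff_ne_zero.2 (det_ne_zero_of_frames b)), mul_one]
  rw [h1]
  refine hb.mul h ?_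
  rw [Matrix.det_mul]
  refine mul_ne_zero (det_ne_zero_of_frames b') ?_
  rw [Matrix.det_nonsing_inv, Ring.inverse_eq_inv']
  exact inv_ne_zero (det_ne_zero_of_frames b)

/-- Frames of one flag differ by a lower triangular matrix, and each class in the chart domain
contains a unique frame whose coordinates in `a` are upper unitriangular. -/
theorem flagOfFrame_eq_iff_unitriangular {a b b' : frames m}
    (hb : HasLeadingMinors (frameCoords a b)) (hb' : HasLeadingMinors (frameCoords a b')) :
    flagOfFrame b = flagOfFrame b' ↔ lowerFactor (frameCoords a b) * frameCoords a b =
      lowerFactor (frameCoords a b') * frameCoords a b' := by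
  rw [flagOfFrame_eq_iff]
  have hL := lowerFactor_mul_isUpperUnitriangular hb
  have hL' := lowerFactor_mul_isUpperUnitriangular hb'
  have hD := lowerFactor_blockTriangular (frameCoords a b)
  have hD' := lowerFactor_blockTriangular (frameCoords a b')
  have hd := det_lowerFactor_ne_zero hb
  have hd' := det_lowerFactor_ne_zero hb'
  set D := lowerFactor (frameCoords a b)
  set D' := lowerFactor (frameCoords a b')
  have hu := isUnit_iff_ne_zero.2 hd
  have hu' := isUnit_iff_ne_zero.2 hd'
  have hub' := isUnit_iff_ne_zero.2 (det_ne_zero_of_frames b')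
  constructor
  · intro h
    -- This product of lower triangular matrices carries the normal form of `b'` to that of `b`, so
    -- uniqueness applies.
    refine (hL'.eq_of_mul hL (D := D * (Matrix.of b.1 * (Matrix.of b'.1)⁻¹) * D'⁻¹)
      ((hD.mul h).mul (blockTriangular_inv hD' hd')) ?_).symm
    rw [← Matrix.mul_assoc, Matrix.nonsing_inv_mul_cancel_right _ _ hu', frameCoords, frameCoords,
      ← Matrix.mul_assoc, Matrix.mul_assoc D, Matrix.nonsing_inv_mul_cancel_right _ _ hub',
      Matrix.mul_assoc]
  · intro h
    have h1 : Matrix.of b.1 * (Matrix.of b'.1)⁻¹ = D⁻¹ * D' := by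
      have h2 : D * Matrix.of b.1 = D' * Matrix.of b'.1 := by
        rw [← frameCoords_mul a b, ← frameCoords_mul a b', ← Matrix.mul_assoc, h, Matrix.mul_assoc]
      calc Matrix.of b.1 * (Matrix.of b'.1)⁻¹ = D⁻¹ * (D * Matrix.of b.1) * (Matrix.of b'.1)⁻¹ := by
            rw [Matrix.nonsing_inv_mul_cancel_left _ _ hu]
        _ = D⁻¹ * D' := by
            rw [h2, Matrix.mul_assoc, Matrix.mul_nonsing_inv_cancel_right _ _ hub']
    rw [h1]
    exact (blockTriangular_inv hD hd).mul hD'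

/-- By dimension, each space of the flag contains a vector outside the sum of the smaller spaces.
Such vectors are independent: in a linear relation, the last one with nonzero coefficient would lie
in the sum of the smaller spaces. -/
theorem surjective_flagOfFrame : Function.Surjective (flagOfFrame (m := m)) := by
  intro φ
  have h1 : ∀ k, ∃ v ∈ φ.space k, v ∉ ⨆ i : Set.Iio k, φ.space i.1 := by
    intro k
    by_contra! h
    have h2 : Module.finrank ℂ (φ.space k) ≤ Module.finrank ℂ ↥(⨆ i : Set.Iio k, φ.space i.1) :=
      Submodule.finrank_mono h
    rw [φ.finrank_space] at h2
    -- For `k = 0` there are no smaller spaces and the sum is zero; otherwise the sum is contained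
    -- in the preceding space, whose dimension is one less.
    obtain ⟨_ | j, hj⟩ := k
    · have h3 : (⨆ i : Set.Iio (⟨0, hj⟩ : Fin m), φ.space i.1) = ⊥ := by
        rw [iSup_eq_bot]
        rintro ⟨i, hi⟩
        exact absurd (Fin.lt_def.1 hi) (Nat.not_lt_zero _)
      rw [h3, finrank_bot] at h2
      omega
    · have h3 : (⨆ i : Set.Iio (⟨j + 1, hj⟩ : Fin m), φ.space i.1) ≤ φ.space ⟨j, by omega⟩ :=
        iSup_le fun i => φ.mono (Fin.le_def.2 (Nat.le_of_lt_succ (Fin.lt_def.1 i.2)))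
      have h4 := h2.trans (Submodule.finrank_mono h3)
      rw [φ.finrank_space] at h4
      simp at h4
  choose a ha ha' using h1
  have hli : LinearIndependent ℂ a := by
    rw [Fintype.linearIndependent_iff]
    by_contra! h
    obtain ⟨c, hc, i, hi⟩ := h
    obtain ⟨k, hk, hmax⟩ := Finset.exists_maximal (s := Finset.univ.filter fun k => c k ≠ 0)
      ⟨i, by simpa using hi⟩
    have hck : c k ≠ 0 := by simpa using hk
    have hlt : ∀ j, k < j → c j = 0 := fun j hj => by
      by_contra h0
      exact absurd (hmax (by simpa using h0) hj.le) (not_le.2 hj)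
    refine ha' k ?_
    have h2 : a k = -(c k)⁻¹ • ∑ j ∈ Finset.univ.erase k, c j • a j := by
      rw [← Finset.add_sum_erase _ _ (Finset.mem_univ k)] at hc
      rw [eq_neg_of_add_eq_zero_right hc, smul_neg, neg_smul, neg_neg, inv_smul_smul₀ hck]
    rw [h2]
    refine Submodule.smul_mem _ _ (Submodule.sum_mem _ fun j hj => ?_)
    rcases lt_or_gt_of_ne (Finset.ne_of_mem_erase hj) with hj | hj
    · exact Submodule.smul_mem _ _
        (Submodule.mem_iSup_of_mem (p := fun i : Set.Iio k => φ.space i.1) ⟨j, hj⟩ (ha j))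
    · rw [hlt j hj, zero_smul]
      exact Submodule.zero_mem _
  refine ⟨⟨a, hli⟩, FullFlag.ext (funext fun k => ?_)⟩
  refine Submodule.eq_of_le_of_finrank_eq (Submodule.span_le.2 ?_)
    (((flagOfFrame ⟨a, hli⟩).finrank_space k).trans (φ.finrank_space k).symm)
  rintro _ ⟨i, hi, rfl⟩
  exact φ.mono hi (ha i)

/-- The chart domains of the flag manifold. -/
def flagChartSource (a : frames m) : Set (frames m) := {b | HasLeadingMinors (frameCoords a b)}

/-- The charts of the flag manifold. -/
def flagChart (a b : frames m) (p : {p : Fin m × Fin m // p.1 < p.2}) : ℂ :=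
  (lowerFactor (frameCoords a b) * frameCoords a b) p.1.1 p.1.2

/-- The rows of an invertible matrix, as a frame. -/
def frameOfMatrix (B : Matrix (Fin m) (Fin m) ℂ) (h : B.det ≠ 0) : frames m :=
  ⟨fun i j => B i j, linearIndependent_of_det_ne_zero h⟩

theorem frameCoords_frameOfMatrix (a : frames m) {B C : Matrix (Fin m) (Fin m) ℂ} (h : B.det ≠ 0)
    (hB : B = C * Matrix.of a.1) : frameCoords a (frameOfMatrix B h) = C := by
  subst hB
  exact Matrix.mul_nonsing_inv_cancel_right _ _ (isUnit_iff_ne_zero.2 (det_ne_zero_of_frames a))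

theorem contDiff_unitriangular (i j : Fin m) :
    ContDiff ℝ ∞ fun l : {p : Fin m × Fin m // p.1 < p.2} → ℂ => unitriangular l i j := by
  simp only [unitriangular, Matrix.of_apply]
  split_ifs
  · exact contDiff_apply ℝ ℂ _
  · exact contDiff_const
  · exact contDiff_const

/-- The section is `l ↦ D⁻¹ * unitriangular l * a`, with `D` the lower factor of `b` held fixed. The
factor `D⁻¹` does not change the flag; it makes the section pass through `b` and not only through a
frame of the same flag. -/
theorem exists_section_flagChart {a b : frames m} (hb : HasLeadingMinors (frameCoords a b)) :
    ∃ s : ({p : Fin m × Fin m // p.1 < p.2} → ℂ) → frames m, s (flagChart a b) = b ∧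
      ContMDiffAt 𝓘(ℝ, {p : Fin m × Fin m // p.1 < p.2} → ℂ) 𝓘(ℝ, Fin m → Fin m → ℂ) ∞ s
        (flagChart a b) ∧
      ∀ᶠ l in nhds (flagChart a b), s l ∈ flagChartSource a ∧ flagChart a (s l) = l := by
  have hD := lowerFactor_blockTriangular (frameCoords a b)
  have hd := det_lowerFactor_ne_zero hb
  have hL := (lowerFactor_mul_isUpperUnitriangular hb).eq_unitriangular
  change _ = unitriangular (flagChart a b) at hL
  set D := lowerFactor (frameCoords a b)
  have hu := isUnit_iff_ne_zero.2 hd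
  have hdi : D⁻¹.det ≠ 0 := by
    rw [Matrix.det_nonsing_inv, Ring.inverse_eq_inv']
    exact inv_ne_zero hd
  let B : ({p : Fin m × Fin m // p.1 < p.2} → ℂ) → Matrix (Fin m) (Fin m) ℂ := fun l =>
    D⁻¹ * unitriangular l * Matrix.of a.1
  have hdet : ∀ l, (B l).det ≠ 0 := fun l => by
    simp only [B]
    rw [Matrix.det_mul, Matrix.det_mul, (isUpperUnitriangular_unitriangular l).det, mul_one]
    exact mul_ne_zero hdi (det_ne_zero_of_frames a)
  have hco : ∀ l, frameCoords a (frameOfMatrix (B l) (hdet l)) = D⁻¹ * unitriangular l := fun l =>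
    frameCoords_frameOfMatrix a (hdet l) rfl
  refine ⟨fun l => frameOfMatrix (B l) (hdet l), ?_, ?_, Filter.Eventually.of_forall fun l => ?_⟩
  · refine Subtype.ext ?_
    have h1 : B (flagChart a b) = Matrix.of b.1 := by
      simp only [B]
      rw [← hL, Matrix.nonsing_inv_mul_cancel_left _ _ hu, frameCoords_mul]
    funext i j
    exact congrFun (congrFun h1 i) j
  · rw [← ContMDiffAt.subtypeVal_comp_iff]
    refine ContDiffAt.contMDiffAt (contDiffAt_pi.2 fun i => contDiffAt_pi.2 fun j => ?_)
    change ContDiffAt ℝ ∞ (fun l => B l i j) _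
    simp only [B, Matrix.mul_apply]
    exact ContDiffAt.sum fun x _ => (ContDiffAt.sum fun y _ =>
      contDiffAt_const.mul (contDiff_unitriangular _ _).contDiffAt).mul contDiffAt_const
  · have hU := isUpperUnitriangular_unitriangular l
    have hg : HasLeadingMinors (D⁻¹ * unitriangular l) :=
      hU.hasLeadingMinors.mul (blockTriangular_inv hD hd) hdi
    refine ⟨?_, ?_⟩
    · change HasLeadingMinors (frameCoords a _)
      rwa [hco]
    -- The factorization of `D⁻¹ * unitriangular l` is unique, so the chart returns `l`.
    · have h1 : unitriangular l = lowerFactor (D⁻¹ * unitriangular l) * (D⁻¹ * unitriangular l) :=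
        hU.eq_of_mul (lowerFactor_mul_isUpperUnitriangular hg)
          (D := lowerFactor (D⁻¹ * unitriangular l) * D⁻¹)
          ((lowerFactor_blockTriangular _).mul (blockTriangular_inv hD hd))
          (Matrix.mul_assoc _ _ _)
      funext p
      simp only [flagChart, hco]
      rw [← h1, unitriangular_apply]

theorem flCharts (m : ℕ) : QuotientCharts 𝓘(ℝ, Fin m → Fin m → ℂ)
    ({p : Fin m × Fin m // p.1 < p.2} → ℂ) (flagOfFrame (m := m)) flagChartSource flagChart where
  isQuotientMap := ⟨⟨rfl⟩, surjective_flagOfFrame⟩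
  cover b := by
    -- Each frame lies in the chart domain centred at itself, where its coordinate matrix is the
    -- identity.
    refine ⟨b, ?_⟩
    change HasLeadingMinors (frameCoords b b)
    rw [frameCoords, Matrix.mul_nonsing_inv _ (isUnit_iff_ne_zero.2 (det_ne_zero_of_frames b))]
    refine IsUpperUnitriangular.hasLeadingMinors fun k i _ => ?_
    rw [Matrix.one_apply]
    simp only [eq_comm]
  isOpen a := by
    simp only [flagChartSource, HasLeadingMinors, Set.ofPred_forall]
    refine isOpen_iInter_of_finite fun k => isOpen_ne.preimage ?_
    exact Continuous.matrix_det (continuous_matrix fun i j =>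
      (contMDiff_frameCoords a i.1 j.1).continuous)
  saturated a b b' hb h := hasLeadingMinors_congr hb h.symm
  contMDiffOn a b hb := by
    refine ContMDiffAt.contMDiffWithinAt (contMDiffAt_pi_space.2 fun p => ?_)
    exact contMDiffAt_lowerFactor_mul hb _ _
  eq_iff a b hb b' hb' := by
    rw [flagOfFrame_eq_iff_unitriangular hb hb',
      (lowerFactor_mul_isUpperUnitriangular hb).eq_unitriangular,
      (lowerFactor_mul_isUpperUnitriangular hb').eq_unitriangular]
    constructor
    · intro h
      exact congrArg unitriangular h
    · intro h
      funext p
      have h1 := congrFun (congrFun h p.1.1) p.1.2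
      rw [unitriangular_apply, unitriangular_apply] at h1
      exact h1
  exists_section a b hb := exists_section_flagChart hb

theorem isClosed_flag_rel (m : ℕ) :
    IsClosed {p : frames m × frames m | flagOfFrame p.1 = flagOfFrame p.2} := by
  simp only [flagOfFrame_eq_iff, Matrix.BlockTriangular, Set.ofPred_forall]
  refine isClosed_iInter fun i => isClosed_iInter fun j => isClosed_iInter fun _ =>
    isClosed_eq ?_ continuous_const
  have h0 : Continuous fun p : frames m × frames m => p.1.1 :=
    continuous_subtype_val.comp continuous_fst
  have h0' : Continuous fun p : frames m × frames m => p.2.1 :=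
    continuous_subtype_val.comp continuous_snd
  have h1 : Continuous fun p : frames m × frames m => Matrix.of p.1.1 := h0
  have h2 : Continuous fun p : frames m × frames m => Matrix.of p.2.1 := h0'
  have h3 : Continuous fun p : frames m × frames m => (Matrix.of p.2.1)⁻¹ := by
    simp only [Matrix.inv_def, Ring.inverse_eq_inv']
    exact (h2.matrix_det.inv₀ fun p => det_ne_zero_of_frames p.2).smul h2.matrix_adjugate
  exact (h1.matrix_mul h3).matrix_elem i j

instance (m : ℕ) : Nonempty (frames m) :=
  ⟨⟨fun i j => (1 : Matrix (Fin m) (Fin m) ℂ) i j, linearIndependent_of_det_ne_zero (by simp)⟩⟩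

/-- The smooth structure of the flag manifold. -/
def flagStructure (m : ℕ) : SmoothStructure (FullFlag m (Fin m → ℂ)) :=
  (flCharts m).smoothStructure (isClosed_flag_rel m)

theorem contMDiff_flagOfFrame (m : ℕ) :
    ContMDiff 𝓘(ℝ, Fin m → Fin m → ℂ) 𝓘(ℝ, (flagStructure m).V) ∞ (flagOfFrame (m := m)) :=
  (flCharts m).contMDiff_quotient

theorem hasSmoothSections_flagOfFrame (m : ℕ) :
    HasSmoothSections 𝓘(ℝ, Fin m → Fin m → ℂ) 𝓘(ℝ, (flagStructure m).V)
      (flagOfFrame (m := m)) :=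
  (flCharts m).hasSmoothSections

end Flags

/-! ### Fibre coordinates of the associated bundle -/

section Coordinates

variable {m : ℕ}

/-- Conjugation of all coordinates but the first one. -/
def partialConj (y : Fin (m + 1) → ℂ) : Fin (m + 1) → ℂ := Fin.cons (y 0) fun i => star (y i.succ)

theorem partialConj_partialConj (y : Fin (m + 1) → ℂ) : partialConj (partialConj y) = y := by
  funext i
  refine Fin.cases ?_ (fun j => ?_) i <;> simp [partialConj]

theorem partialConj_ne_zero {y : Fin (m + 1) → ℂ} {i : Fin (m + 1)} (h : y i ≠ 0) :
    partialConj y i ≠ 0 := by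
  revert h
  refine Fin.cases ?_ (fun j => ?_) i <;> simp [partialConj]

theorem conjLastColumn_eq (g : SU m) :
    conjLastColumn g = partialConj fun i => g.1 i (Fin.last m) := rfl

theorem partialConj_conjLastColumn (g : SU m) (i : Fin (m + 1)) :
    partialConj (conjLastColumn g) i = g.1 i (Fin.last m) := by
  rw [conjLastColumn_eq, partialConj_partialConj]

/-- Multiplication of the first coordinate by `c`. -/
def scaleFirst (c : ℂ) (i : Fin (m + 1)) : ℂ := (Fin.cons c fun _ => 1 : Fin (m + 1) → ℂ) i

theorem scaleFirst_zero (c : ℂ) : scaleFirst c (0 : Fin (m + 1)) = c := rfl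

theorem scaleFirst_succ (c : ℂ) (i : Fin m) : scaleFirst c i.succ = 1 := rfl

theorem scaleFirst_mul (c d : ℂ) (i : Fin (m + 1)) :
    scaleFirst c i * scaleFirst d i = scaleFirst (c * d) i := by
  refine Fin.cases ?_ (fun j => ?_) i <;> simp [scaleFirst]

theorem scaleFirst_one (i : Fin (m + 1)) : scaleFirst (1 : ℂ) i = 1 := by
  refine Fin.cases ?_ (fun j => ?_) i <;> simp [scaleFirst]

/-- Orthogonality of `w` to the vector whose partial conjugate is `y`. -/
def IsPerp (y w : Fin (m + 1) → ℂ) : Prop := ∑ i, star (partialConj y i) * w i = 0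

/-- The coordinates of a vector `w` of the fibre over the line spanned by `y` in the `j`-th
trivialization. -/
def fiberCoord (j : Fin (m + 1)) (y : Fin (m + 1) → ℂ) :
    (Fin (m + 1) → ℂ) →ₗ[ℂ] (Fin m → ℂ) where
  -- Replacing `y` by `c • y` multiplies this factor by `star c / c`, which cancels the factor `c /
  -- star c` of `fiberAct` on the first coordinate.
  toFun w i := scaleFirst (star (y j) / y j) (j.succAbove i) * w (j.succAbove i)
  map_add' w w' := by
    funext i
    exact mul_add _ _ _
  map_smul' c w := by
    funext i
    exact mul_left_comm _ _ _

/-- The vector with given coordinates in the `j`-th trivialization. -/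
def fiberLift (j : Fin (m + 1)) (y : Fin (m + 1) → ℂ) :
    (Fin m → ℂ) →ₗ[ℂ] (Fin (m + 1) → ℂ) where
  -- The dropped `j`-th coordinate is recovered by solving the equation of `IsPerp` for it; its
  -- coefficient there is nonzero when `y j ≠ 0`.
  toFun u := j.insertNth (α := fun _ => ℂ)
    (-(star (partialConj y j))⁻¹ * ∑ i, star (partialConj y (j.succAbove i)) *
      (scaleFirst (y j / star (y j)) (j.succAbove i) * u i))
    fun i => scaleFirst (y j / star (y j)) (j.succAbove i) * u i
  map_add' u u' := by
    funext k
    rcases Fin.eq_self_or_eq_succAbove j k with rfl | ⟨i, rfl⟩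
    · simp [mul_add, Finset.sum_add_distrib]
    · simp [mul_add]
  map_smul' c u := by
    funext k
    rcases Fin.eq_self_or_eq_succAbove j k with rfl | ⟨i, rfl⟩
    · simp [Finset.mul_sum, mul_left_comm]
    · simp [mul_left_comm]

theorem fiberCoord_apply (j : Fin (m + 1)) (y w : Fin (m + 1) → ℂ) (i : Fin m) :
    fiberCoord j y w i = scaleFirst (star (y j) / y j) (j.succAbove i) * w (j.succAbove i) := rfl

theorem fiberLift_apply_same (j : Fin (m + 1)) (y : Fin (m + 1) → ℂ) (u : Fin m → ℂ) :
    fiberLift j y u j = -(star (partialConj y j))⁻¹ * ∑ i, star (partialConj y (j.succAbove i)) *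
      (scaleFirst (y j / star (y j)) (j.succAbove i) * u i) := by
  simp only [fiberLift, LinearMap.coe_mk, AddHom.coe_mk, Fin.insertNth_apply_same]

theorem fiberLift_apply_succAbove (j : Fin (m + 1)) (y : Fin (m + 1) → ℂ) (u : Fin m → ℂ)
    (i : Fin m) :
    fiberLift j y u (j.succAbove i) = scaleFirst (y j / star (y j)) (j.succAbove i) * u i := by
  simp only [fiberLift, LinearMap.coe_mk, AddHom.coe_mk, Fin.insertNth_apply_succAbove]

theorem fiberCoord_fiberLift {j : Fin (m + 1)} {y : Fin (m + 1) → ℂ} (hy : y j ≠ 0)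
    (u : Fin m → ℂ) : fiberCoord j y (fiberLift j y u) = u := by
  funext i
  have hy' : star (y j) ≠ 0 := star_ne_zero.2 hy
  rw [fiberCoord_apply, fiberLift_apply_succAbove, ← mul_assoc, scaleFirst_mul,
    div_mul_div_cancel₀ hy, div_self hy', scaleFirst_one, one_mul]

theorem isPerp_fiberLift {j : Fin (m + 1)} {y : Fin (m + 1) → ℂ} (hy : y j ≠ 0)
    (u : Fin m → ℂ) : IsPerp y (fiberLift j y u) := by
  have hx : star (partialConj y j) ≠ 0 := star_ne_zero.2 (partialConj_ne_zero hy)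
  rw [IsPerp, Fin.sum_univ_succAbove _ j, fiberLift_apply_same]
  simp only [fiberLift_apply_succAbove]
  rw [← mul_assoc, mul_neg, mul_inv_cancel₀ hx, neg_one_mul, neg_add_cancel]

theorem fiberLift_fiberCoord {j : Fin (m + 1)} {y w : Fin (m + 1) → ℂ} (hy : y j ≠ 0)
    (hw : IsPerp y w) : fiberLift j y (fiberCoord j y w) = w := by
  have hy' : star (y j) ≠ 0 := star_ne_zero.2 hy
  have hx : star (partialConj y j) ≠ 0 := star_ne_zero.2 (partialConj_ne_zero hy)
  have h1 : ∀ i, scaleFirst (y j / star (y j)) (j.succAbove i) * fiberCoord j y w i =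
      w (j.succAbove i) := fun i => by
    rw [fiberCoord_apply, ← mul_assoc, scaleFirst_mul, div_mul_div_cancel₀ hy', div_self hy,
      scaleFirst_one, one_mul]
  funext k
  rcases Fin.eq_self_or_eq_succAbove j k with rfl | ⟨i, rfl⟩
  · rw [fiberLift_apply_same]
    simp only [h1]
    rw [IsPerp, Fin.sum_univ_succAbove _ k] at hw
    rw [eq_neg_of_add_eq_zero_right hw, mul_neg, neg_mul, neg_neg, inv_mul_cancel_left₀ hx]
  · rw [fiberLift_apply_succAbove, h1]

/-- The effect of a change of the representative `y` of a point of projective space. -/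
def fiberAct (c : ℂ) (w : Fin (m + 1) → ℂ) : Fin (m + 1) → ℂ :=
  fun i => scaleFirst (c / star c) i * w i

theorem fiberCoord_smul_fiberAct {c : ℂ} (hc : c ≠ 0) (j : Fin (m + 1))
    (y w : Fin (m + 1) → ℂ) : fiberCoord j (c • y) (fiberAct c w) = fiberCoord j y w := by
  funext i
  have hc' : star c ≠ 0 := star_ne_zero.2 hc
  rw [fiberCoord_apply, fiberCoord_apply, fiberAct, ← mul_assoc, scaleFirst_mul, Pi.smul_apply,
    smul_eq_mul, star_mul']
  congr 2
  field_simp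

/-- Every summand of the pairing is multiplied by `c`: the first since `star c * (c / star c) = c`,
the others since the two conjugations of `y` cancel. -/
theorem IsPerp.fiberAct {c : ℂ} (hc : c ≠ 0) {y w : Fin (m + 1) → ℂ} (h : IsPerp y w) :
    IsPerp (c • y) (fiberAct c w) := by
  have hc' : star c ≠ 0 := star_ne_zero.2 hc
  have h1 : ∀ i, star (partialConj (c • y) i) * _root_.fiberAct c w i =
      c * (star (partialConj y i) * w i) := fun i => by
    refine Fin.cases ?_ (fun i => ?_) i
    · simp only [partialConj, _root_.fiberAct, Fin.cons_zero, scaleFirst_zero, Pi.smul_apply,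
        smul_eq_mul, star_mul']
      field_simp
    · simp only [partialConj, _root_.fiberAct, Fin.cons_succ, scaleFirst_succ, Pi.smul_apply,
        smul_eq_mul, star_star]
      ring
  rw [IsPerp]
  simp only [h1]
  rw [← Finset.mul_sum, h, mul_zero]

/-- Both sides are perpendicular to `c • y` and have the same coordinates `u`. -/
theorem fiberLift_smul {c : ℂ} (hc : c ≠ 0) {j : Fin (m + 1)} {y : Fin (m + 1) → ℂ}
    (hy : y j ≠ 0) (u : Fin m → ℂ) : fiberLift j (c • y) u = fiberAct c (fiberLift j y u) := by
  have hcy : (c • y) j ≠ 0 := mul_ne_zero hc hy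
  have h1 := fiberLift_fiberCoord hcy ((isPerp_fiberLift hy u).fiberAct hc)
  rwa [fiberCoord_smul_fiberAct hc, fiberCoord_fiberLift hy] at h1

/-- The coordinate change between two trivializations. -/
def fiberCoordChange (j k : Fin (m + 1)) (y : Fin (m + 1) → ℂ) :
    (Fin m → ℂ) →ₗ[ℂ] (Fin m → ℂ) :=
  fiberCoord k y ∘ₗ fiberLift j y

/-- Scale invariance makes the transition functions depend on the line of `y` only, so they descend
to projective space. -/
theorem fiberCoordChange_smul {c : ℂ} (hc : c ≠ 0) {j : Fin (m + 1)} (k : Fin (m + 1))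
    {y : Fin (m + 1) → ℂ} (hy : y j ≠ 0) :
    fiberCoordChange j k (c • y) = fiberCoordChange j k y := by
  refine LinearMap.ext fun u => ?_
  change fiberCoord k (c • y) (fiberLift j (c • y) u) = fiberCoord k y (fiberLift j y u)
  rw [fiberLift_smul hc hy, fiberCoord_smul_fiberAct hc]

theorem fiberCoordChange_fiberCoord {j : Fin (m + 1)} (k : Fin (m + 1))
    {y w : Fin (m + 1) → ℂ} (hy : y j ≠ 0) (hw : IsPerp y w) :
    fiberCoordChange j k y (fiberCoord j y w) = fiberCoord k y w := by
  change fiberCoord k y (fiberLift j y _) = _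
  rw [fiberLift_fiberCoord hy hw]

theorem fiberCoordChange_self {j : Fin (m + 1)} {y : Fin (m + 1) → ℂ} (hy : y j ≠ 0)
    (u : Fin m → ℂ) : fiberCoordChange j j y u = u := fiberCoord_fiberLift hy u

theorem fiberCoordChange_comp {j k : Fin (m + 1)} (l : Fin (m + 1)) {y : Fin (m + 1) → ℂ}
    (hj : y j ≠ 0) (hk : y k ≠ 0) (u : Fin m → ℂ) :
    fiberCoordChange k l y (fiberCoordChange j k y u) = fiberCoordChange j l y u :=
  fiberCoordChange_fiberCoord l hk (isPerp_fiberLift hj u)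

/-! ### Smoothness of the fibre coordinates -/

theorem contDiff_star {F : Type} [NormedAddCommGroup F] [NormedSpace ℝ F] {f : F → ℂ} {x : F}
    (hf : ContDiffAt ℝ ∞ f x) : ContDiffAt ℝ ∞ (fun x => star (f x)) x :=
  Complex.conjCLE.contDiff.contDiffAt.comp x hf

theorem contDiffAt_partialConj {F : Type} [NormedAddCommGroup F] [NormedSpace ℝ F]
    {y : F → Fin (m + 1) → ℂ} {x : F} (hy : ContDiffAt ℝ ∞ y x) :
    ContDiffAt ℝ ∞ (fun x => partialConj (y x)) x := by
  rw [contDiffAt_pi] at hy ⊢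
  intro i
  refine Fin.cases ?_ (fun i => ?_) i
  · exact hy 0
  · exact contDiff_star (hy i.succ)

theorem contDiffAt_scaleFirst {F : Type} [NormedAddCommGroup F] [NormedSpace ℝ F]
    {f : F → ℂ} {x : F} (hf : ContDiffAt ℝ ∞ f x) (i : Fin (m + 1)) :
    ContDiffAt ℝ ∞ (fun x => scaleFirst (f x) i) x := by
  refine Fin.cases ?_ (fun i => ?_) i
  · exact hf
  · exact contDiffAt_const

theorem contDiffAt_fiberCoord {F : Type} [NormedAddCommGroup F] [NormedSpace ℝ F]
    {y w : F → Fin (m + 1) → ℂ} {x : F} {j : Fin (m + 1)} (hy : ContDiffAt ℝ ∞ y x)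
    (hw : ContDiffAt ℝ ∞ w x) (hj : y x j ≠ 0) :
    ContDiffAt ℝ ∞ (fun x => fiberCoord j (y x) (w x)) x := by
  rw [contDiffAt_pi] at hy hw ⊢
  intro i
  simp only [fiberCoord_apply, div_eq_mul_inv]
  exact (contDiffAt_scaleFirst ((contDiff_star (hy j)).mul ((hy j).inv hj)) _).mul (hw _)

theorem contDiffAt_fiberLift {F : Type} [NormedAddCommGroup F] [NormedSpace ℝ F]
    {y : F → Fin (m + 1) → ℂ} {u : F → Fin m → ℂ} {x : F} {j : Fin (m + 1)}
    (hy : ContDiffAt ℝ ∞ y x) (hu : ContDiffAt ℝ ∞ u x) (hj : y x j ≠ 0) :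
    ContDiffAt ℝ ∞ (fun x => fiberLift j (y x) (u x)) x := by
  have hc := contDiffAt_pi.1 (contDiffAt_partialConj hy)
  rw [contDiffAt_pi] at hy hu ⊢
  have h1 : ∀ i, ContDiffAt ℝ ∞ (fun x =>
      scaleFirst (y x j / star (y x j)) (j.succAbove i) * u x i) x := fun i => by
    simp only [div_eq_mul_inv]
    exact (contDiffAt_scaleFirst ((hy j).mul ((contDiff_star (hy j)).inv (star_ne_zero.2 hj))) _).mul
      (hu i)
  intro k
  rcases Fin.eq_self_or_eq_succAbove j k with rfl | ⟨i, rfl⟩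
  · simp only [fiberLift_apply_same]
    refine ContDiffAt.mul (ContDiffAt.neg ?_) (ContDiffAt.sum fun i _ => ?_)
    · exact (contDiff_star (hc k)).inv (star_ne_zero.2 (partialConj_ne_zero hj))
    · exact (contDiff_star (hc _)).mul (h1 i)
  · simp only [fiberLift_apply_succAbove]
    exact h1 i

end Coordinates

/-! ### The fibres of the associated bundle -/

section Fibres

variable {m : ℕ}

/-- The inclusion of `ℂ^m` into `ℂ^(m + 1)` with last coordinate zero. -/
def padZero (v : Fin m → ℂ) : Fin (m + 1) → ℂ := Fin.snoc (α := fun _ => ℂ) v 0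

theorem padZero_castSucc (v : Fin m → ℂ) (i : Fin m) : padZero v i.castSucc = v i :=
  Fin.snoc_castSucc (α := fun _ => ℂ) _ _ _

theorem padZero_last (v : Fin m → ℂ) : padZero v (Fin.last m) = 0 :=
  Fin.snoc_last (α := fun _ => ℂ) _ _

theorem eq_padZero {w : Fin (m + 1) → ℂ} (h : w (Fin.last m) = 0) :
    w = padZero fun i => w i.castSucc := by
  funext i
  refine Fin.lastCases ?_ (fun i => ?_) i
  · rw [h, padZero_last]
  · rw [padZero_castSucc]

theorem conjTranspose_mul_self_SU (g : SU m) : (g.1)ᴴ * g.1 = 1 :=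
  Matrix.mem_unitaryGroup_iff'.1 g.2.1

theorem mul_conjTranspose_self_SU (g : SU m) : g.1 * (g.1)ᴴ = 1 :=
  Matrix.mem_unitaryGroup_iff.1 g.2.1

theorem isPerp_conjLastColumn_iff (g : SU m) (w : Fin (m + 1) → ℂ) :
    IsPerp (conjLastColumn g) w ↔ ((g.1)ᴴ *ᵥ w) (Fin.last m) = 0 := by
  rw [IsPerp]
  simp only [partialConj_conjLastColumn]
  rfl

theorem isPerp_mulVec_padZero (g : SU m) (v : Fin m → ℂ) :
    IsPerp (conjLastColumn g) (g.1 *ᵥ padZero v) := by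
  rw [isPerp_conjLastColumn_iff, Matrix.mulVec_mulVec, conjTranspose_mul_self_SU, Matrix.one_mulVec,
    padZero_last]

/-- The isomorphism `v ↦ [g, v]` from `ℂ^m` to a fibre, in the `j`-th trivialization. -/
def fiberMap (j : Fin (m + 1)) (g : SU m) (v : Fin m → ℂ) : Fin m → ℂ :=
  fiberCoord j (conjLastColumn g) (g.1 *ᵥ padZero v)

/-- The inverse of `fiberMap`. -/
def fiberMapInv (j : Fin (m + 1)) (g : SU m) (u : Fin m → ℂ) : Fin m → ℂ :=
  fun i => ((g.1)ᴴ *ᵥ fiberLift j (conjLastColumn g) u) i.castSucc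

/-- The lifted vector is orthogonal to the last column of `g`, so its image under `gᴴ` has last
coordinate zero, and nothing is lost by keeping the first `m` coordinates. -/
theorem fiberMap_fiberMapInv {j : Fin (m + 1)} {g : SU m} (hj : conjLastColumn g j ≠ 0)
    (u : Fin m → ℂ) : fiberMap j g (fiberMapInv j g u) = u := by
  have h1 := (isPerp_conjLastColumn_iff g _).1 (isPerp_fiberLift hj u)
  have h2 : padZero (fiberMapInv j g u) = (g.1)ᴴ *ᵥ fiberLift j (conjLastColumn g) u :=
    (eq_padZero h1).symm
  rw [fiberMap, h2, Matrix.mulVec_mulVec, mul_conjTranspose_self_SU,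
    Matrix.one_mulVec, fiberCoord_fiberLift hj]

theorem fiberMapInv_fiberMap {j : Fin (m + 1)} {g : SU m} (hj : conjLastColumn g j ≠ 0)
    (v : Fin m → ℂ) : fiberMapInv j g (fiberMap j g v) = v := by
  funext i
  change ((g.1)ᴴ *ᵥ fiberLift j (conjLastColumn g) (fiberMap j g v)) i.castSucc = _
  rw [fiberMap, fiberLift_fiberCoord hj (isPerp_mulVec_padZero g v),
    Matrix.mulVec_mulVec, conjTranspose_mul_self_SU, Matrix.one_mulVec, padZero_castSucc]

/-- `fiberMap` as a linear isomorphism. -/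
def fiberEquiv {j : Fin (m + 1)} {g : SU m} (hj : conjLastColumn g j ≠ 0) :
    (Fin m → ℂ) ≃ₗ[ℂ] (Fin m → ℂ) where
  toFun := fiberMap j g
  map_add' v v' := by
    have h : padZero (v + v') = padZero v + padZero v' := by
      funext i
      refine Fin.lastCases ?_ (fun i => ?_) i
      · simp only [Pi.add_apply, padZero_last, add_zero]
      · simp only [Pi.add_apply, padZero_castSucc]
    rw [fiberMap, h, Matrix.mulVec_add, map_add]
    rfl
  map_smul' c v := by
    have h : padZero (c • v) = c • padZero v := by
      funext i
      refine Fin.lastCases ?_ (fun i => ?_) i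
      · simp only [Pi.smul_apply, padZero_last, smul_zero]
      · simp only [Pi.smul_apply, padZero_castSucc]
    rw [fiberMap, h, Matrix.mulVec_smul, map_smul]
    rfl
  invFun := fiberMapInv j g
  left_inv := fiberMapInv_fiberMap hj
  right_inv := fiberMap_fiberMapInv hj

theorem fiberCoordChange_fiberMap {j : Fin (m + 1)} (k : Fin (m + 1)) {g : SU m}
    (hj : conjLastColumn g j ≠ 0) (v : Fin m → ℂ) :
    fiberCoordChange j k (conjLastColumn g) (fiberMap j g v) = fiberMap k g v :=
  fiberCoordChange_fiberCoord k hj (isPerp_mulVec_padZero g v)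

/-! ### The orbits of the action of the unitary group -/

theorem rightFactor_castSucc_castSucc (A : Matrix.unitaryGroup (Fin m) ℂ) (i j : Fin m) :
    rightFactor m A i.castSucc j.castSucc = A.1 i j := by
  simp [rightFactor]

theorem rightFactor_castSucc_last (A : Matrix.unitaryGroup (Fin m) ℂ) (i : Fin m) :
    rightFactor m A i.castSucc (Fin.last m) = 0 := by
  simp [rightFactor]

theorem rightFactor_last_castSucc (A : Matrix.unitaryGroup (Fin m) ℂ) (i : Fin m) :
    rightFactor m A (Fin.last m) i.castSucc = 0 := by
  simp [rightFactor]

theorem rightFactor_last_last (A : Matrix.unitaryGroup (Fin m) ℂ) :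
    rightFactor m A (Fin.last m) (Fin.last m) = A.1.det := by
  simp [rightFactor]

theorem leftFactor_apply (A : Matrix.unitaryGroup (Fin m) ℂ) :
    leftFactor m A = Matrix.diagonal (scaleFirst (A.1.det ^ 2)) := rfl

theorem isUnit_rightFactor_det (A : Matrix.unitaryGroup (Fin m) ℂ) :
    IsUnit (rightFactor m A).det := by
  have h := congrArg Matrix.det ((map_mul (rightFactor m) A A⁻¹).symm.trans
    ((congrArg _ (mul_inv_cancel A)).trans (map_one _)))
  rw [Matrix.det_mul, Matrix.det_one] at h
  exact IsUnit.of_mul_eq_one _ h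

theorem twistedAct_mul_rightFactor (A : Matrix.unitaryGroup (Fin m) ℂ) (g : SU m) :
    (twistedAct A g).1 * rightFactor m A = leftFactor m A * g.1 :=
  Matrix.nonsing_inv_mul_cancel_right _ _ (isUnit_rightFactor_det A)

theorem twistedAct_eq_iff {A : Matrix.unitaryGroup (Fin m) ℂ} {g g' : SU m} :
    g' = twistedAct A g ↔ g'.1 * rightFactor m A = leftFactor m A * g.1 := by
  constructor
  · rintro rfl
    exact twistedAct_mul_rightFactor A g
  · intro h
    refine Subtype.ext ?_
    change _ = leftFactor m A * g.1 * (rightFactor m A)⁻¹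
    rw [← h, Matrix.mul_nonsing_inv_cancel_right _ _ (isUnit_rightFactor_det A)]

theorem star_det_mul_det (A : Matrix.unitaryGroup (Fin m) ℂ) : star A.1.det * A.1.det = 1 := by
  have h := congrArg Matrix.det (Matrix.mem_unitaryGroup_iff'.1 A.2)
  rwa [Matrix.det_mul, Matrix.star_eq_conjTranspose, Matrix.det_conjTranspose,
    Matrix.det_one] at h

/-- A determinant of modulus one satisfies `det / star det = det ^ 2`; this matches the left factor
with the rescaling in `fiberAct`. -/
theorem leftFactor_mulVec (A : Matrix.unitaryGroup (Fin m) ℂ) (w : Fin (m + 1) → ℂ) :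
    leftFactor m A *ᵥ w = fiberAct A.1.det w := by
  have h0 : A.1.det ≠ 0 := right_ne_zero_of_mul_eq_one (star_det_mul_det A)
  have h1 : A.1.det / star A.1.det = A.1.det ^ 2 := by
    rw [div_eq_iff (left_ne_zero_of_mul_eq_one (star_det_mul_det A))]
    linear_combination -(A.1.det) * star_det_mul_det A
  funext i
  rw [leftFactor_apply, Matrix.mulVec_diagonal, fiberAct, h1]

theorem rightFactor_mulVec_padZero (A : Matrix.unitaryGroup (Fin m) ℂ) (v : Fin m → ℂ) :
    rightFactor m A *ᵥ padZero v = padZero (A.1 *ᵥ v) := by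
  funext i
  change ∑ j, rightFactor m A i j * padZero v j = _
  rw [Fin.sum_univ_castSucc, padZero_last, mul_zero, add_zero]
  simp only [padZero_castSucc]
  refine Fin.lastCases ?_ (fun i => ?_) i
  · simp only [rightFactor_last_castSucc, zero_mul, Finset.sum_const_zero, padZero_last]
  · simp only [rightFactor_castSucc_castSucc, padZero_castSucc]
    rfl

theorem twistedAct_mulVec_padZero (A : Matrix.unitaryGroup (Fin m) ℂ) (g : SU m)
    (v : Fin m → ℂ) : (twistedAct A g).1 *ᵥ padZero (A.1 *ᵥ v) =
      fiberAct A.1.det (g.1 *ᵥ padZero v) := by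
  rw [← rightFactor_mulVec_padZero, Matrix.mulVec_mulVec, twistedAct_mul_rightFactor,
    ← Matrix.mulVec_mulVec, leftFactor_mulVec]

theorem twistedAct_apply_last (A : Matrix.unitaryGroup (Fin m) ℂ) (g : SU m) (i : Fin (m + 1)) :
    (twistedAct A g).1 i (Fin.last m) * A.1.det =
      scaleFirst (A.1.det ^ 2) i * g.1 i (Fin.last m) := by
  have h := congrFun (congrFun (twistedAct_mul_rightFactor A g) i) (Fin.last m)
  rw [leftFactor_apply, Matrix.diagonal_mul, Matrix.mul_apply, Fin.sum_univ_castSucc,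
    rightFactor_last_last, Finset.sum_eq_zero, zero_add] at h
  · exact h
  · intro j _
    rw [rightFactor_castSucc_last, mul_zero]

/-- The first entry of the last column is multiplied by `det ^ 2 / det = det`, the others by `1 /
det`, which conjugation turns into `det`. This is why all entries but the first are conjugated in
`toCP`. -/
theorem conjLastColumn_twistedAct (A : Matrix.unitaryGroup (Fin m) ℂ) (g : SU m) :
    conjLastColumn (twistedAct A g) = A.1.det • conjLastColumn g := by
  have h0 : A.1.det ≠ 0 := right_ne_zero_of_mul_eq_one (star_det_mul_det A)
  have hu := star_det_mul_det A
  funext i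
  have h := twistedAct_apply_last A g i
  revert h
  refine Fin.cases (fun h => ?_) (fun i h => ?_) i
  · rw [scaleFirst_zero, sq, mul_assoc, mul_comm] at h
    exact mul_left_cancel₀ h0 h
  · rw [scaleFirst_succ, one_mul] at h
    change star _ = A.1.det * star _
    rw [← h, star_mul', mul_comm, mul_assoc, hu, mul_one]

theorem toCP_eq_iff {g g' : SU m} :
    toCP g = toCP g' ↔ ∃ c : ℂ, c ≠ 0 ∧ conjLastColumn g' = c • conjLastColumn g := by
  rw [eq_comm]
  refine (Projectivization.mk_eq_mk_iff' ℂ _ _ (conjLastColumn_ne_zero g')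
    (conjLastColumn_ne_zero g)).trans ?_
  constructor
  · rintro ⟨c, hc⟩
    refine ⟨c, ?_, hc.symm⟩
    rintro rfl
    rw [zero_smul] at hc
    exact conjLastColumn_ne_zero g' hc.symm
  · rintro ⟨c, -, hc⟩
    exact ⟨c, hc.symm⟩

theorem toCP_twistedAct (A : Matrix.unitaryGroup (Fin m) ℂ) (g : SU m) :
    toCP (twistedAct A g) = toCP g :=
  (toCP_eq_iff.2 ⟨_, right_ne_zero_of_mul_eq_one (star_det_mul_det A),
    conjLastColumn_twistedAct A g⟩).symm

theorem conjLastColumn_ne_zero_of_toCP_eq {g g' : SU m} (h : toCP g = toCP g') {j : Fin (m + 1)}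
    (hj : conjLastColumn g j ≠ 0) : conjLastColumn g' j ≠ 0 := by
  obtain ⟨c, hc, h⟩ := toCP_eq_iff.1 h
  rw [h]
  exact mul_ne_zero hc hj

/-- Thus `fiberMap j` is constant on the orbits of U(m) and defines a coordinate on the associated
bundle. -/
theorem fiberMap_twistedAct (j : Fin (m + 1)) (A : Matrix.unitaryGroup (Fin m) ℂ) (g : SU m)
    (v : Fin m → ℂ) : fiberMap j (twistedAct A g) (A.1 *ᵥ v) = fiberMap j g v := by
  rw [fiberMap, conjLastColumn_twistedAct, twistedAct_mulVec_padZero,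
    fiberCoord_smul_fiberAct (right_ne_zero_of_mul_eq_one (star_det_mul_det A))]
  rfl

theorem sum_conjLastColumn (g : SU m) : ∑ i, star (conjLastColumn g i) * conjLastColumn g i = 1 := by
  have h := congrFun (congrFun (conjTranspose_mul_self_SU g) (Fin.last m)) (Fin.last m)
  rw [Matrix.one_apply_eq, Matrix.mul_apply] at h
  rw [← h]
  refine Finset.sum_congr rfl fun i _ => ?_
  rw [Matrix.conjTranspose_apply]
  refine Fin.cases ?_ (fun i => ?_) i
  · rfl
  · change star (star _) * star _ = _
    rw [star_star, mul_comm]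

/-- The unitary group acts transitively on the fibres of `toCP`. -/
theorem exists_twistedAct_eq {g g' : SU m} (h : toCP g = toCP g') :
    ∃ A, g' = twistedAct A g := by
  obtain ⟨z, -, hz⟩ := toCP_eq_iff.1 h
  -- Both columns are unit vectors, so the factor between them has modulus one.
  have hz1 : star z * z = 1 := by
    have h1 := sum_conjLastColumn g'
    rw [hz] at h1
    have h2 : ∀ i, star ((z • conjLastColumn g) i) * (z • conjLastColumn g) i =
        (star z * z) * (star (conjLastColumn g i) * conjLastColumn g i) := fun i => by
      rw [Pi.smul_apply, smul_eq_mul, star_mul']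
      ring
    simp only [h2] at h1
    rwa [← Finset.mul_sum, sum_conjLastColumn, mul_one] at h1
  have hz0 : z ≠ 0 := right_ne_zero_of_mul_eq_one hz1
  let D : Matrix (Fin (m + 1)) (Fin (m + 1)) ℂ := Matrix.diagonal (scaleFirst (z ^ 2))
  have hDdet : D.det = z ^ 2 := by
    rw [Matrix.det_diagonal, Fin.prod_univ_succ]
    simp [scaleFirst_zero, scaleFirst_succ]
  have hDD : Dᴴ * D = 1 := by
    rw [Matrix.diagonal_conjTranspose, Matrix.diagonal_mul_diagonal, ← Matrix.diagonal_one]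
    congr 1
    funext i
    refine Fin.cases ?_ (fun i => ?_) i
    · simp only [Pi.star_apply, scaleFirst_zero, star_pow]
      rw [← mul_pow, hz1, one_pow]
    · simp only [Pi.star_apply, scaleFirst_succ, star_one, mul_one]
  -- If `g' = A · g`, then `z = det A` and `R` is the right factor of `A`. It remains to see that
  -- `R` has that shape: its last column is `z` times the last basis vector, unitarity then clears
  -- the last row, and comparing determinants gives `det A * z = z ^ 2`.
  let R := (g'.1)ᴴ * D * g.1
  have hgR : g'.1 * R = D * g.1 := by
    simp only [R]
    rw [← Matrix.mul_assoc, ← Matrix.mul_assoc, mul_conjTranspose_self_SU, one_mul]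
  have hRR : Rᴴ * R = 1 := Matrix.mem_unitaryGroup_iff'.1 (mul_mem
    (mul_mem (Unitary.star_mem g'.2.1) (Matrix.mem_unitaryGroup_iff'.2 hDD)) g.2.1)
  have hRR' : R * Rᴴ = 1 := mul_eq_one_comm.1 hRR
  have hDx : ∀ i, scaleFirst (z ^ 2) i * g.1 i (Fin.last m) = z * g'.1 i (Fin.last m) := fun i => by
    have h1 := congrFun hz i
    revert h1
    refine Fin.cases (fun h1 => ?_) (fun i h1 => ?_) i
    · change g'.1 0 (Fin.last m) = z * g.1 0 (Fin.last m) at h1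
      rw [h1, scaleFirst_zero]
      ring
    · change star _ = z * star _ at h1
      rw [scaleFirst_succ, one_mul, ← star_star (g'.1 i.succ (Fin.last m)), h1, star_mul', star_star,
        ← mul_assoc, mul_comm z, hz1, one_mul]
  have hRlast : ∀ i, R i (Fin.last m) = if i = Fin.last m then z else 0 := fun i => by
    have h1 : R i (Fin.last m) = z * ((g'.1)ᴴ * g'.1) i (Fin.last m) := by
      simp only [R]
      rw [Matrix.mul_assoc, Matrix.mul_apply, Matrix.mul_apply, Finset.mul_sum]
      refine Finset.sum_congr rfl fun k _ => ?_
      rw [Matrix.diagonal_mul, hDx]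
      ring
    rw [h1, conjTranspose_mul_self_SU, Matrix.one_apply]
    simp
  have hRlast' : ∀ i : Fin m, R (Fin.last m) i.castSucc = 0 := fun i => by
    have h1 := congrFun (congrFun hRR (Fin.last m)) i.castSucc
    rw [Matrix.one_apply_ne (Fin.castSucc_ne_last i).symm, Matrix.mul_apply,
      Finset.sum_eq_single (Fin.last m)] at h1
    · rw [Matrix.conjTranspose_apply, hRlast, if_pos rfl] at h1
      exact (mul_eq_zero.1 h1).resolve_left (star_ne_zero.2 hz0)
    · intro k _ hk
      rw [Matrix.conjTranspose_apply, hRlast, if_neg hk, star_zero, zero_mul]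
    · simp
  have hA : R.submatrix Fin.castSucc Fin.castSucc ∈ Matrix.unitaryGroup (Fin m) ℂ := by
    rw [Matrix.mem_unitaryGroup_iff, Matrix.star_eq_conjTranspose]
    ext i k
    have h1 := congrFun (congrFun hRR' i.castSucc) k.castSucc
    rw [Matrix.mul_apply, Fin.sum_univ_castSucc, hRlast, if_neg (Fin.castSucc_ne_last i), zero_mul,
      add_zero, Matrix.one_apply] at h1
    simp only [Fin.castSucc_inj] at h1
    rw [Matrix.one_apply]
    exact h1
  let A : Matrix.unitaryGroup (Fin m) ℂ := ⟨_, hA⟩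
  have hRblock : R = Matrix.reindex finSumFinEquiv finSumFinEquiv
      (Matrix.fromBlocks A.1 0 0 (z • (1 : Matrix (Fin 1) (Fin 1) ℂ))) := by
    ext i k
    refine Fin.lastCases ?_ (fun i => ?_) i <;> refine Fin.lastCases ?_ (fun k => ?_) k
    · simp [hRlast]
    · simp [hRlast']
    · simp [hRlast, Fin.castSucc_ne_last]
    · simp [A]
  have hdet : A.1.det = z := by
    have h1 : R.det = z ^ 2 := by
      simp only [R]
      have hg : g.1.det = 1 := (Matrix.mem_specialUnitaryGroup_iff.1 g.2).2
      have hg' : g'.1.det = 1 := (Matrix.mem_specialUnitaryGroup_iff.1 g'.2).2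
      rw [Matrix.det_mul, Matrix.det_mul, Matrix.det_conjTranspose, hg, hg', hDdet]
      simp
    rw [hRblock, Matrix.det_reindex_self, Matrix.det_fromBlocks_zero₂₁] at h1
    simp only [Matrix.det_fin_one, Matrix.smul_apply, Matrix.one_apply_eq, smul_eq_mul, mul_one,
      sq] at h1
    exact mul_right_cancel₀ hz0 h1
  refine ⟨A, twistedAct_eq_iff.2 ?_⟩
  have h1 : rightFactor m A = R := by
    rw [hRblock, ← hdet]
    rfl
  have h2 : leftFactor m A = D := by
    rw [leftFactor_apply, hdet]
  rw [h1, h2, hgR]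

end Fibres

/-! ### The orbits of the torus `S₁₂` -/

section Torus

variable {m : ℕ}

/-- A parametrization of the Lie algebra of the torus `S₁₂`. -/
def lieParam (m : ℕ) : (Fin m → ℝ) →ₗ[ℝ] (Fin (m + 1) → ℝ) × (Fin (m + 1) → ℝ) where
  -- For `A = diag(exp(i θ_k))` these are the exponents of the left and right factors. Both have
  -- trace `2 ∑ θ`, so one constant is subtracted from all entries to make both trace-free.
  toFun θ := (fun j => (Fin.cons (2 * ∑ i, θ i) fun _ => 0 : Fin (m + 1) → ℝ) j -
      (2 * ∑ i, θ i) / (m + 1),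
    fun j => Fin.snoc (α := fun _ => ℝ) θ (∑ i, θ i) j - (2 * ∑ i, θ i) / (m + 1))
  map_add' θ θ' := by
    refine Prod.ext (funext fun j => ?_) (funext fun j => ?_)
    · refine Fin.cases ?_ (fun j => ?_) j <;>
        simp only [Fin.cons_zero, Fin.cons_succ, Prod.mk_add_mk, Pi.add_apply,
          Finset.sum_add_distrib] <;> ring
    · refine Fin.lastCases ?_ (fun j => ?_) j <;>
        simp only [Fin.snoc_last, Fin.snoc_castSucc, Prod.mk_add_mk, Pi.add_apply,
          Finset.sum_add_distrib] <;> ring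
  map_smul' c θ := by
    refine Prod.ext (funext fun j => ?_) (funext fun j => ?_)
    · refine Fin.cases ?_ (fun j => ?_) j <;>
        simp only [Fin.cons_zero, Fin.cons_succ, Prod.smul_mk, Pi.smul_apply, smul_eq_mul,
          ← Finset.mul_sum, RingHom.id_apply] <;> ring
    · refine Fin.lastCases ?_ (fun j => ?_) j <;>
        simp only [Fin.snoc_last, Fin.snoc_castSucc, Prod.smul_mk, Pi.smul_apply, smul_eq_mul,
          ← Finset.mul_sum, RingHom.id_apply] <;> ring

theorem lieParam_fst (θ : Fin m → ℝ) (j : Fin (m + 1)) : (lieParam m θ).1 j =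
    (Fin.cons (2 * ∑ i, θ i) fun _ => 0 : Fin (m + 1) → ℝ) j - (2 * ∑ i, θ i) / (m + 1) := rfl

theorem lieParam_snd (θ : Fin m → ℝ) (j : Fin (m + 1)) : (lieParam m θ).2 j =
    Fin.snoc (α := fun _ => ℝ) θ (∑ i, θ i) j - (2 * ∑ i, θ i) / (m + 1) := rfl

theorem lieParam_single_zero (l : ℕ) : lieParam (l + 1) (Pi.single 0 1) =
    (tracefree ((2 : ℝ) • lieE 0), tracefree (lieE 0 + lieE (Fin.last (l + 1)))) := by
  refine Prod.ext (funext fun j => ?_) (funext fun j => ?_)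
  · rw [lieParam_fst]
    refine Fin.cases ?_ (fun j => ?_) j <;>
      simp [tracefree, lieE, ← Finset.mul_sum]
  · rw [lieParam_snd]
    refine Fin.lastCases ?_ (fun j => ?_) j
    · simp [tracefree, lieE, Finset.sum_add_distrib, one_add_one_eq_two]
    · have h1 : (Fin.castSucc j = Fin.last (l + 1)) = False :=
        eq_false (Fin.castSucc_ne_last j)
      have h2 : (Fin.castSucc j = 0) = (j = 0) := propext Fin.castSucc_eq_zero_iff
      simp only [tracefree, lieE, Finset.sum_add_distrib, Fin.snoc_castSucc, Pi.add_apply,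
        Finset.mem_univ, if_true, Pi.single_apply, h1, h2, if_false,
        Finset.sum_ite_eq', add_zero]
      norm_num

theorem lieParam_single_sub (l : ℕ) (i : Fin (l + 1)) :
    lieParam (l + 1) (Pi.single i 1 - Pi.single 0 1) = (0, lieE i.castSucc - lieE 0) := by
  refine Prod.ext (funext fun j => ?_) (funext fun j => ?_)
  · rw [lieParam_fst]
    refine Fin.cases ?_ (fun j => ?_) j <;> simp
  · rw [lieParam_snd]
    refine Fin.lastCases ?_ (fun j => ?_) j
    · have h1 : (Fin.last (l + 1) = i.castSucc) = False := eq_false (Fin.castSucc_ne_last i).symm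
      have h2 : (Fin.last (l + 1) = 0) = False := eq_false (Fin.last_pos).ne'
      simp [lieE, Pi.single_apply, h1, h2]
    · have h2 : (Fin.castSucc j = 0) = (j = 0) := propext Fin.castSucc_eq_zero_iff
      have h3 : (Fin.castSucc j = i.castSucc) = (j = i) := propext Fin.castSucc_inj
      simp [lieE, Pi.single_apply, h2, h3]

/-- The parametrization sends `e_0` and `e_i - e_0` to the generators of the Lie algebra, and these
vectors span `ℝ^m`. Positivity of `m` provides the index `0`. -/
theorem lieS12_eq_range (hm : 0 < m) : lieS12 m = LinearMap.range (lieParam m) := by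
  obtain ⟨l, rfl⟩ := Nat.exists_eq_succ_of_ne_zero hm.ne'
  apply le_antisymm
  · refine Submodule.span_le.2 ?_
    rintro _ (rfl | ⟨i, h0, hl, rfl⟩)
    · exact ⟨_, lieParam_single_zero l⟩
    · obtain ⟨i, rfl⟩ := Fin.exists_castSucc_eq.2 hl
      exact ⟨_, lieParam_single_sub l i⟩
  · rintro _ ⟨θ, rfl⟩
    rw [LinearMap.pi_apply_eq_sum_univ]
    refine Submodule.sum_mem _ fun i _ => Submodule.smul_mem _ _ ?_
    have h0 : lieParam (l + 1) (Pi.single 0 1) ∈ lieS12 (l + 1) := by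
      rw [lieParam_single_zero]
      exact Submodule.subset_span (Or.inl rfl)
    have h1 : (fun j => if i = j then 1 else 0 : Fin (l + 1) → ℝ) =
        (Pi.single i 1 - Pi.single 0 1) + Pi.single 0 1 := by
      funext j
      simp [Pi.single_apply, eq_comm]
    change lieParam (l + 1) _ ∈ _
    rw [h1, map_add]
    refine Submodule.add_mem _ ?_ h0
    by_cases hi : i = 0
    · rw [hi, sub_self, map_zero]
      exact Submodule.zero_mem _
    · rw [lieParam_single_sub]
      exact Submodule.subset_span (Or.inr ⟨_, (Fin.castSucc_ne_zero_iff).2 hi,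
        Fin.castSucc_ne_last i, rfl⟩)

/-- The diagonal unitary matrix with given entries of modulus one. -/
def diagUnitary (a : Fin m → ℂ) (ha : ∀ i, star (a i) * a i = 1) :
    Matrix.unitaryGroup (Fin m) ℂ :=
  ⟨Matrix.diagonal a, by
    rw [Matrix.mem_unitaryGroup_iff', Matrix.star_eq_conjTranspose, Matrix.diagonal_conjTranspose,
      Matrix.diagonal_mul_diagonal, ← Matrix.diagonal_one]
    congr 1
    funext i
    exact ha i⟩

theorem diagUnitary_det (a : Fin m → ℂ) (ha : ∀ i, star (a i) * a i = 1) :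
    (diagUnitary a ha).1.det = ∏ i, a i := Matrix.det_diagonal

theorem rightFactor_diagUnitary (a : Fin m → ℂ) (ha : ∀ i, star (a i) * a i = 1) :
    rightFactor m (diagUnitary a ha) =
      Matrix.diagonal (Fin.snoc (α := fun _ => ℂ) a (∏ i, a i)) := by
  ext i j
  refine Fin.lastCases ?_ (fun i => ?_) i <;> refine Fin.lastCases ?_ (fun j => ?_) j
  · rw [rightFactor_last_last, Matrix.diagonal_apply_eq, Fin.snoc_last, diagUnitary_det]
  · rw [rightFactor_last_castSucc, Matrix.diagonal_apply_ne _ (Fin.castSucc_ne_last j).symm]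
  · rw [rightFactor_castSucc_last, Matrix.diagonal_apply_ne _ (Fin.castSucc_ne_last i)]
  · rw [rightFactor_castSucc_castSucc]
    change Matrix.diagonal a i j = _
    rw [Matrix.diagonal_apply, Matrix.diagonal_apply, Fin.snoc_castSucc]
    simp only [Fin.castSucc_inj]

theorem star_exp_mul_exp (θ : ℝ) :
    star (Complex.exp (θ * Complex.I)) * Complex.exp (θ * Complex.I) = 1 := by
  rw [Complex.star_def, ← Complex.exp_conj, ← Complex.exp_add]
  simp

theorem torusExp_sub_const (x : Fin (m + 1) → ℝ) (c : ℝ) :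
    torusExp (fun j => x j - c) = Complex.exp (-c * Complex.I) • torusExp x := by
  rw [torusExp, torusExp, ← Matrix.diagonal_smul]
  congr 1
  funext j
  rw [Pi.smul_apply, smul_eq_mul, ← Complex.exp_add]
  congr 1
  push_cast
  ring

/-- Passing to trace-free parts costs the same scalar on both sides, and a common scalar has no
effect on the two-sided action. -/
theorem torusExp_lieParam (θ : Fin m → ℝ) :
    torusExp (lieParam m θ).1 = Complex.exp (-((2 * ∑ i, θ i) / (m + 1) : ℝ) * Complex.I) •
        leftFactor m (diagUnitary (fun i => Complex.exp (θ i * Complex.I))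
          fun i => star_exp_mul_exp (θ i)) ∧
      torusExp (lieParam m θ).2 = Complex.exp (-((2 * ∑ i, θ i) / (m + 1) : ℝ) * Complex.I) •
        rightFactor m (diagUnitary (fun i => Complex.exp (θ i * Complex.I))
          fun i => star_exp_mul_exp (θ i)) := by
  have hprod : ∏ i, Complex.exp (θ i * Complex.I) = Complex.exp ((∑ i, θ i : ℝ) * Complex.I) := by
    rw [← Complex.exp_sum, ← Finset.sum_mul]
    push_cast
    rfl
  constructor
  · refine (torusExp_sub_const _ _).trans ?_
    rw [leftFactor_apply, diagUnitary_det, hprod, torusExp]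
    congr 2
    funext j
    refine Fin.cases ?_ (fun j => ?_) j
    · rw [Fin.cons_zero, scaleFirst_zero, ← Complex.exp_nat_mul]
      congr 1
      push_cast
      ring
    · simp [scaleFirst_succ]
  · refine (torusExp_sub_const _ _).trans ?_
    rw [rightFactor_diagUnitary, hprod, torusExp]
    congr 2
    funext j
    refine Fin.lastCases ?_ (fun j => ?_) j
    · rw [Fin.snoc_last, Fin.snoc_last]
    · rw [Fin.snoc_castSucc, Fin.snoc_castSucc]

theorem torusExp_mem {x : Fin (m + 1) → ℝ} (hx : ∑ i, x i = 0) :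
    torusExp x ∈ Matrix.specialUnitaryGroup (Fin (m + 1)) ℂ := by
  rw [Matrix.mem_specialUnitaryGroup_iff]
  constructor
  · rw [Matrix.mem_unitaryGroup_iff, Matrix.star_eq_conjTranspose, ← torusExp_neg, ← torusExp_add,
      add_neg_cancel, torusExp_zero]
  · rw [torusExp, Matrix.det_diagonal, ← Complex.exp_sum, ← Finset.sum_mul, ← Complex.ofReal_sum,
      hx]
    simp

/-- The elements of `S₁₂` act like diagonal unitary matrices. -/
theorem exists_diagUnitary_of_mem_S12 (hm : 0 < m) {h : SU m × SU m} (hh : h ∈ S12 m) :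
    ∃ a ha, ∀ g, h.1 * g * h.2⁻¹ = twistedAct (diagUnitary a ha) g := by
  obtain ⟨x, hx, h1, h2⟩ := hh
  rw [lieS12_eq_range hm] at hx
  obtain ⟨θ, rfl⟩ := hx
  refine ⟨_, fun i => star_exp_mul_exp (θ i), fun g => ?_⟩
  rw [twistedAct_eq_iff]
  obtain ⟨k1, k2⟩ := torusExp_lieParam θ
  rw [k1] at h1
  rw [k2] at h2
  set c := Complex.exp (-((2 * ∑ i, θ i) / (m + 1) : ℝ) * Complex.I)
  have hc : c ≠ 0 := Complex.exp_ne_zero _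
  have h3 : (h.1 * g * h.2⁻¹) * h.2 = h.1 * g := inv_mul_cancel_right _ _
  have h4 : (h.1 * g * h.2⁻¹).1 * h.2.1 = h.1.1 * g.1 := congrArg Subtype.val h3
  rw [h1, h2, Matrix.mul_smul, Matrix.smul_mul] at h4
  exact smul_right_injective _ hc h4

theorem exists_mem_S12_of_diagUnitary (hm : 0 < m) (a : Fin m → ℂ)
    (ha : ∀ i, star (a i) * a i = 1) :
    ∃ h ∈ S12 m, ∀ g, h.1 * g * h.2⁻¹ = twistedAct (diagUnitary a ha) g := by
  have hexp : ∀ i, Complex.exp (Complex.arg (a i) * Complex.I) = a i := fun i => by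
    have h1 := Complex.norm_mul_exp_arg_mul_I (a i)
    have h2 : ‖a i‖ = 1 := by
      have h3 := congrArg norm (ha i)
      rw [norm_mul, norm_star, norm_one] at h3
      nlinarith [norm_nonneg (a i)]
    rwa [h2, Complex.ofReal_one, one_mul] at h1
  -- Arguments of the entries are logarithms of them; the trace-free lifts then have determinant
  -- one.
  set θ : Fin m → ℝ := fun i => Complex.arg (a i)
  have hm0 : (m + 1 : ℝ) ≠ 0 := by positivity
  have hs1 : ∑ i, (lieParam m θ).1 i = 0 := by
    simp only [lieParam_fst, Finset.sum_sub_distrib]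
    rw [Fin.sum_univ_succ]
    simp
    field_simp
    ring
  have hs2 : ∑ i, (lieParam m θ).2 i = 0 := by
    simp only [lieParam_snd, Finset.sum_sub_distrib]
    rw [Fin.sum_univ_castSucc]
    simp
    field_simp
    ring
  have hmem : ((⟨_, torusExp_mem hs1⟩, ⟨_, torusExp_mem hs2⟩) : SU m × SU m) ∈ S12 m := by
    refine ⟨lieParam m θ, ?_, rfl, rfl⟩
    rw [lieS12_eq_range hm]
    exact ⟨θ, rfl⟩
  refine ⟨_, hmem, fun g => ?_⟩
  rw [twistedAct_eq_iff]
  obtain ⟨k1, k2⟩ := torusExp_lieParam θ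
  have hd : diagUnitary (fun i => Complex.exp (θ i * Complex.I)) (fun i => star_exp_mul_exp (θ i)) =
      diagUnitary a ha := Subtype.ext (congrArg Matrix.diagonal (funext hexp))
  rw [hd] at k1 k2
  set c := Complex.exp (-((2 * ∑ i, θ i) / (m + 1) : ℝ) * Complex.I)
  have hc : c ≠ 0 := Complex.exp_ne_zero _
  set h : SU m × SU m := (⟨_, torusExp_mem hs1⟩, ⟨_, torusExp_mem hs2⟩)
  have h1 : h.1.1 = c • leftFactor m (diagUnitary a ha) := k1
  have h2 : h.2.1 = c • rightFactor m (diagUnitary a ha) := k2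
  have h3 : (h.1 * g * h.2⁻¹) * h.2 = h.1 * g := inv_mul_cancel_right _ _
  have h4 : (h.1 * g * h.2⁻¹).1 * h.2.1 = h.1.1 * g.1 := congrArg Subtype.val h3
  rw [h1, h2, Matrix.mul_smul, Matrix.smul_mul] at h4
  exact smul_right_injective _ hc h4

theorem biquotient_mk_eq_iff (hm : 0 < m) {g g' : SU m} :
    Biquotient.mk (S12 m) g = Biquotient.mk (S12 m) g' ↔
      ∃ a ha, g' = twistedAct (diagUnitary a ha) g := by
  refine Quotient.eq.trans ?_
  constructor
  · rintro ⟨h, hh, rfl⟩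
    obtain ⟨a, ha, h1⟩ := exists_diagUnitary_of_mem_S12 hm hh
    exact ⟨a, ha, h1 g⟩
  · rintro ⟨a, ha, rfl⟩
    obtain ⟨h, hh, h1⟩ := exists_mem_S12_of_diagUnitary hm a ha
    exact ⟨h, hh, (h1 g).symm⟩

/-- A fixed point has a fixed nonzero vector `conjLastColumn g`, which forces `det A = 1`. Then the
left factor is the identity, cancelling `g` shows the same for the right factor, and every point is
fixed. -/
theorem actsFreelyModKernel_S12 (hm : 0 < m) : ActsFreelyModKernel (S12 m) := by
  rintro h hh ⟨g, hg⟩ g'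
  obtain ⟨a, ha, h1⟩ := exists_diagUnitary_of_mem_S12 hm hh
  rw [h1] at hg ⊢
  have h2 : (diagUnitary a ha).1.det = 1 := by
    have h3 := conjLastColumn_twistedAct (diagUnitary a ha) g
    rw [hg] at h3
    obtain ⟨i, hi⟩ := Function.ne_iff.1 (conjLastColumn_ne_zero g)
    have h4 := congrFun h3 i
    rw [Pi.smul_apply, smul_eq_mul] at h4
    exact (mul_right_cancel₀ hi ((one_mul _).trans h4)).symm
  have h3 : leftFactor m (diagUnitary a ha) = 1 := by
    rw [leftFactor_apply, h2, ← Matrix.diagonal_one]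
    congr 1
    funext i
    rw [one_pow, scaleFirst_one]
  have h4 := twistedAct_eq_iff.1 hg.symm
  have h5 : rightFactor m (diagUnitary a ha) = 1 := by
    rw [h3, one_mul] at h4
    have h6 := congrArg (fun B => (g.1)ᴴ * B) h4
    simp only [← Matrix.mul_assoc, conjTranspose_mul_self_SU, one_mul] at h6
    exact h6
  refine (twistedAct_eq_iff.2 ?_).symm
  rw [h3, h5, one_mul, mul_one]

/-- A unitary matrix that preserves the standard flag is diagonal. -/
theorem exists_eq_diagUnitary {A : Matrix.unitaryGroup (Fin m) ℂ}
    (h : ∀ i j, j < i → A.1 i j = 0) (h' : ∀ i j, j < i → (A⁻¹).1 i j = 0) :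
    ∃ a ha, A = diagUnitary a ha := by
  have h1 : A.1 = Matrix.diagonal fun i => A.1 i i := by
    ext i j
    rcases lt_trichotomy i j with hij | rfl | hij
    · rw [Matrix.diagonal_apply_ne _ hij.ne]
      have h2 := h' j i hij
      change star (A.1 i j) = 0 at h2
      exact star_eq_zero.1 h2
    · rw [Matrix.diagonal_apply_eq]
    · rw [Matrix.diagonal_apply_ne _ hij.ne', h i j hij]
  refine ⟨fun i => A.1 i i, fun i => ?_, Subtype.ext h1⟩
  have h2 := congrFun (congrFun (Matrix.mem_unitaryGroup_iff'.1 A.2) i) i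
  rw [Matrix.one_apply_eq, h1, Matrix.star_eq_conjTranspose, Matrix.diagonal_conjTranspose,
    Matrix.diagonal_mul_diagonal, Matrix.diagonal_apply_eq] at h2
  exact h2

end Torus

/-! ### Flags in the fibres -/

section Flags

open Set

variable {m : ℕ}

/-- The image of a flag under a linear isomorphism. -/
def FullFlag.map {W W' : Type} [AddCommGroup W] [Module ℂ W] [AddCommGroup W'] [Module ℂ W']
    (ℓ : W ≃ₗ[ℂ] W') (φ : FullFlag m W) : FullFlag m W' where
  space i := (φ.space i).map ℓ.toLinearMap
  mono _ _ h := Submodule.map_mono (φ.mono h)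
  finrank_space i := (LinearEquiv.finrank_map_eq ℓ _).trans (φ.finrank_space i)

/-- The standard basis of `ℂ^m`. -/
def stdFrame (m : ℕ) : frames m :=
  ⟨fun k => Pi.single k 1, Pi.linearIndependent_single_one (Fin m) ℂ⟩

/-- The image of the standard basis under `v ↦ [g, v]`, in the `j`-th trivialization. -/
def fiberFrame (j : Fin (m + 1)) (g : SU m) : frames m :=
  open Classical in
  if hj : conjLastColumn g j ≠ 0 then
    ⟨fun k => fiberMap j g (Pi.single k 1), (stdFrame m).2.map' (fiberEquiv hj).toLinearMap
      (fiberEquiv hj).ker⟩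
  -- An arbitrary value outside the domain of the `j`-th trivialization.
  else stdFrame m

theorem fiberFrame_apply {j : Fin (m + 1)} {g : SU m} (hj : conjLastColumn g j ≠ 0) (k : Fin m) :
    (fiberFrame j g).1 k = fiberMap j g (Pi.single k 1) := by
  rw [fiberFrame, dif_pos hj]

/-- The image of the standard flag under `v ↦ [g, v]`, in the `j`-th trivialization. -/
def fiberFlag (j : Fin (m + 1)) (g : SU m) : FullFlag m (Fin m → ℂ) := flagOfFrame (fiberFrame j g)

theorem fiberFlag_eq {j : Fin (m + 1)} {g : SU m} (hj : conjLastColumn g j ≠ 0) :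
    fiberFlag j g = (flagOfFrame (stdFrame m)).map (fiberEquiv hj) := by
  refine FullFlag.ext (funext fun i => ?_)
  change Submodule.span ℂ ((fiberFrame j g).1 '' Iic i) =
    (Submodule.span ℂ ((stdFrame m).1 '' Iic i)).map (fiberEquiv hj).toLinearMap
  rw [Submodule.map_span, ← Set.image_comp]
  congr 2
  funext k
  exact fiberFrame_apply hj k

theorem mem_stdFlag_iff {i : Fin m} {v : Fin m → ℂ} :
    v ∈ (flagOfFrame (stdFrame m)).space i ↔ ∀ k, i < k → v k = 0 := by
  change v ∈ Submodule.span ℂ _ ↔ _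
  constructor
  · intro h
    induction h using Submodule.span_induction with
    | mem x hx =>
      obtain ⟨l, hl, rfl⟩ := hx
      intro k hk
      exact Pi.single_eq_of_ne (lt_of_le_of_lt hl hk).ne' _
    | zero => exact fun k _ => rfl
    | add x y _ _ hx hy => exact fun k hk => by rw [Pi.add_apply, hx k hk, hy k hk, add_zero]
    | smul c x _ hx => exact fun k hk => by rw [Pi.smul_apply, hx k hk, smul_zero]
  · intro h
    rw [← Finset.univ_sum_single v]
    refine Submodule.sum_mem _ fun k _ => ?_
    have h1 : Pi.single k (v k) = v k • (Pi.single k 1 : Fin m → ℂ) := by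
      rw [← Pi.single_smul, smul_eq_mul, mul_one]
    rw [h1]
    rcases le_or_gt k i with hk | hk
    · exact Submodule.smul_mem _ _ (Submodule.subset_span ⟨k, hk, rfl⟩)
    · rw [h k hk, zero_smul]
      exact Submodule.zero_mem _

theorem eq_zero_of_map_stdFlag_le {B : Matrix (Fin m) (Fin m) ℂ}
    (h : ∀ i, ((flagOfFrame (stdFrame m)).space i).map B.mulVecLin ≤
      (flagOfFrame (stdFrame m)).space i) (i j : Fin m) (hij : j < i) : B i j = 0 := by
  have h1 : (Pi.single j 1 : Fin m → ℂ) ∈ (flagOfFrame (stdFrame m)).space j :=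
    Submodule.subset_span ⟨j, mem_Iic.2 le_rfl, rfl⟩
  have h2 := mem_stdFlag_iff.1 (h j ⟨_, h1, rfl⟩) i hij
  rwa [Matrix.mulVecLin_apply, Matrix.mulVec_single_one] at h2

theorem fiberEquiv_twistedAct {j : Fin (m + 1)} {A : Matrix.unitaryGroup (Fin m) ℂ} {g : SU m}
    (hj : conjLastColumn g j ≠ 0) (hj' : conjLastColumn (twistedAct A g) j ≠ 0) :
    (fiberEquiv hj).toLinearMap = (fiberEquiv hj').toLinearMap ∘ₗ A.1.mulVecLin :=
  LinearMap.ext fun v => (fiberMap_twistedAct j A g v).symm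

/-- Equal base points give `g' = A · g`. Since `v ↦ [A · g, A v]` equals `v ↦ [g, v]`, equal flags
mean that `A` preserves the standard flag. Then `A` and `A⁻¹ = Aᴴ` are both upper triangular, so `A`
is diagonal. -/
theorem fiberFlag_eq_iff {j : Fin (m + 1)} {g g' : SU m} (hj : conjLastColumn g j ≠ 0) :
    (toCP g = toCP g' ∧ fiberFlag j g = fiberFlag j g') ↔
      ∃ a ha, g' = twistedAct (diagUnitary a ha) g := by
  constructor
  · rintro ⟨h1, h2⟩
    obtain ⟨A, rfl⟩ := exists_twistedAct_eq h1
    have hj' := conjLastColumn_ne_zero_of_toCP_eq h1 hj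
    rw [fiberFlag_eq hj, fiberFlag_eq hj'] at h2
    have h3 : ∀ i, ((flagOfFrame (stdFrame m)).space i).map A.1.mulVecLin =
        (flagOfFrame (stdFrame m)).space i := fun i => by
      have h4 := congrFun (congrArg FullFlag.space h2) i
      change Submodule.map _ _ = Submodule.map _ _ at h4
      rw [fiberEquiv_twistedAct hj hj', Submodule.map_comp] at h4
      exact Submodule.map_injective_of_injective (fiberEquiv hj').injective h4
    have h5 : ∀ i, ((flagOfFrame (stdFrame m)).space i).map (A⁻¹).1.mulVecLin =
        (flagOfFrame (stdFrame m)).space i := fun i => by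
      conv_lhs => rw [← h3 i]
      rw [← Submodule.map_comp, ← Matrix.mulVecLin_mul, ← Submonoid.coe_mul, inv_mul_cancel,
        Submonoid.coe_one, Matrix.mulVecLin_one, Submodule.map_id]
    obtain ⟨a, ha, rfl⟩ := exists_eq_diagUnitary (eq_zero_of_map_stdFlag_le fun i => (h3 i).le)
      (eq_zero_of_map_stdFlag_le fun i => (h5 i).le)
    exact ⟨a, ha, rfl⟩
  · rintro ⟨a, ha, rfl⟩
    have h1 := (toCP_twistedAct (diagUnitary a ha) g).symm
    have hj' := conjLastColumn_ne_zero_of_toCP_eq h1 hj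
    refine ⟨h1, ?_⟩
    rw [fiberFlag_eq hj, fiberFlag_eq hj']
    refine FullFlag.ext (funext fun i => ?_)
    change Submodule.map _ _ = Submodule.map _ _
    rw [fiberEquiv_twistedAct hj hj', Submodule.map_comp]
    congr 1
    have h2 : ∀ (b : Fin m → ℂ) (v : Fin m → ℂ), v ∈ (flagOfFrame (stdFrame m)).space i →
        Matrix.diagonal b *ᵥ v ∈ (flagOfFrame (stdFrame m)).space i := fun b v hv => by
      rw [mem_stdFlag_iff] at hv ⊢
      intro k hk
      rw [Matrix.mulVec_diagonal, hv k hk, mul_zero]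
    apply le_antisymm
    · rintro _ ⟨v, hv, rfl⟩
      exact h2 a v hv
    · intro v hv
      refine ⟨Matrix.diagonal (fun i => star (a i)) *ᵥ v, h2 _ v hv, ?_⟩
      change Matrix.diagonal a *ᵥ (Matrix.diagonal (fun i => star (a i)) *ᵥ v) = v
      rw [Matrix.mulVec_mulVec, Matrix.diagonal_mul_diagonal]
      funext k
      rw [Matrix.mulVec_diagonal, mul_comm (a k), ha, one_mul]

theorem fiberMap_single (j : Fin (m + 1)) (g : SU m) (k : Fin m) :
    fiberMap j g (Pi.single k 1) = fiberCoord j (conjLastColumn g) (g.1.col k.castSucc) := by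
  have h : padZero (Pi.single k 1 : Fin m → ℂ) = Pi.single k.castSucc 1 := by
    funext i
    refine Fin.lastCases ?_ (fun i => ?_) i
    · rw [padZero_last, Pi.single_eq_of_ne (Fin.castSucc_ne_last k).symm]
    · simp only [padZero_castSucc, Pi.single_apply, Fin.castSucc_inj]
  rw [fiberMap, h, Matrix.mulVec_single_one]

/-- For real `c` the factor `c / star c` is one, so normalizing the last column does not affect
fibre coordinates. -/
theorem fiberCoord_real_smul {r : ℝ} (hr : r ≠ 0) (j : Fin (m + 1)) (y w : Fin (m + 1) → ℂ) :
    fiberCoord j ((r : ℂ) • y) w = fiberCoord j y w := by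
  have hr' : (r : ℂ) ≠ 0 := Complex.ofReal_ne_zero.2 hr
  have h : fiberAct (r : ℂ) w = w := by
    funext i
    rw [fiberAct, Complex.star_def, Complex.conj_ofReal, div_self hr', scaleFirst_one, one_mul]
  conv_lhs => rw [← h]
  exact fiberCoord_smul_fiberAct hr' j y w

/-- The matrix whose last column represents a given point of projective space, and whose other
columns represent a given frame of the fibre. -/
def frameMatrix (j : Fin (m + 1)) (y : Fin (m + 1) → ℂ) (a : Fin m → Fin m → ℂ) :
    Fin (m + 1) → Fin (m + 1) → ℂ :=
  fun i => Fin.snoc (α := fun _ => ℂ) (fun k => fiberLift j y (a k) i) (partialConj y i)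

theorem frameMatrix_castSucc (j : Fin (m + 1)) (y : Fin (m + 1) → ℂ) (a : Fin m → Fin m → ℂ)
    (i : Fin (m + 1)) (k : Fin m) : frameMatrix j y a i k.castSucc = fiberLift j y (a k) i :=
  Fin.snoc_castSucc (α := fun _ => ℂ) _ _ _

theorem frameMatrix_last (j : Fin (m + 1)) (y : Fin (m + 1) → ℂ) (a : Fin m → Fin m → ℂ)
    (i : Fin (m + 1)) : frameMatrix j y a i (Fin.last m) = partialConj y i :=
  Fin.snoc_last (α := fun _ => ℂ) _ _

/-- The assembled matrix reproduces `g` from its own data, so the section built from it passes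
through `g`. -/
theorem frameMatrix_fiberFrame {j : Fin (m + 1)} {g : SU m} (hj : conjLastColumn g j ≠ 0) :
    frameMatrix j (conjLastColumn g) (fiberFrame j g).1 = fun i k => g.1 i k := by
  funext i k
  refine Fin.lastCases ?_ (fun k => ?_) k
  · rw [frameMatrix_last, partialConj_conjLastColumn]
  · rw [frameMatrix_castSucc, fiberFrame_apply hj, fiberMap_single, fiberLift_fiberCoord hj]
    · rfl
    · rw [isPerp_conjLastColumn_iff]
      have h := congrFun (congrFun (conjTranspose_mul_self_SU g) (Fin.last m)) k.castSucc
      rwa [Matrix.one_apply_ne (Fin.castSucc_ne_last k).symm] at h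

theorem contDiffAt_frameMatrix {j : Fin (m + 1)} {y : Fin (m + 1) → ℂ} (hy : y j ≠ 0)
    (a : Fin m → Fin m → ℂ) :
    ContDiffAt ℝ ∞ (fun p : (Fin (m + 1) → ℂ) × (Fin m → Fin m → ℂ) => frameMatrix j p.1 p.2)
      (y, a) := by
  refine contDiffAt_pi.2 fun i => contDiffAt_pi.2 fun k => ?_
  refine Fin.lastCases ?_ (fun k => ?_) k
  · simp only [frameMatrix_last]
    exact contDiffAt_pi.1 (contDiffAt_partialConj contDiffAt_fst) i
  · simp only [frameMatrix_castSucc]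
    refine contDiffAt_pi.1 (contDiffAt_fiberLift contDiffAt_fst ?_ hy) i
    exact ((contDiff_apply ℝ (Fin m → ℂ) k).comp contDiff_snd).contDiffAt

theorem inner_euclideanCols_frameMatrix {j : Fin (m + 1)} {y : Fin (m + 1) → ℂ} (hy : y j ≠ 0)
    (a : Fin m → Fin m → ℂ) (k : Fin (m + 1)) (hk : k < Fin.last m) :
    inner ℂ (euclideanCols (frameMatrix j y a) k)
      (euclideanCols (frameMatrix j y a) (Fin.last m)) = 0 := by
  obtain ⟨k, rfl⟩ := Fin.exists_castSucc_eq.2 hk.ne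
  have h := congrArg star (isPerp_fiberLift hy (a k))
  rw [star_sum, star_zero] at h
  rw [EuclideanSpace.inner_eq_star_dotProduct, dotProduct, ← h]
  refine Finset.sum_congr rfl fun i _ => ?_
  change frameMatrix j y a i (Fin.last m) * star (frameMatrix j y a i k.castSucc) = _
  rw [frameMatrix_last, frameMatrix_castSucc, star_mul', star_star]

/-- The special unitary matrix associated with `frameMatrix`. -/
theorem specialUnitarize_frameMatrix (hm : 0 < m) {j : Fin (m + 1)} {y : Fin (m + 1) → ℂ}
    (hy : y j ≠ 0) {a : frames m} {g : SU m}
    (hN : LinearIndependent ℂ (euclideanCols (frameMatrix j y a.1)))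
    (hg : g.1 = specialUnitarize (frameMatrix j y a.1)) :
    conjLastColumn g j ≠ 0 ∧ toCP g = CP.mk ⟨y, fun h => hy (congrFun h j)⟩ ∧
      fiberFlag j g = flagOfFrame a := by
  set r : ℝ := ‖euclideanCols (frameMatrix j y a.1) (Fin.last m)‖⁻¹
  have hr : r ≠ 0 := inv_ne_zero (norm_ne_zero_iff.2 (hN.ne_zero _))
  have hr' : (r : ℂ) ≠ 0 := Complex.ofReal_ne_zero.2 hr
  -- The last column is orthogonal to the others, so Gram-Schmidt only normalizes it, by the
  -- positive real factor `r`.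
  have h1 : conjLastColumn g = (r : ℂ) • y := by
    have h2 : ∀ i, g.1 i (Fin.last m) = (r : ℂ) * partialConj y i := fun i => by
      rw [hg, specialUnitarize_last hm (inner_euclideanCols_frameMatrix hy a.1), frameMatrix_last,
        Complex.ofReal_inv]
    funext i
    refine Fin.cases ?_ (fun i => ?_) i
    · exact h2 0
    · change star (g.1 i.succ (Fin.last m)) = (r : ℂ) * y i.succ
      rw [h2, star_mul', Complex.star_def, Complex.conj_ofReal]
      congr 1
      exact star_star _
  have hj : conjLastColumn g j ≠ 0 := by
    rw [h1]
    exact mul_ne_zero hr' hy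
  refine ⟨hj, ?_, ?_⟩
  · refine (Projectivization.mk_eq_mk_iff' ℂ _ _ _ _).2 ⟨(r : ℂ), ?_⟩
    exact h1.symm
  · refine FullFlag.ext (funext fun i => ?_)
    change Submodule.span ℂ ((fiberFrame j g).1 '' Iic i) = Submodule.span ℂ (a.1 '' Iic i)
    have h2 : (fiberFrame j g).1 = fun k => fiberCoord j y (g.1.col k.castSucc) := by
      funext k
      rw [fiberFrame_apply hj, fiberMap_single, h1, fiberCoord_real_smul hr]
    have h3 : a.1 = fun k => fiberCoord j y ((Matrix.of (frameMatrix j y a.1)).col k.castSucc) := by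
      funext k
      have h4 : (Matrix.of (frameMatrix j y a.1)).col k.castSucc = fiberLift j y (a.1 k) :=
        funext fun i => frameMatrix_castSucc j y a.1 i k
      rw [h4, fiberCoord_fiberLift hy]
    -- Both flags are images under `fiberCoord j y` of spans of leading columns, and
    -- `specialUnitarize` preserves these spans.
    have h5 : ∀ B : Matrix (Fin (m + 1)) (Fin (m + 1)) ℂ,
        Submodule.span ℂ ((fun k : Fin m => fiberCoord j y (B.col k.castSucc)) '' Iic i) =
          (Submodule.span ℂ (B.col '' Iic i.castSucc)).map (fiberCoord j y) := fun B => by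
      rw [Submodule.map_span, ← Set.image_comp, ← Fin.image_castSucc_Iic, ← Set.image_comp]
      rfl
    rw [h2]
    conv_rhs => rw [h3]
    rw [h5, h5, hg, span_col_specialUnitarize hN]

end Flags

/-! ### Smooth quotients that fibre over a manifold -/

section Fibered

open Topology Set

variable {E H V W : Type} [NormedAddCommGroup E] [NormedSpace ℝ E] [TopologicalSpace H]
  {I : ModelWithCorners ℝ E H} {M X A B : Type} [TopologicalSpace M] [ChartedSpace H M]
  [TopologicalSpace X] [NormedAddCommGroup V] [NormedSpace ℝ V] [NormedAddCommGroup W]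
  [NormedSpace ℝ W] [TopologicalSpace A] [ChartedSpace V A] [TopologicalSpace B] [ChartedSpace W B]

/-- A variant of `QuotientCharts` where the quotient maps to a manifold `A`, and where the charts
take values in a product of `A` with a manifold `B`. -/
structure FiberedCharts (I : ModelWithCorners ℝ E H) (V W : Type) [NormedAddCommGroup V]
    [NormedSpace ℝ V] [NormedAddCommGroup W] [NormedSpace ℝ W] [ChartedSpace V A]
    [ChartedSpace W B] {ι : Type} (q : M → X) (O : ι → Set M) (β : M → A) (f : ι → M → B) :
    Prop where
  isQuotientMap : IsQuotientMap q
  cover : ∀ x, ∃ j, x ∈ O j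
  isOpen : ∀ j, IsOpen (O j)
  base_eq : ∀ x y, q x = q y → β x = β y
  saturated : ∀ j x y, x ∈ O j → β x = β y → y ∈ O j
  contMDiff_base : ContMDiff I 𝓘(ℝ, V) ∞ β
  contMDiffAt : ∀ j, ∀ x ∈ O j, ContMDiffAt I 𝓘(ℝ, W) ∞ (f j) x
  eq_iff : ∀ j, ∀ x ∈ O j, ∀ y ∈ O j, (β x = β y ∧ f j x = f j y) ↔ q x = q y
  exists_section : ∀ j, ∀ x ∈ O j, ∃ s : A × B → M, s (β x, f j x) = x ∧
    ContMDiffAt (𝓘(ℝ, V).prod 𝓘(ℝ, W)) I ∞ s (β x, f j x) ∧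
    ∀ᶠ n in 𝓝 (β x, f j x), s n ∈ O j ∧ β (s n) = n.1 ∧ f j (s n) = n.2

/-- The charted space structure of a product over the product of the model vector spaces. -/
@[reducible] def prodSelfChartedSpace (V W A B : Type) [NormedAddCommGroup V]
    [NormedAddCommGroup W] [TopologicalSpace A] [ChartedSpace V A] [TopologicalSpace B]
    [ChartedSpace W B] : ChartedSpace (V × W) (A × B) :=
  inferInstanceAs (ChartedSpace (ModelProd V W) (A × B))

theorem isManifold_prodSelf [IsManifold 𝓘(ℝ, V) ∞ A] [IsManifold 𝓘(ℝ, W) ∞ B] :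
    letI := prodSelfChartedSpace V W A B
    IsManifold 𝓘(ℝ, V × W) ∞ (A × B) := by
  rw [modelWithCornersSelf_prod]
  exact IsManifold.prod A B

namespace FiberedCharts

variable {ι : Type} {q : M → X} {O : ι → Set M} {β : M → A} {f : ι → M → B}

theorem quotientCharts (h : FiberedCharts I V W q O β f) :
    letI := prodSelfChartedSpace V W A B
    QuotientCharts I (V × W) q O fun j x => (β x, f j x) := by
  let _ := prodSelfChartedSpace V W A B
  refine ⟨h.isQuotientMap, h.cover, h.isOpen, fun j x y hx hxy =>
    h.saturated j x y hx (h.base_eq x y hxy), fun j x hx => ?_, fun j x hx y hy => ?_,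
    fun j x hx => ?_⟩
  · rw [modelWithCornersSelf_prod]
    exact ((h.contMDiff_base x).prodMk (h.contMDiffAt j x hx)).contMDiffWithinAt
  · rw [Prod.mk_inj]
    exact h.eq_iff j x hx y hy
  · obtain ⟨s, h1, h2, h3⟩ := h.exists_section j x hx
    refine ⟨s, h1, ?_, h3.mono fun n hn => ⟨hn.1, Prod.ext hn.2.1 hn.2.2⟩⟩
    rw [modelWithCornersSelf_prod]
    exact h2

/-- Points with different images in `A` are separated there. Points with the same image lie in a
common `O j` by saturation and are separated by `f j` in `B`. -/
theorem isClosed_rel [T2Space A] [T2Space B] (h : FiberedCharts I V W q O β f) :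
    IsClosed {p : M × M | q p.1 = q p.2} := by
  rw [← isOpen_compl_iff, isOpen_iff_mem_nhds]
  rintro ⟨x, y⟩ hxy
  have hβ := h.contMDiff_base.continuous
  by_cases hb : β x = β y
  · obtain ⟨j, hx⟩ := h.cover x
    have hy := h.saturated j x y hx hb
    have hne : f j x ≠ f j y := fun hf => hxy ((h.eq_iff j x hx y hy).1 ⟨hb, hf⟩)
    have h1 : Filter.Tendsto (fun p : M × M => (f j p.1, f j p.2)) (𝓝 (x, y))
        (𝓝 (f j x, f j y)) :=
      ((h.contMDiffAt j x hx).continuousAt.comp continuousAt_fst).prodMk_nhds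
        ((h.contMDiffAt j y hy).continuousAt.comp continuousAt_snd)
    have h2 := h1.eventually (isClosed_diagonal.isOpen_compl.mem_nhds
      (show (f j x, f j y) ∈ (Set.diagonal B)ᶜ from hne))
    filter_upwards [h2, ((h.isOpen j).prod (h.isOpen j)).mem_nhds (mk_mem_prod hx hy)] with p hp hpO
    exact fun hq => hp ((h.eq_iff j _ hpO.1 _ hpO.2).2 hq).2
  · have h1 : IsOpen {p : M × M | β p.1 ≠ β p.2} :=
      isOpen_ne_fun (hβ.comp continuous_fst) (hβ.comp continuous_snd)
    filter_upwards [h1.mem_nhds hb] with p hp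
    exact fun hq => hp (h.base_eq _ _ hq)

variable [Nonempty M] [IsManifold 𝓘(ℝ, V) ∞ A] [IsManifold 𝓘(ℝ, W) ∞ B] [FiniteDimensional ℝ V]
  [FiniteDimensional ℝ W] [SecondCountableTopology M] [T2Space A] [T2Space B]

/-- The smooth structure of the quotient. -/
def smoothStructure (h : FiberedCharts I V W q O β f) : SmoothStructure X :=
  letI := prodSelfChartedSpace V W A B
  haveI : IsManifold 𝓘(ℝ, V × W) ∞ (A × B) := isManifold_prodSelf
  h.quotientCharts.smoothStructure h.isClosed_rel

theorem contMDiff_quotient (h : FiberedCharts I V W q O β f) :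
    ContMDiff I 𝓘(ℝ, h.smoothStructure.V) ∞ q :=
  letI := prodSelfChartedSpace V W A B
  haveI : IsManifold 𝓘(ℝ, V × W) ∞ (A × B) := isManifold_prodSelf
  h.quotientCharts.contMDiff_quotient

theorem hasSmoothSections (h : FiberedCharts I V W q O β f) :
    HasSmoothSections I 𝓘(ℝ, h.smoothStructure.V) q :=
  letI := prodSelfChartedSpace V W A B
  haveI : IsManifold 𝓘(ℝ, V × W) ∞ (A × B) := isManifold_prodSelf
  h.quotientCharts.hasSmoothSections

theorem isSurjectiveSubmersion [IsManifold I 1 M] (h : FiberedCharts I V W q O β f) :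
    IsSurjectiveSubmersion I 𝓘(ℝ, h.smoothStructure.V) q :=
  haveI : IsManifold 𝓘(ℝ, h.smoothStructure.V) 1 X :=
    IsManifold.of_le (n := ∞) (by simp)
  h.hasSmoothSections.isSurjectiveSubmersion h.isQuotientMap.surjective h.contMDiff_quotient

theorem exists_partialDiffeomorph (h : FiberedCharts I V W q O β f) (j : ι) :
    ∃ Φ : PartialDiffeomorph 𝓘(ℝ, h.smoothStructure.V) (𝓘(ℝ, V).prod 𝓘(ℝ, W)) X (A × B) ∞,
      Φ.source = q '' O j ∧ Φ.target = (fun x => (β x, f j x)) '' O j ∧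
        ∀ x ∈ O j, Φ (q x) = (β x, f j x) := by
  let _ := prodSelfChartedSpace V W A B
  have : IsManifold 𝓘(ℝ, V × W) ∞ (A × B) := isManifold_prodSelf
  rw [← modelWithCornersSelf_prod]
  exact ⟨h.quotientCharts.partialDiffeo h.isClosed_rel j, rfl, rfl,
    fun x hx => h.quotientCharts.localHomeo_apply hx⟩

end FiberedCharts

end Fibered

/-! ### The smooth structure of the biquotient -/

section Biquotients

open Topology

variable {m : ℕ}

/-- The smooth structure of the special unitary group. -/
def suStructure (m : ℕ) : SmoothStructure (SU m) := (exists_smoothStructure_SU m).choose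

theorem isEmbeddingSmooth_SU (m : ℕ) : IsEmbeddingSmooth 𝓘(ℝ, (suStructure m).V)
    𝓘(ℝ, Fin (m + 1) → Fin (m + 1) → ℂ) (fun (g : SU m) (i j : Fin (m + 1)) => g.1 i j) :=
  (exists_smoothStructure_SU m).choose_spec.1

theorem contMDiffAt_SU {E' H' M' : Type} [NormedAddCommGroup E'] [NormedSpace ℝ E']
    [TopologicalSpace H'] [TopologicalSpace M'] [ChartedSpace H' M']
    {I' : ModelWithCorners ℝ E' H'} {f : M' → SU m} {x : M'}
    (h : ContMDiffAt I' 𝓘(ℝ, Fin (m + 1) → Fin (m + 1) → ℂ) ∞ (fun x i j => (f x).1 i j) x) :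
    ContMDiffAt I' 𝓘(ℝ, (suStructure m).V) ∞ f x :=
  (exists_smoothStructure_SU m).choose_spec.2 I' f x h

instance : SecondCountableTopology (SU m) := (suStructure m).secondCountable

theorem contMDiff_SU_coe (i k : Fin (m + 1)) :
    ContMDiff 𝓘(ℝ, (suStructure m).V) 𝓘(ℝ, ℂ) ∞ fun g : SU m => g.1 i k :=
  (contDiff_apply_apply ℝ ℂ i k).contMDiff.comp (isEmbeddingSmooth_SU m).2.1

theorem ContMDiffAt.mul_complex {E' H' M' : Type} [NormedAddCommGroup E'] [NormedSpace ℝ E']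
    [TopologicalSpace H'] [TopologicalSpace M'] [ChartedSpace H' M']
    {I' : ModelWithCorners ℝ E' H'} {f f' : M' → ℂ} {x : M'}
    (hf : ContMDiffAt I' 𝓘(ℝ, ℂ) ∞ f x) (hf' : ContMDiffAt I' 𝓘(ℝ, ℂ) ∞ f' x) :
    ContMDiffAt I' 𝓘(ℝ, ℂ) ∞ (fun x => f x * f' x) x :=
  (contDiff_mul (𝕜 := ℝ) (𝔸 := ℂ)).contMDiff.contMDiffAt.comp x (hf.prodMk_space hf')

theorem contMDiff_conjLastColumn : ContMDiff 𝓘(ℝ, (suStructure m).V)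
    𝓘(ℝ, Fin (m + 1) → ℂ) ∞ (conjLastColumn (m := m)) := by
  have h : ContDiff ℝ ∞ (partialConj (m := m)) :=
    contDiff_iff_contDiffAt.2 fun y => contDiffAt_partialConj contDiffAt_id
  exact h.contMDiff.comp (contMDiff_pi_space.2 fun i => contMDiff_SU_coe i (Fin.last m))

theorem contMDiff_toCP :
    ContMDiff 𝓘(ℝ, (suStructure m).V) 𝓘(ℝ, (cpStructure m).V) ∞ (toCP (m := m)) := by
  refine (contMDiff_CP_mk m).comp (f := fun g : SU m =>
    (⟨conjLastColumn g, conjLastColumn_ne_zero g⟩ : puncturedSpace m)) fun g => ?_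
  rw [← ContMDiffAt.subtypeVal_comp_iff]
  exact contMDiff_conjLastColumn g

theorem isOpen_conjLastColumn_ne (j : Fin (m + 1)) : IsOpen {g : SU m | conjLastColumn g j ≠ 0} :=
  isOpen_ne.preimage ((continuous_apply j).comp contMDiff_conjLastColumn.continuous)

theorem contMDiffAt_fiberMap {E' H' M' : Type} [NormedAddCommGroup E'] [NormedSpace ℝ E']
    [TopologicalSpace H'] [TopologicalSpace M'] [ChartedSpace H' M']
    {I' : ModelWithCorners ℝ E' H'} {f : M' → SU m} {v : M' → Fin m → ℂ} {x : M'}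
    (hf : ContMDiffAt I' 𝓘(ℝ, (suStructure m).V) ∞ f x)
    (hv : ContMDiffAt I' 𝓘(ℝ, Fin m → ℂ) ∞ v x) {j : Fin (m + 1)}
    (hj : conjLastColumn (f x) j ≠ 0) :
    ContMDiffAt I' 𝓘(ℝ, Fin m → ℂ) ∞ (fun x => fiberMap j (f x) (v x)) x := by
  have h1 : ContMDiffAt I' 𝓘(ℝ, Fin (m + 1) → ℂ) ∞ (fun x => (f x).1 *ᵥ padZero (v x)) x := by
    refine contMDiffAt_pi_space.2 fun i => ?_
    simp only [Matrix.mulVec, dotProduct, Fin.sum_univ_castSucc, padZero_castSucc, padZero_last,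
      mul_zero, add_zero]
    refine ContMDiffAt.sum fun k _ => ?_
    exact ((contMDiff_SU_coe i k.castSucc).contMDiffAt.comp x hf).mul_complex
      (contMDiffAt_pi_space.1 hv k)
  have h2 := contMDiff_conjLastColumn.contMDiffAt.comp x hf
  have h3 : ContDiffAt ℝ ∞ (fun p : (Fin (m + 1) → ℂ) × (Fin (m + 1) → ℂ) => fiberCoord j p.1 p.2)
      (conjLastColumn (f x), (f x).1 *ᵥ padZero (v x)) :=
    contDiffAt_fiberCoord contDiffAt_fst contDiffAt_snd hj
  exact h3.contMDiffAt.comp x (h2.prodMk_space h1)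

theorem contMDiffAt_fiberMapInv {E' H' M' : Type} [NormedAddCommGroup E'] [NormedSpace ℝ E']
    [TopologicalSpace H'] [TopologicalSpace M'] [ChartedSpace H' M']
    {I' : ModelWithCorners ℝ E' H'} {f : M' → SU m} {u : M' → Fin m → ℂ} {x : M'}
    (hf : ContMDiffAt I' 𝓘(ℝ, (suStructure m).V) ∞ f x)
    (hu : ContMDiffAt I' 𝓘(ℝ, Fin m → ℂ) ∞ u x) {j : Fin (m + 1)}
    (hj : conjLastColumn (f x) j ≠ 0) :
    ContMDiffAt I' 𝓘(ℝ, Fin m → ℂ) ∞ (fun x => fiberMapInv j (f x) (u x)) x := by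
  have h2 := contMDiff_conjLastColumn.contMDiffAt.comp x hf
  have h3 : ContDiffAt ℝ ∞ (fun p : (Fin (m + 1) → ℂ) × (Fin m → ℂ) => fiberLift j p.1 p.2)
      (conjLastColumn (f x), u x) :=
    contDiffAt_fiberLift contDiffAt_fst contDiffAt_snd hj
  have h4 := contMDiffAt_pi_space.1 (h3.contMDiffAt.comp x (h2.prodMk_space hu))
  refine contMDiffAt_pi_space.2 fun i => ?_
  simp only [fiberMapInv, Matrix.mulVec, dotProduct, Matrix.conjTranspose_apply]
  refine ContMDiffAt.sum fun k _ => ContMDiffAt.mul_complex ?_ (h4 k)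
  exact (contDiff_star contDiffAt_id).contMDiffAt.comp x
    ((contMDiff_SU_coe k i.castSucc).contMDiffAt.comp x hf)

theorem contMDiffAt_fiberFlag {j : Fin (m + 1)} {g : SU m} (hj : conjLastColumn g j ≠ 0) :
    ContMDiffAt 𝓘(ℝ, (suStructure m).V) 𝓘(ℝ, (flagStructure m).V) ∞ (fiberFlag j) g := by
  refine (contMDiff_flagOfFrame m _).comp g (f := fiberFrame j) ?_
  rw [← ContMDiffAt.subtypeVal_comp_iff]
  refine contMDiffAt_pi_space.2 fun k => ?_
  refine (contMDiffAt_fiberMap (v := fun _ => Pi.single k 1) contMDiffAt_id contMDiffAt_const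
    hj).congr_of_eventuallyEq ?_
  filter_upwards [(isOpen_conjLastColumn_ne j).mem_nhds hj] with g' hg'
  exact fiberFrame_apply hg' k

/-- Lift the point to a vector and the flag to a frame by smooth local sections, assemble them with
`frameMatrix`, and retract to SU(m + 1) by `specialUnitarize`. -/
theorem exists_section_fiberFlag (hm : 0 < m) {j : Fin (m + 1)} {g : SU m}
    (hj : conjLastColumn g j ≠ 0) :
    ∃ s : CP m × FullFlag m (Fin m → ℂ) → SU m, s (toCP g, fiberFlag j g) = g ∧
      ContMDiffAt (𝓘(ℝ, (cpStructure m).V).prod 𝓘(ℝ, (flagStructure m).V))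
        𝓘(ℝ, (suStructure m).V) ∞ s (toCP g, fiberFlag j g) ∧
      ∀ᶠ n in 𝓝 (toCP g, fiberFlag j g),
        conjLastColumn (s n) j ≠ 0 ∧ toCP (s n) = n.1 ∧ fiberFlag j (s n) = n.2 := by
  obtain ⟨σ, hσ1, hσ2, hσ3⟩ :=
    hasSmoothSections_CP_mk m ⟨conjLastColumn g, conjLastColumn_ne_zero g⟩
  obtain ⟨τ, hτ1, hτ2, hτ3⟩ := hasSmoothSections_flagOfFrame m (fiberFrame j g)
  change σ (toCP g) = _ at hσ1
  change ContMDiffAt _ _ ∞ σ (toCP g) at hσ2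
  change ∀ᶠ p in 𝓝 (toCP g), _ at hσ3
  change τ (fiberFlag j g) = _ at hτ1
  change ContMDiffAt _ _ ∞ τ (fiberFlag j g) at hτ2
  change ∀ᶠ p in 𝓝 (fiberFlag j g), _ at hτ3
  let N : CP m × FullFlag m (Fin m → ℂ) → Fin (m + 1) → Fin (m + 1) → ℂ := fun n =>
    frameMatrix j (σ n.1).1 (τ n.2).1
  have hN0 : N (toCP g, fiberFlag j g) = fun i k => g.1 i k := by
    simp only [N, hσ1, hτ1]
    exact frameMatrix_fiberFrame hj
  have hσ' : ContMDiffAt (𝓘(ℝ, (cpStructure m).V).prod 𝓘(ℝ, (flagStructure m).V))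
      𝓘(ℝ, Fin (m + 1) → ℂ) ∞ (fun n => (σ n.1).1) (toCP g, fiberFlag j g) :=
    (contMDiff_subtype_val (U := puncturedSpace m)).contMDiffAt.comp _
      (ContMDiffAt.comp (toCP g, fiberFlag j g) hσ2 contMDiffAt_fst)
  have hτ' : ContMDiffAt (𝓘(ℝ, (cpStructure m).V).prod 𝓘(ℝ, (flagStructure m).V))
      𝓘(ℝ, Fin m → Fin m → ℂ) ∞ (fun n => (τ n.2).1) (toCP g, fiberFlag j g) :=
    (contMDiff_subtype_val (U := frames m)).contMDiffAt.comp _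
      (ContMDiffAt.comp (toCP g, fiberFlag j g) hτ2 contMDiffAt_snd)
  have hy0 : (σ (toCP g)).1 j ≠ 0 := by
    rw [hσ1]
    exact hj
  have hN : ContMDiffAt (𝓘(ℝ, (cpStructure m).V).prod 𝓘(ℝ, (flagStructure m).V))
      𝓘(ℝ, Fin (m + 1) → Fin (m + 1) → ℂ) ∞ N (toCP g, fiberFlag j g) :=
    (contDiffAt_frameMatrix hy0 (τ (fiberFlag j g)).1).contMDiffAt.comp
      (toCP g, fiberFlag j g) (hσ'.prodMk_space hτ')
  have hli0 : LinearIndependent ℂ (euclideanCols (N (toCP g, fiberFlag j g))) := by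
    rw [hN0]
    exact linearIndependent_euclideanCols g
  have hli : ∀ᶠ n in 𝓝 (toCP g, fiberFlag j g), LinearIndependent ℂ (euclideanCols (N n)) :=
    hN.continuousAt.eventually (isOpen_linearIndependent_euclideanCols.mem_nhds hli0)
  classical
  let s : CP m × FullFlag m (Fin m → ℂ) → SU m := fun n =>
    if h : LinearIndependent ℂ (euclideanCols (N n)) then
      -- Linear independence holds near the base point, so the value `1` elsewhere is irrelevant.
      ⟨specialUnitarize (N n), specialUnitarize_mem h⟩ else 1
  have hs : ∀ n, LinearIndependent ℂ (euclideanCols (N n)) →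
      (s n).1 = specialUnitarize (N n) := fun n hn => by
    simp only [s]
    rw [dif_pos hn]
  refine ⟨s, ?_, ?_, ?_⟩
  · refine Subtype.ext ?_
    rw [hs _ hli0, hN0, specialUnitarize_eq_self]
  · refine contMDiffAt_SU ?_
    refine ((contDiffAt_specialUnitarize hli0).contMDiffAt.comp _ hN).congr_of_eventuallyEq ?_
    filter_upwards [hli] with n hn
    funext i k
    rw [hs n hn]
    rfl
  · have hy : ∀ᶠ n in 𝓝 (toCP g, fiberFlag j g), (σ n.1).1 j ≠ 0 :=
      ((continuousAt_apply j _).comp hσ'.continuousAt).eventually_ne hy0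
    filter_upwards [hli, hy, continuousAt_fst.eventually hσ3, continuousAt_snd.eventually hτ3]
      with n hn hyn h1 h2
    obtain ⟨k1, k2, k3⟩ := specialUnitarize_frameMatrix hm hyn hn (hs n hn)
    exact ⟨k1, k2.trans h1, k3.trans h2⟩

instance : T2Space (CP m) := (cpStructure m).t2Space

instance : T2Space (FullFlag m (Fin m → ℂ)) := (flagStructure m).t2Space

theorem exists_conjLastColumn_ne (g : SU m) : ∃ j, conjLastColumn g j ≠ 0 :=
  Function.ne_iff.1 (conjLastColumn_ne_zero g)

/-- Quotients of the special unitary group with the same fibres as the orbit map of `S₁₂`. -/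
theorem fiberedCharts_SU (hm : 0 < m) {X : Type} [TopologicalSpace X] {q : SU m → X}
    (hq : IsQuotientMap q)
    (hiff : ∀ g g', q g = q g' ↔ ∃ a ha, g' = twistedAct (diagUnitary a ha) g) :
    FiberedCharts 𝓘(ℝ, (suStructure m).V) (cpStructure m).V (flagStructure m).V q
      (fun j : Fin (m + 1) => {g | conjLastColumn g j ≠ 0}) toCP fiberFlag where
  isQuotientMap := hq
  cover := exists_conjLastColumn_ne
  isOpen := isOpen_conjLastColumn_ne
  base_eq g g' h := by
    obtain ⟨a, ha, rfl⟩ := (hiff g g').1 h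
    exact (toCP_twistedAct _ _).symm
  saturated j g g' hg h := conjLastColumn_ne_zero_of_toCP_eq h hg
  contMDiff_base := contMDiff_toCP
  contMDiffAt j g hg := contMDiffAt_fiberFlag hg
  eq_iff j g hg g' _ := by rw [hiff, fiberFlag_eq_iff hg]
  exists_section j g hg := exists_section_fiberFlag hm hg

end Biquotients

/-! ### The associated bundle as a smooth vector bundle -/

section VectorBundles

open Topology

variable {m : ℕ}

/-- The coordinate change between two trivializations of the associated bundle. -/
def bundleCoordChange (j k : Fin (m + 1)) (b : CP m) : (Fin m → ℂ) →L[ℂ] (Fin m → ℂ) :=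
  LinearMap.toContinuousLinearMap (fiberCoordChange j k b.rep)

/-- The domain of the `j`-th trivialization of the associated bundle. -/
def bundleBaseSet (j : Fin (m + 1)) : Set (CP m) := {b | b.rep j ≠ 0}

theorem exists_rep_eq_smul (y : puncturedSpace m) : ∃ c : ℂ, c ≠ 0 ∧ (CP.mk y).rep = c • y.1 := by
  obtain ⟨c, hc⟩ := Projectivization.exists_smul_eq_mk_rep ℂ y.1 y.2
  exact ⟨c, c.ne_zero, hc.symm⟩

theorem mem_bundleBaseSet_mk_iff {j : Fin (m + 1)} {y : puncturedSpace m} :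
    CP.mk y ∈ bundleBaseSet j ↔ y.1 j ≠ 0 := by
  obtain ⟨c, hc, h⟩ := exists_rep_eq_smul y
  change (CP.mk y).rep j ≠ 0 ↔ _
  rw [h, Pi.smul_apply, smul_eq_mul, mul_ne_zero_iff, and_iff_right hc]

theorem mem_bundleBaseSet_toCP_iff {j : Fin (m + 1)} {g : SU m} :
    toCP g ∈ bundleBaseSet j ↔ conjLastColumn g j ≠ 0 := mem_bundleBaseSet_mk_iff

theorem bundleCoordChange_mk {j : Fin (m + 1)} (k : Fin (m + 1)) {y : puncturedSpace m}
    (hy : y.1 j ≠ 0) (u : Fin m → ℂ) :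
    bundleCoordChange j k (CP.mk y) u = fiberCoordChange j k y.1 u := by
  obtain ⟨c, hc, h⟩ := exists_rep_eq_smul y
  change fiberCoordChange j k (CP.mk y).rep u = _
  rw [h, fiberCoordChange_smul hc k hy]

theorem bundleCoordChange_fiberMap {j : Fin (m + 1)} (k : Fin (m + 1)) {g : SU m}
    (hj : conjLastColumn g j ≠ 0) (v : Fin m → ℂ) :
    bundleCoordChange j k (toCP g) (fiberMap j g v) = fiberMap k g v :=
  (bundleCoordChange_mk k hj _).trans (fiberCoordChange_fiberMap k hj v)

theorem isOpen_bundleBaseSet (j : Fin (m + 1)) : IsOpen (bundleBaseSet (m := m) j) := by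
  rw [← (cpCharts m).isQuotientMap.isOpen_preimage]
  have h : CP.mk ⁻¹' bundleBaseSet j = {y : puncturedSpace m | y.1 j ≠ 0} :=
    Set.ext fun y => mem_bundleBaseSet_mk_iff
  rw [h]
  exact (cpCharts m).isOpen j

/-- The representative `b.rep` need not depend continuously on `b`. By scale invariance it can be
replaced by an arbitrary nonzero vector on the line, and smoothness is checked after composing with
`CP.mk`. -/
theorem contMDiffOn_bundleCoordChange (j k : Fin (m + 1)) :
    ContMDiffOn 𝓘(ℝ, (cpStructure m).V) 𝓘(ℝ, (Fin m → ℂ) →L[ℝ] (Fin m → ℂ)) ∞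
      (fun b => (bundleCoordChange j k b).restrictScalars ℝ)
      (bundleBaseSet j ∩ bundleBaseSet k) := by
  rintro b ⟨hj, hk⟩
  obtain ⟨y, rfl⟩ := surjective_CP_mk m b
  rw [mem_bundleBaseSet_mk_iff] at hj hk
  refine ContMDiffAt.contMDiffWithinAt ((hasSmoothSections_CP_mk m).contMDiffAt_of_comp ?_)
  have ho : ∀ i : Fin (m + 1), IsOpen {y : Fin (m + 1) → ℂ | y i ≠ 0} := fun i =>
    isOpen_ne.preimage (continuous_apply i)
  have h1 : ContDiffOn ℝ ∞ (fun y : Fin (m + 1) → ℂ =>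
      (LinearMap.toContinuousLinearMap (fiberCoordChange j k y)).restrictScalars ℝ)
      ({y | y j ≠ 0} ∩ {y | y k ≠ 0}) := by
    rw [contDiffOn_clm_apply]
    rintro u y ⟨hyj, hyk⟩
    exact (contDiffAt_fiberCoord contDiffAt_id
      (contDiffAt_fiberLift contDiffAt_id contDiffAt_const hyj) hyk).contDiffWithinAt
  have h2 := h1.contDiffAt (((ho j).inter (ho k)).mem_nhds ⟨hj, hk⟩)
  refine (h2.contMDiffAt.comp y (contMDiff_subtype_val y)).congr_of_eventuallyEq ?_
  filter_upwards [((cpCharts m).isOpen j).mem_nhds hj] with y' hy'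
  exact ContinuousLinearMap.ext fun u => bundleCoordChange_mk k hy' u

/-- The transition functions of the associated bundle. -/
def bundleCore (m : ℕ) : VectorBundleCore ℂ (CP m) (Fin m → ℂ) (Fin (m + 1)) where
  baseSet := bundleBaseSet
  isOpen_baseSet := isOpen_bundleBaseSet
  indexAt b := (Function.ne_iff.1 b.rep_nonzero).choose
  mem_baseSet_at b := (Function.ne_iff.1 b.rep_nonzero).choose_spec
  coordChange := bundleCoordChange
  coordChange_self _ _ hb u := fiberCoordChange_self hb u
  continuousOn_coordChange j k := by
    -- Restriction of scalars embeds complex operators isometrically in the real ones, so continuity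
    -- follows from the real statement.
    rw [(ContinuousLinearMap.restrictScalarsIsometry ℂ (Fin m → ℂ) (Fin m → ℂ) ℝ
      ℝ).isometry.isEmbedding.isInducing.continuousOn_iff]
    exact (contMDiffOn_bundleCoordChange j k).continuousOn
  coordChange_comp _ _ l _ hb u := fiberCoordChange_comp l hb.1.1 hb.1.2 u

/-- The transition functions of the associated bundle, as real linear maps. -/
def realBundleCore (m : ℕ) : VectorBundleCore ℝ (CP m) (Fin m → ℂ) (Fin (m + 1)) where
  baseSet := bundleBaseSet
  isOpen_baseSet := isOpen_bundleBaseSet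
  indexAt := (bundleCore m).indexAt
  mem_baseSet_at := (bundleCore m).mem_baseSet_at
  coordChange j k b := (bundleCoordChange j k b).restrictScalars ℝ
  coordChange_self := (bundleCore m).coordChange_self
  continuousOn_coordChange j k := (contMDiffOn_bundleCoordChange j k).continuousOn
  coordChange_comp := (bundleCore m).coordChange_comp

instance : (realBundleCore m).IsContMDiff 𝓘(ℝ, (cpStructure m).V) ∞ :=
  ⟨contMDiffOn_bundleCoordChange⟩

/-- The associated bundle as a smooth complex vector bundle. -/
def assocVectorBundle (m : ℕ) : SmoothComplexVectorBundle (cpStructure m) m where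
  fiber := (bundleCore m).Fiber
  -- The real and complex cores have the same base sets, index choices and underlying coordinate
  -- changes, so the real structures live on the same bundle.
  vectorBundleReal := inferInstanceAs
    (VectorBundle ℝ (Fin m → ℂ) (realBundleCore m).Fiber)
  smooth := inferInstanceAs
    (ContMDiffVectorBundle ∞ (Fin m → ℂ) (realBundleCore m).Fiber 𝓘(ℝ, (cpStructure m).V))

end VectorBundles

/-! ### Realization of all points and flags by special unitary matrices. -/

section Surjectivity

variable {m : ℕ}

-- The columns from the frame are independent because `fiberLift` is injective. The last column is
-- orthogonal to them, so if it lay in their span it would be orthogonal to itself, hence zero.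
open scoped ComplexOrder in
theorem linearIndependent_frameMatrix {j : Fin (m + 1)} {y : Fin (m + 1) → ℂ} (hy : y j ≠ 0)
    (a : frames m) : LinearIndependent ℂ (euclideanCols (frameMatrix j y a.1)) := by
  rw [linearIndependent_euclideanCols_iff]
  have h : (Matrix.of (frameMatrix j y a.1)).col =
      Fin.snoc (α := fun _ => Fin (m + 1) → ℂ) (fun k => fiberLift j y (a.1 k)) (partialConj y) := by
    funext k
    refine Fin.lastCases ?_ (fun k => ?_) k
    · rw [Fin.snoc_last]
      exact funext fun i => frameMatrix_last j y a.1 i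
    · rw [Fin.snoc_castSucc]
      exact funext fun i => frameMatrix_castSucc j y a.1 i k
  rw [h, linearIndependent_finSnoc]
  refine ⟨a.2.map' (fiberLift j y) (LinearMap.ker_eq_bot_of_injective
    (Function.LeftInverse.injective (fiberCoord_fiberLift hy))), fun hmem => ?_⟩
  have h1 : Submodule.span ℂ (Set.range fun k => fiberLift j y (a.1 k)) ≤
      LinearMap.range (fiberLift j y) := Submodule.span_le.2 (by
    rintro _ ⟨k, rfl⟩
    exact ⟨_, rfl⟩)
  obtain ⟨u, hu⟩ := h1 hmem
  have h2 : star (partialConj y) ⬝ᵥ partialConj y = 0 := by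
    have h3 := isPerp_fiberLift hy u
    rwa [hu] at h3
  exact partialConj_ne_zero hy (congrFun (dotProduct_star_self_eq_zero.1 h2) j)

theorem exists_toCP_eq_and_fiberFlag_eq (hm : 0 < m) {j : Fin (m + 1)} {b : CP m}
    (hb : b ∈ bundleBaseSet j) (φ : FullFlag m (Fin m → ℂ)) :
    ∃ g : SU m, conjLastColumn g j ≠ 0 ∧ toCP g = b ∧ fiberFlag j g = φ := by
  obtain ⟨⟨y, hy0⟩, rfl⟩ := surjective_CP_mk m b
  obtain ⟨a, rfl⟩ := surjective_flagOfFrame φ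
  have hy := mem_bundleBaseSet_mk_iff.1 hb
  have hN := linearIndependent_frameMatrix hy a
  exact ⟨⟨_, specialUnitarize_mem hN⟩, specialUnitarize_frameMatrix hm hy hN rfl⟩

theorem surjective_toCP (hm : 0 < m) : Function.Surjective (toCP (m := m)) := fun b => by
  obtain ⟨g, -, hg, -⟩ := exists_toCP_eq_and_fiberFlag_eq hm ((bundleCore m).mem_baseSet_at b)
    (flagOfFrame (stdFrame m))
  exact ⟨g, hg⟩

end Surjectivity

/-! ### The total space of the associated bundle -/

section TotalSpace

open Topology

variable {m : ℕ}

theorem conjLastColumn_indexAt_ne_zero (g : SU m) :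
    conjLastColumn g ((bundleCore m).indexAt (toCP g)) ≠ 0 :=
  mem_bundleBaseSet_toCP_iff.1 ((bundleCore m).mem_baseSet_at _)

/-- The isomorphism `v ↦ [g, v]` onto the fibre. -/
def fiberIso (g : SU m) : (Fin m → ℂ) ≃ₗ[ℂ] (assocVectorBundle m).fiber (toCP g) :=
  fiberEquiv (conjLastColumn_indexAt_ne_zero g)

/-- The map `(g, v) ↦ [g, v]` to the total space of the vector bundle. -/
def toTotal (p : SU m × (Fin m → ℂ)) : (assocVectorBundle m).Total := ⟨toCP p.1, fiberIso p.1 p.2⟩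

theorem localTriv_toTotal (j : Fin (m + 1)) (p : SU m × (Fin m → ℂ)) :
    (bundleCore m).localTriv j (toTotal p) = (toCP p.1, fiberMap j p.1 p.2) :=
  Prod.ext rfl (bundleCoordChange_fiberMap j (conjLastColumn_indexAt_ne_zero p.1) p.2)

/-- Freeze the flag in the section of `exists_section_fiberFlag`. -/
theorem exists_section_toCP (hm : 0 < m) (g : SU m) :
    ∃ s : CP m → SU m, s (toCP g) = g ∧
      ContMDiffAt 𝓘(ℝ, (cpStructure m).V) 𝓘(ℝ, (suStructure m).V) ∞ s (toCP g) ∧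
      ∀ᶠ b in 𝓝 (toCP g), toCP (s b) = b := by
  obtain ⟨j, hj⟩ := exists_conjLastColumn_ne g
  obtain ⟨s, h1, h2, h3⟩ := exists_section_fiberFlag hm hj
  have h4 : ContMDiffAt 𝓘(ℝ, (cpStructure m).V)
      (𝓘(ℝ, (cpStructure m).V).prod 𝓘(ℝ, (flagStructure m).V)) ∞
      (fun b => (b, fiberFlag j g)) (toCP g) := contMDiffAt_id.prodMk contMDiffAt_const
  exact ⟨fun b => s (b, fiberFlag j g), h1, h2.comp (toCP g) h4,
    (h4.continuousAt.eventually h3).mono fun b hb => hb.2.1⟩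

/-- Over one base point `g' = A · g` for some `A`, and injectivity of `fiberMap j` on the fibre then
forces `v' = A v`. -/
theorem fiberMap_eq_iff {j : Fin (m + 1)} {p p' : SU m × (Fin m → ℂ)}
    (hj : conjLastColumn p.1 j ≠ 0) :
    (toCP p.1 = toCP p'.1 ∧ fiberMap j p.1 p.2 = fiberMap j p'.1 p'.2) ↔
      AssocBundle.mk p = AssocBundle.mk p' := by
  refine Iff.trans ?_ (Quotient.eq (r := assocSetoid m)).symm
  constructor
  · rintro ⟨h1, h2⟩
    obtain ⟨A, hA⟩ := exists_twistedAct_eq h1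
    have hj' := conjLastColumn_ne_zero_of_toCP_eq h1 hj
    refine ⟨A, Prod.ext hA ((fiberEquiv hj').injective ?_)⟩
    change fiberMap j p'.1 p'.2 = fiberMap j p'.1 (A.1 *ᵥ p.2)
    rw [← h2, hA, fiberMap_twistedAct]
  · rintro ⟨A, rfl⟩
    exact ⟨(toCP_twistedAct A p.1).symm, (fiberMap_twistedAct j A p.1 p.2).symm⟩

theorem fiberedCharts_assocBundle (hm : 0 < m) :
    FiberedCharts (𝓘(ℝ, (suStructure m).V).prod 𝓘(ℝ, Fin m → ℂ)) (cpStructure m).V (Fin m → ℂ)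
      (AssocBundle.mk (m := m)) (fun j : Fin (m + 1) => {p | conjLastColumn p.1 j ≠ 0})
      (fun p => toCP p.1) (fun j p => fiberMap j p.1 p.2) where
  isQuotientMap := isQuotientMap_quot_mk
  cover p := exists_conjLastColumn_ne p.1
  isOpen j := (isOpen_conjLastColumn_ne j).preimage continuous_fst
  base_eq p p' h := by
    obtain ⟨j, hj⟩ := exists_conjLastColumn_ne p.1
    exact ((fiberMap_eq_iff hj).2 h).1
  saturated j p p' hp h := conjLastColumn_ne_zero_of_toCP_eq h hp
  contMDiff_base := contMDiff_toCP.comp contMDiff_fst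
  contMDiffAt j p hp := contMDiffAt_fiberMap contMDiffAt_fst contMDiffAt_snd hp
  eq_iff j p hp p' _ := fiberMap_eq_iff hp
  exists_section j p hp := by
    obtain ⟨s, h1, h2, h3⟩ := exists_section_toCP hm p.1
    have h4 : ContMDiffAt (𝓘(ℝ, (cpStructure m).V).prod 𝓘(ℝ, Fin m → ℂ)) 𝓘(ℝ, (suStructure m).V) ∞
        (fun n : CP m × (Fin m → ℂ) => s n.1) (toCP p.1, fiberMap j p.1 p.2) :=
      ContMDiffAt.comp (toCP p.1, fiberMap j p.1 p.2) h2 contMDiffAt_fst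
    have hj : conjLastColumn (s (toCP p.1)) j ≠ 0 := by rwa [h1]
    -- Choose `g` smoothly over the base, then solve `fiberMap j g v = u` for `v`.
    refine ⟨fun n => (s n.1, fiberMapInv j (s n.1) n.2), Prod.ext h1 ?_,
      h4.prodMk (contMDiffAt_fiberMapInv h4 contMDiffAt_snd hj), ?_⟩
    · change fiberMapInv j (s (toCP p.1)) (fiberMap j p.1 p.2) = p.2
      rw [h1, fiberMapInv_fiberMap hp]
    · have h5 := h4.continuousAt.eventually ((isOpen_conjLastColumn_ne j).mem_nhds hj)
      filter_upwards [continuousAt_fst.eventually h3, h5] with n hn hn'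
      exact ⟨hn', hn, fiberMap_fiberMapInv hn' _⟩

theorem contMDiff_toTotal : ContMDiff (𝓘(ℝ, (suStructure m).V).prod 𝓘(ℝ, Fin m → ℂ))
    (𝓘(ℝ, (cpStructure m).V).prod 𝓘(ℝ, Fin m → ℂ)) ∞ (toTotal (m := m)) := by
  intro p
  refine Bundle.contMDiffAt_totalSpace.2 ⟨contMDiff_toCP.contMDiffAt.comp p contMDiffAt_fst, ?_⟩
  refine (contMDiffAt_fiberMap (j := (bundleCore m).indexAt (toCP p.1)) contMDiffAt_fst
    contMDiffAt_snd (conjLastColumn_indexAt_ne_zero p.1)).congr_of_eventuallyEq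
    (Filter.Eventually.of_forall fun p' => ?_)
  exact congrArg Prod.snd (localTriv_toTotal _ p')

theorem surjective_toTotal (hm : 0 < m) : Function.Surjective (toTotal (m := m)) := by
  rintro ⟨b, w⟩
  obtain ⟨g, rfl⟩ := surjective_toCP hm b
  obtain ⟨v, rfl⟩ := (fiberIso g).surjective w
  exact ⟨(g, v), rfl⟩

theorem hasSmoothSections_toTotal (hm : 0 < m) :
    HasSmoothSections (𝓘(ℝ, (suStructure m).V).prod 𝓘(ℝ, Fin m → ℂ))
      (𝓘(ℝ, (cpStructure m).V).prod 𝓘(ℝ, Fin m → ℂ)) (toTotal (m := m)) := by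
  intro p
  set j := (bundleCore m).indexAt (toCP p.1)
  have hj0 : conjLastColumn p.1 j ≠ 0 := conjLastColumn_indexAt_ne_zero p.1
  obtain ⟨s, h1, h2, h3⟩ := exists_section_toCP hm p.1
  obtain ⟨k1, k2⟩ := Bundle.contMDiffAt_totalSpace.1 (contMDiffAt_id
    (I := 𝓘(ℝ, (cpStructure m).V).prod 𝓘(ℝ, Fin m → ℂ)) (n := ∞) (x := toTotal p))
  have h4 : ContMDiffAt (𝓘(ℝ, (cpStructure m).V).prod 𝓘(ℝ, Fin m → ℂ)) 𝓘(ℝ, (suStructure m).V) ∞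
      (fun x : (assocVectorBundle m).Total => s x.1) (toTotal p) :=
    ContMDiffAt.comp (toTotal p) h2 k1
  have hj : conjLastColumn (s (toTotal p).1) j ≠ 0 := by
    change conjLastColumn (s (toCP p.1)) j ≠ 0
    rwa [h1]
  refine ⟨fun x => (s x.1, fiberMapInv j (s x.1) ((bundleCore m).localTriv j x).2), ?_,
    h4.prodMk (contMDiffAt_fiberMapInv h4 k2 hj), ?_⟩
  · refine Prod.ext h1 ?_
    change fiberMapInv j (s (toCP p.1)) ((bundleCore m).localTriv j (toTotal p)).2 = p.2
    rw [h1, localTriv_toTotal, fiberMapInv_fiberMap hj0]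
  · have h5 := h4.continuousAt.eventually ((isOpen_conjLastColumn_ne j).mem_nhds hj)
    filter_upwards [k1.continuousAt.eventually h3, h5] with x hx hx'
    replace hx : toCP (s x.1) = x.1 := hx
    have hxs : x ∈ ((bundleCore m).localTriv j).source := by
      change x.1 ∈ bundleBaseSet j
      rw [← hx]
      exact mem_bundleBaseSet_toCP_iff.2 hx'
    have hts : toTotal (s x.1, fiberMapInv j (s x.1) ((bundleCore m).localTriv j x).2) ∈
        ((bundleCore m).localTriv j).source := mem_bundleBaseSet_toCP_iff.2 hx'
    refine ((bundleCore m).localTriv j).injOn hts hxs ?_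
    exact (localTriv_toTotal j _).trans (Prod.ext hx (fiberMap_fiberMapInv hx' _))

theorem toTotal_eq_iff (p p' : SU m × (Fin m → ℂ)) :
    AssocBundle.mk p = AssocBundle.mk p' ↔ toTotal p = toTotal p' := by
  have hj := conjLastColumn_indexAt_ne_zero p.1
  rw [← fiberMap_eq_iff hj, ← Prod.mk_inj, ← localTriv_toTotal, ← localTriv_toTotal]
  refine ⟨fun h => ?_, fun h => by rw [h]⟩
  have h1 : toTotal p ∈ ((bundleCore m).localTriv ((bundleCore m).indexAt (toCP p.1))).source :=
    mem_bundleBaseSet_toCP_iff.2 hj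
  refine ((bundleCore m).localTriv _).injOn h1 ?_ h
  have h2 : toCP p.1 = toCP p'.1 := congrArg Prod.fst h
  exact mem_bundleBaseSet_toCP_iff.2 (conjLastColumn_ne_zero_of_toCP_eq h2 hj)

/-- The smooth structure of the total space of the associated bundle. -/
def assocStructure (hm : 0 < m) : SmoothStructure (AssocBundle m) :=
  (fiberedCharts_assocBundle hm).smoothStructure

/-- The associated bundle and the total space of the vector bundle are smooth quotients of SU(m + 1)
× ℂ^m with the same fibres. -/
theorem isAssociatedBundle (hm : 0 < m) :
    IsAssociatedBundle (assocStructure hm) (assocVectorBundle m) := by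
  obtain ⟨Φ, hΦ⟩ := exists_diffeomorph_of_hasSmoothSections
    (fiberedCharts_assocBundle hm).contMDiff_quotient (fiberedCharts_assocBundle hm).hasSmoothSections
    (fiberedCharts_assocBundle hm).isQuotientMap.surjective contMDiff_toTotal
    (hasSmoothSections_toTotal hm) (surjective_toTotal hm) toTotal_eq_iff
  exact ⟨Φ, fun g => ⟨fiberIso g, fun v => hΦ (g, v)⟩⟩

end TotalSpace

/-! ### The flag bundle -/

section FlagBundles

open Topology

variable {m : ℕ}

/-- The flag bundle of the associated bundle. -/
abbrev AssocFlagBundle (m : ℕ) : Type := (assocVectorBundle m).FlagBundle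

/-- The map that sends `g` to the image of the standard flag under `v ↦ [g, v]`. -/
def toFlagBundle (g : SU m) : AssocFlagBundle m :=
  ⟨toCP g, (flagOfFrame (stdFrame m)).map (fiberIso g)⟩

/-- The flag bundle is topologized as a quotient of SU(m + 1). That this is its usual topology
follows from `isFlagBundleStructure`, whose diffeomorphisms have open sources covering it. -/
instance : TopologicalSpace (AssocFlagBundle m) :=
  TopologicalSpace.coinduced toFlagBundle inferInstance

/-- The flag in `ℂ^m` that corresponds to a flag in a fibre of the associated bundle. -/
def flagCoord (x : AssocFlagBundle m) : FullFlag m (Fin m → ℂ) := x.2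

theorem flagBundle_ext {x x' : AssocFlagBundle m} (h : x.1 = x'.1)
    (h' : flagCoord x = flagCoord x') : x = x' := by
  obtain ⟨b, φ⟩ := x
  obtain ⟨b', φ'⟩ := x'
  obtain rfl : b = b' := h
  exact congrArg (Sigma.mk b) h'

theorem flagCoord_toFlagBundle (g : SU m) :
    flagCoord (toFlagBundle g) = fiberFlag ((bundleCore m).indexAt (toCP g)) g :=
  (fiberFlag_eq (conjLastColumn_indexAt_ne_zero g)).symm

theorem surjective_toFlagBundle (hm : 0 < m) : Function.Surjective (toFlagBundle (m := m)) := by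
  intro x
  obtain ⟨g, -, h2, h3⟩ := exists_toCP_eq_and_fiberFlag_eq hm ((bundleCore m).mem_baseSet_at x.1)
    (flagCoord x)
  refine ⟨g, flagBundle_ext h2 ?_⟩
  rw [flagCoord_toFlagBundle, h2, h3]

theorem toFlagBundle_eq_iff (g g' : SU m) : toFlagBundle g = toFlagBundle g' ↔
    ∃ a ha, g' = twistedAct (diagUnitary a ha) g := by
  rw [← fiberFlag_eq_iff (conjLastColumn_indexAt_ne_zero g)]
  constructor
  · intro h
    have h1 : toCP g = toCP g' := congrArg Sigma.fst h
    have h2 := congrArg flagCoord h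
    rw [flagCoord_toFlagBundle, flagCoord_toFlagBundle, ← h1] at h2
    exact ⟨h1, h2⟩
  · rintro ⟨h1, h2⟩
    refine flagBundle_ext h1 ?_
    rw [flagCoord_toFlagBundle, flagCoord_toFlagBundle, ← h1, h2]

theorem fiberedCharts_flagBundle (hm : 0 < m) :
    FiberedCharts 𝓘(ℝ, (suStructure m).V) (cpStructure m).V (flagStructure m).V
      (toFlagBundle (m := m)) (fun j : Fin (m + 1) => {g | conjLastColumn g j ≠ 0}) toCP fiberFlag :=
  fiberedCharts_SU hm ⟨⟨rfl⟩, surjective_toFlagBundle hm⟩ toFlagBundle_eq_iff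

theorem fiberedCharts_biquotient (hm : 0 < m) :
    FiberedCharts 𝓘(ℝ, (suStructure m).V) (cpStructure m).V (flagStructure m).V
      (Biquotient.mk (S12 m)) (fun j : Fin (m + 1) => {g | conjLastColumn g j ≠ 0}) toCP fiberFlag :=
  fiberedCharts_SU hm isQuotientMap_quot_mk fun _ _ => biquotient_mk_eq_iff hm

/-- The smooth structure of the flag bundle. -/
def flagBundleStructure (hm : 0 < m) : SmoothStructure (AssocFlagBundle m) :=
  (fiberedCharts_flagBundle hm).smoothStructure

/-- The smooth structure of the biquotient. -/
def biquotientStructure (hm : 0 < m) : SmoothStructure (Biquotient (S12 m)) :=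
  (fiberedCharts_biquotient hm).smoothStructure

/-- The `j`-th trivialization carries the image of the standard flag under `v ↦ [g, v]` to
`fiberFlag j g`, so the diffeomorphism it induces is the one that `FiberedCharts` attaches to `j`.
-/
theorem isFlagBundleStructure (hm : 0 < m) :
    (assocVectorBundle m).IsFlagBundleStructure (flagStructure m) (flagBundleStructure hm) := by
  intro e he
  have key : ∀ (g : SU m), toCP g ∈ e.baseSet → ∀ v,
      e.linearMapAt ℂ (toCP g) (fiberIso g v) = (e (toTotal (g, v))).2 := fun g hb v =>
    congrFun (e.coe_linearMapAt_of_mem hb) _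
  -- The trivialization atlas of a bundle core consists of its standard trivializations only.
  obtain ⟨j, rfl⟩ : e ∈ Set.range (bundleCore m).localTriv := he.out
  obtain ⟨Φ, h1, h2, h3⟩ := (fiberedCharts_flagBundle hm).exists_partialDiffeomorph j
  refine ⟨Φ, ?_, ?_, ?_⟩
  · rw [h1]
    ext x
    obtain ⟨g, rfl⟩ := surjective_toFlagBundle hm x
    refine Iff.trans ⟨?_, fun h => ⟨g, h, rfl⟩⟩ (mem_bundleBaseSet_toCP_iff (g := g)).symm
    rintro ⟨g', hg', h⟩
    exact conjLastColumn_ne_zero_of_toCP_eq (congrArg Sigma.fst h) hg'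
  · rw [h2]
    ext ⟨b, φ⟩
    constructor
    · rintro ⟨g, hg, h⟩
      refine ⟨?_, trivial⟩
      obtain rfl : toCP g = b := congrArg Prod.fst h
      exact mem_bundleBaseSet_toCP_iff.2 hg
    · rintro ⟨hb, -⟩
      obtain ⟨g, hg, k1, k2⟩ := exists_toCP_eq_and_fiberFlag_eq hm hb φ
      exact ⟨g, hg, Prod.ext k1 k2⟩
  · rw [h1]
    rintro _ ⟨g, hg, rfl⟩
    rw [h3 g hg]
    refine ⟨rfl, fun i => ?_⟩
    have hk : ∀ v, _ = fiberMap j g v := fun v =>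
      (key g (mem_bundleBaseSet_toCP_iff.2 hg) v).trans
        (congrArg Prod.snd (localTriv_toTotal j (g, v)))
    refine (congrArg (fun φ => φ.space i) (fiberFlag_eq hg)).trans (SetLike.ext fun w => ⟨?_, ?_⟩)
    · rintro ⟨v, hv, rfl⟩
      exact ⟨fiberIso g v, ⟨v, hv, rfl⟩, hk v⟩
    · rintro ⟨_, ⟨v, hv, rfl⟩, rfl⟩
      exact ⟨v, hv, (hk v).symm⟩

end FlagBundles

end

/-! ### The main theorem. -/

theorem mainTheorem4 (m : ℕ) (hm : 3 ≤ m + 1) :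
    ActsFreelyModKernel (S12 m) ∧
    ∃ (G : SmoothStructure (SU m))
      (X : SmoothStructure (Biquotient (S12 m)))
      (P : SmoothStructure (CP m))
      (L : SmoothStructure (FullFlag m (Fin m → ℂ)))
      (A : SmoothStructure (AssocBundle m))
      (E : SmoothComplexVectorBundle P m)
      (_ : TopologicalSpace E.FlagBundle)
      (F : SmoothStructure E.FlagBundle),
      -- `G` is the submanifold structure of `SU(m + 1)` in the space of matrices
      IsEmbeddingSmooth 𝓘(ℝ, G.V) 𝓘(ℝ, Fin (m + 1) → Fin (m + 1) → ℂ)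
        (fun (g : SU m) (i j : Fin (m + 1)) => g.1 i j) ∧
      -- `X`, `P`, `L`, `A` are the quotient smooth structures
      IsSurjectiveSubmersion 𝓘(ℝ, G.V) 𝓘(ℝ, X.V) (Biquotient.mk (S12 m)) ∧
      IsSurjectiveSubmersion 𝓘(ℝ, Fin (m + 1) → ℂ) 𝓘(ℝ, P.V) (CP.mk (m := m)) ∧
      IsSurjectiveSubmersion 𝓘(ℝ, Fin m → Fin m → ℂ) 𝓘(ℝ, L.V) (flagOfFrame (m := m)) ∧
      IsSurjectiveSubmersion (𝓘(ℝ, G.V).prod 𝓘(ℝ, Fin m → ℂ)) 𝓘(ℝ, A.V)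
        (AssocBundle.mk (m := m)) ∧
      -- `E → ℂP^m` is the bundle `SU(m + 1) ×_{U(m)} ℂ^m`, and `F` is the smooth structure of
      -- its full flag bundle
      IsAssociatedBundle A E ∧
      E.IsFlagBundleStructure L F ∧
      Nonempty (Diffeomorph 𝓘(ℝ, X.V) 𝓘(ℝ, F.V) (Biquotient (S12 m)) E.FlagBundle ∞) := by
  have hm0 : 0 < m := by omega
  have hSU : IsManifold 𝓘(ℝ, (suStructure m).V) 1 (SU m) := IsManifold.of_le (n := ∞) (by simp)
  have hCP : IsManifold 𝓘(ℝ, (cpStructure m).V) 1 (CP m) := IsManifold.of_le (n := ∞) (by simp)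
  have hFl : IsManifold 𝓘(ℝ, (flagStructure m).V) 1 (FullFlag m (Fin m → ℂ)) :=
    IsManifold.of_le (n := ∞) (by simp)
  have hX := fiberedCharts_biquotient hm0
  have hF := fiberedCharts_flagBundle hm0
  -- The fibres of both quotient maps are the orbits of the diagonal torus of U(m), so the identity
  -- of SU(m + 1) descends to a diffeomorphism.
  obtain ⟨Φ, -⟩ := exists_diffeomorph_of_hasSmoothSections hX.contMDiff_quotient
    hX.hasSmoothSections hX.isQuotientMap.surjective hF.contMDiff_quotient hF.hasSmoothSections
    hF.isQuotientMap.surjective fun g g' =>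
      (biquotient_mk_eq_iff hm0).trans (toFlagBundle_eq_iff g g').symm
  exact ⟨actsFreelyModKernel_S12 hm0, suStructure m, biquotientStructure hm0, cpStructure m,
    flagStructure m, assocStructure hm0, assocVectorBundle m, inferInstance,
    flagBundleStructure hm0, isEmbeddingSmooth_SU m, hX.isSurjectiveSubmersion,
    (hasSmoothSections_CP_mk m).isSurjectiveSubmersion (surjective_CP_mk m) (contMDiff_CP_mk m),
    (hasSmoothSections_flagOfFrame m).isSurjectiveSubmersion surjective_flagOfFrame
      (contMDiff_flagOfFrame m),
    (fiberedCharts_assocBundle hm0).isSurjectiveSubmersion, isAssociatedBundle hm0,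
    isFlagBundleStructure hm0, ⟨Φ⟩⟩
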